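/- Let $E$ be a countable set, $\mathcal X=\{0,1\}^E$ the compact space of configurations $\xi\subset E$, and write $x\xi=\{x\}\cup\xi$, $\xi\setminus x=\xi\setminus\{x\}$. For $f\in C(\mathcal X)$ (real valued, sup-norm) put $\Delta_f(x)=\sup_\xi|f(x\xi)-f(\xi)|$, $|||f|||=\sum_x\Delta_f(x)$ and $D(\mathcal X)=\{f\in C(\mathcal X):|||f|||<\infty\}$. **The intensities.** Let $A$ be a bounded positive operator on $\mathcal H_0=\ell^2(E)$ (complex scalars) with $\ker A=\{0\}$. Let $\mathcal H_-$ be the completion of $\mathcal H_0$ for $\|f\|_-^2=(f,Af)_0$, and let $\mathcal H_+\subset\mathcal H_0$ be the completion of $\mathrm{Ran}\,A$ for $\|h\|_+^2=(h,A^{-1}h)_0$. Assume (H): $\mathcal H_-$ is functionally complete, i.e. its elements are functions on $E$: every $\|\cdot\|_-$-Cauchy sequence in $\mathcal H_0$ converges pointwise on $E$, and if its pointwise limit is $0$ then it converges to $0$ in $\|\cdot\|_-$. For $x\notin\xi$ let $$\alpha(x;\xi)=\lim_{\Lambda\uparrow E}\ \inf_{f\in\mathrm{span}\{e_y:\,y\in\Lambda\cap\xi\}}\|e_x-f\|_-^2,\qquad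 \beta(x;\xi)=\lim_{\Lambda\uparrow E}\ \inf_{g\in\mathrm{span}\{e_y:\,y\in\Lambda\setminus x\xi\}}\|e_x-g\|_+^2 ,$$ where $\Lambda$ runs over the finite subsets of $E$. Let $\mu$ be the determinantal point process on $E$ with kernel operator $K=A(I+A)^{-1}$, and $\mu_\Lambda(\xi_\Lambda)=\mu\{\zeta:\zeta\cap\Lambda=\xi\cap\Lambda\}$; the Papangelou intensity of $\mu$ at $(x;\xi)$ is $\lim_{\Lambda\uparrow E}\mu_\Lambda(x\xi_\Lambda)/\mu_\Lambda(\xi_\Lambda)$. **The rates.** For $x,y\notin\xi$, $x\ne y$, $$b(x;\xi)=\frac{\alpha(x;\xi)}{1+\alpha(x;\xi)},\quad d(x;x\xi)=\frac{\beta(x;\xi)}{1+\beta(x;\xi)},\quad c(x,y;x\xi)=d(x,y)\,\alpha(y;\xi)\Big(\frac1{(1+\alpha(x;\xi))(1+\alpha(y;\xi))}\Big)^{t},$$ and $c(x,y;\xi)=0$ unless $x\in\xi$, $y\notin\xi$. Here $0\le t\le1$ and $d(x,y)=d(y,x)\ge0$ is a weight with $0<\inf_x\sum_{y\ne x}d(x,y)\le\sup_x\sum_{y\neq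 x}d(x,y)<\infty$. On $D(\mathcal X)$ let $$L^{(G)}f(\xi)=\sum_{x\in\xi}d(x;\xi)[f(\xi\setminus x)-f(\xi)]+\sum_{y\notin\xi}b(y;\xi)[f(y\xi)-f(\xi)],\qquad L^{(K)}f(\xi)=\sum_{x\in\xi,\,y\notin\xi}c(x,y;\xi)[f(y\xi\setminus x)-f(\xi)].$$ **The interdependence constants.** For $x\ne u$ let $$\gamma^{(G)}(x,u)=\sup_{\xi\not\ni x,u}\{|b(x;\xi)-b(x;u\xi)|+|d(x;xu\xi)-d(x;x\xi)|\},\qquad \gamma^{(K)}(x,u)=\sum_{y\ne x}\gamma^{(K)}_y(x,u),$$ where $\gamma^{(K)}_y(x,u)=\sup_{\xi\not\ni x,y,u}\max\{|c(x,y;x\xi)-c(x,y;xu\xi)|,\,|c(y,x;y\xi)-c(y,x;yu\xi)|\}$ for $y\ne u$, and $\gamma^{(K)}_u(x,u)=\sup_{\xi\not\ni x,u}\max\{c(x,u;x\xi),c(u,x;u\xi)\}$. Put $\gamma^{(\#)}(x,x)=0$, $M^{(\#)}=\sup_x\sum_{u}\gamma^{(\#)}(x,u)$, and let $\Gamma^{(\#)}$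 act by $(\Gamma^{(\#)}\eta)(u)=\sum_x\eta(x)\gamma^{(\#)}(x,u)$. Further let $$\varepsilon^{(G)}=\inf_{x}\inf_{\xi\not\ni x}\{b(x;\xi)+d(x;x\xi)\},\qquad \varepsilon^{(K)}=\inf_y\inf_{\xi\not\ni y}\Big\{\sum_{x\in\xi}c(x,y;\xi)+\sum_{x\notin y\xi}c(y,x;y\xi)\Big\},$$ $$M_1^{(G)}=\sup_x\sum_{u\ne x}\ \sup_{\xi\not\ni x,u}(\alpha(x;\xi)-\alpha(x;u\xi)),\qquad M_1^{(K)}=\sup_x\sum_{u\ne x}\sum_{y\ne x}d(x,y)\,\delta_y(x,u),$$ where $\delta_y(x,u)=\sup_{\xi\not\ni x,y,u}[(\alpha(x;\xi)-\alpha(x;u\xi))+(\alpha(y;\xi)-\alpha(y;u\xi))]$ for $y\ne u$ and $\delta_u(x,u)=\sup_{\xi\not\ni x,u}[\alpha(x;\xi)+\alpha(u;\xi)]$. **Proposition.** There is a constant $a_0<\infty$, depending on $A$ only (not on $t$ or the weight $d$), such that $$M^{(\#)}\le a_0M_1^{(\#)},\qquad \#=G,K,$$ and in the Kawasaki case even $\gamma^{(K)}_y(x,u)\le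 a_0\,d(x,y)\,\delta_y(x,u)$ for all $x,y,u$ with $y\ne x$, $u\neq x$. Consequently, if $M_1^{(\#)}<\infty$, then $M^{(\#)}<\infty$, the number $\alpha(x;\xi)$ is the Papangelou intensity of $\mu$ (for all $x\notin\xi$ if $\#=G$; for all $\xi\not\ni x,y$ with $x\neq y$, $d(x,y)\ne0$ if $\#=K$), the operator $L^{(\#)}$ is well defined from $D(\mathcal X)$ to $C(\mathcal X)$ and closable, and: (a) the closure $\overline{L^{(\#)}}$ is a Markov generator, namely the generator of a Markov semigroup $T_s^{(\#)}$ on $C(\mathcal X)$; (b) $D(\mathcal X)$ is a core for $\overline{L^{(\#)}}$; (c) for $f\in D(\mathcal X)$ and $s\ge0$, $\Delta_{T_s^{(\#)}f}\le e^{-\varepsilon^{(\#)}s}\exp(s\Gamma^{(\#)})\Delta_f$ pointwise on $E$; (d) for $f\in D(\mathcal X)$ and $s\ge0$, $T_s^{(\#)}f\in D(\mathcal X)$ and $|||T_s^{(\#)}f|||\le\exp[(M^{(\#)}-\varepsilon^{(\#)})s]\,|||f|||$. -/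

import Mathlib

open Filter Topology MeasureTheory
open scoped NNReal ENNReal

noncomputable section

namespace DPPDynamics

/-! ### Configurations and functions of configurations -/

/-- Configurations `ξ ⊆ E`, identified with points of `{0,1}^E` (product topology and product
σ-algebra); `ξ x = true` means `x ∈ ξ`. -/
abbrev Config (E : Type*) : Type _ := E → Bool

variable {E : Type*} [DecidableEq E]

/-- `ξ ∪ {x}`. -/
def ins (x : E) (ξ : Config E) : Config E := Function.update ξ x true

/-- `ξ \ {x}`. -/
def del (x : E) (ξ : Config E) : Config E := Function.update ξ x false

/-- `Δ_f(x) = sup_ξ |f(ξ ∪ {x}) - f(ξ)|`. -/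
def osc (f : C(Config E, ℝ)) (x : E) : ℝ≥0∞ :=
  ⨆ ξ : Config E, ENNReal.ofReal |f (ins x ξ) - f ξ|

/-- `|||f||| = ∑_x Δ_f(x)`; the space `D(𝒳)` is `{f | |||f||| < ∞}`. -/
def tripleNorm (f : C(Config E, ℝ)) : ℝ≥0∞ := ∑' x, osc f x

/-! ### Markov semigroups and Markov generators on `C(X)` -/

/-- A Markov semigroup on `C(X)`. -/
structure IsMarkovSemigroup {X : Type*} [TopologicalSpace X] [CompactSpace X]
    (T : ℝ≥0 → C(X, ℝ) →ₗ[ℝ] C(X, ℝ)) : Prop where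
  zero : T 0 = LinearMap.id
  add : ∀ s t, T (s + t) = T s ∘ₗ T t
  right_continuous : ∀ f t, ContinuousWithinAt (fun s => T s f) (Set.Ici t) t
  one : ∀ t, T t 1 = 1
  nonneg : ∀ t f, 0 ≤ f → 0 ≤ T t f

/-- A Markov pregenerator on `C(X)`: `Ω1 = 0`, dense domain, and
`min f ≥ min (f - r Ωf)` for `f` in the domain and `r ≥ 0`. -/
structure IsMarkovPregenerator {X : Type*} [TopologicalSpace X] [CompactSpace X]
    (Ω : C(X, ℝ) →ₗ.[ℝ] C(X, ℝ)) : Prop where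
  one : ((1 : C(X, ℝ)), (0 : C(X, ℝ))) ∈ Ω.graph
  dense : Dense (Ω.domain : Set C(X, ℝ))
  min_principle : ∀ (f : Ω.domain) (r : ℝ), 0 ≤ r → ∀ m : ℝ,
    (∀ ξ, m ≤ ((f : C(X, ℝ)) - r • Ω f) ξ) → ∀ ξ, m ≤ (f : C(X, ℝ)) ξ

/-- A Markov generator: a closed Markov pregenerator with `R(I - rΩ) = C(X)` for all
sufficiently small `r > 0`. -/
structure IsMarkovGenerator {X : Type*} [TopologicalSpace X] [CompactSpace X]
    (Ω : C(X, ℝ) →ₗ.[ℝ] C(X, ℝ)) : Prop extends IsMarkovPregenerator Ω where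
  closed : Ω.IsClosed
  range : ∃ r₀ : ℝ, 0 < r₀ ∧ ∀ r : ℝ, 0 < r → r < r₀ →
    ∀ g : C(X, ℝ), ∃ f : Ω.domain, (f : C(X, ℝ)) - r • Ω f = g

/-- `Ω` is the infinitesimal generator of `T`: `f ∈ D(Ω)` and `Ωf = h` if and only if
`(T_s f - f)/s → h` in `C(X)` as `s ↓ 0`. -/
def Generates {X : Type*} [TopologicalSpace X] [CompactSpace X]
    (Ω : C(X, ℝ) →ₗ.[ℝ] C(X, ℝ)) (T : ℝ≥0 → C(X, ℝ) →ₗ[ℝ] C(X, ℝ)) : Prop :=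
  ∀ f h : C(X, ℝ), (f, h) ∈ Ω.graph ↔
    Tendsto (fun s : ℝ≥0 => (s : ℝ)⁻¹ • (T s f - f)) (𝓝[>] 0) (𝓝 h)

/-! ### The conclusions of Liggett's existence theorem -/

/-- `L` has domain `D(𝒳)` and `(Lf)(ξ) = ∑_i terms f ξ i` there. -/
def IsPregeneratorOn {ι : Type*} (terms : C(Config E, ℝ) → Config E → ι → ℝ)
    (L : C(Config E, ℝ) →ₗ.[ℝ] C(Config E, ℝ)) : Prop :=
  (∀ f, f ∈ L.domain ↔ tripleNorm f < ⊤) ∧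
    ∀ (f : L.domain) (ξ : Config E), HasSum (terms (f : C(Config E, ℝ)) ξ) (L f ξ)

/-- The action of `Γ = (γ(x,u))` on nonnegative functions: `(Γβ)(u) = ∑_x β(x) γ(x,u)`. -/
def gammaAct (γ : E → E → ℝ≥0∞) (β : E → ℝ≥0∞) (u : E) : ℝ≥0∞ := ∑' x, β x * γ x u

/-- `(exp(sΓ)β)(u) = ∑_n s^n / n! (Γ^n β)(u)`. -/
def expGamma (γ : E → E → ℝ≥0∞) (s : ℝ≥0) (β : E → ℝ≥0∞) (u : E) : ℝ≥0∞ :=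
  ∑' n : ℕ, ENNReal.ofReal ((s : ℝ) ^ n / (n.factorial : ℝ)) * ((gammaAct γ)^[n] β) u

/-- `M = sup_x ∑_u γ(x,u)`. -/
def rowSup (γ : E → E → ℝ≥0∞) : ℝ≥0∞ := ⨆ x, ∑' u, γ x u

/-- The operator `L` given by `terms` on `D(𝒳)` is well defined and closable, its closure is the
Markov generator of a Markov semigroup `T` with core `D(𝒳)`, and, with `M = sup_x ∑_u γ(x,u)`,
`Δ_{T_s f} ≤ e^{-εs} exp(sΓ) Δ_f` and `|||T_s f||| ≤ e^{(M-ε)s} |||f||| < ∞` for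
`f ∈ D(𝒳)`. -/
def ExistenceConclusions {ι : Type*} (terms : C(Config E, ℝ) → Config E → ι → ℝ)
    (γ : E → E → ℝ≥0∞) (ε : ℝ≥0∞) : Prop :=
  ∃ L : C(Config E, ℝ) →ₗ.[ℝ] C(Config E, ℝ), IsPregeneratorOn terms L ∧ L.IsClosable ∧
    ∃ T : ℝ≥0 → C(Config E, ℝ) →ₗ[ℝ] C(Config E, ℝ), IsMarkovSemigroup T ∧
      (IsMarkovGenerator L.closure ∧ Generates L.closure T) ∧
      L.closure.HasCore L.domain ∧
      (∀ f, tripleNorm f < ⊤ → ∀ (s : ℝ≥0) (u : E),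
        osc (T s f) u ≤ ENNReal.ofReal (Real.exp (-ε.toReal * s)) * expGamma γ s (osc f) u) ∧
      (∀ f, tripleNorm f < ⊤ → ∀ s : ℝ≥0, tripleNorm (T s f) < ⊤ ∧
        tripleNorm (T s f) ≤
          ENNReal.ofReal (Real.exp (((rowSup γ).toReal - ε.toReal) * s)) * tripleNorm f)

/-! ### Glauber dynamics with birth rates `b(x;ξ)` and death rates `d(x;ξ)` -/

/-- Summands of `L^{(G)} f(ξ)`. -/
def glauberTerms (b d : E → Config E → ℝ) (f : C(Config E, ℝ)) (ξ : Config E) (x : E) : ℝ :=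
  if ξ x = true then d x ξ * (f (del x ξ) - f ξ) else b x ξ * (f (ins x ξ) - f ξ)

/-- `γ^{(G)}(x,u)`. -/
def glauberGamma (b d : E → Config E → ℝ) (x u : E) : ℝ≥0∞ :=
  if u = x then 0 else
    ⨆ (ξ : Config E) (_ : ξ x = false ∧ ξ u = false),
      ENNReal.ofReal (|b x ξ - b x (ins u ξ)| + |d x (ins x (ins u ξ)) - d x (ins x ξ)|)

/-- `ε^{(G)}`. -/
def glauberEps (b d : E → Config E → ℝ) : ℝ≥0∞ :=
  ⨅ (x : E) (ξ : Config E) (_ : ξ x = false), ENNReal.ofReal (b x ξ + d x (ins x ξ))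

/-! ### Kawasaki dynamics with jump rates `c(x,y;ξ)` -/

/-- Summands of `L^{(K)} f(ξ)`. -/
def kawasakiTerms (c : E → E → Config E → ℝ) (f : C(Config E, ℝ)) (ξ : Config E)
    (p : E × E) : ℝ :=
  if ξ p.1 = true ∧ ξ p.2 = false then
    c p.1 p.2 ξ * (f (ins p.2 (del p.1 ξ)) - f ξ) else 0

/-- `c_{{x,y}}`. -/
def pairRate (c : E → E → Config E → ℝ) (x y : E) : ℝ≥0∞ :=
  ⨆ (ξ : Config E) (_ : ξ x = false ∧ ξ y = false),
    ENNReal.ofReal (max (c x y (ins x ξ)) (c y x (ins y ξ)))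

/-- The largest change of the jump rates between `x` and `y` when the occupation of the site `u ≠ x`
changes. If `u = y`, one of the two rates compared is zero, because a jump from `x` to `y` needs
`x` occupied and `y` empty; the largest change is then the largest rate. -/
def pairVariation (c : E → E → Config E → ℝ) (x y u : E) : ℝ≥0∞ :=
  if y = u then pairRate c x u else
    ⨆ (ξ : Config E) (_ : ξ x = false ∧ ξ y = false ∧ ξ u = false),
      ENNReal.ofReal (max |c x y (ins x ξ) - c x y (ins x (ins u ξ))|
        |c y x (ins y ξ) - c y x (ins y (ins u ξ))|)

/-- `γ^{(K)}(x,u)`. -/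
def kawasakiGamma (c : E → E → Config E → ℝ) (x u : E) : ℝ≥0∞ :=
  if u = x then 0 else ∑' y, if y = x then 0 else pairVariation c x y u

/-- `ε^{(K)}`. -/
def kawasakiEps (c : E → E → Config E → ℝ) : ℝ≥0∞ :=
  ⨅ (y : E) (ξ : Config E) (_ : ξ y = false),
    ((∑' x, if ξ x = true then ENNReal.ofReal (c x y ξ) else 0) +
      ∑' x, if ins y ξ x = false then ENNReal.ofReal (c y x (ins y ξ)) else 0)

/-! ### The operator `A`, the norms `‖·‖_-`, `‖·‖_+`, and the intensities -/

/-- `ℋ_0 = ℓ²(E)`. -/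
abbrev H0 (E : Type*) : Type _ := lp (fun _ : E => ℂ) 2

/-- The standard basis vector `e_x`. -/
def basisVec (x : E) : H0 E := lp.single 2 x (1 : ℂ)

/-- The matrix entry `B(x,y) = (e_x, B e_y)_0`. -/
def entry (B : H0 E →L[ℂ] H0 E) (x y : E) : ℂ := inner ℂ (basisVec x) (B (basisVec y))

/-- `‖f‖_-^2 = (f, Af)_0`. -/
def minusNormSq (A : H0 E →L[ℂ] H0 E) (f : H0 E) : ℝ := (inner ℂ f (A f)).re

/-- Cauchy sequences of `ℋ_0` with respect to `‖·‖_-`; the vectors of the completion `ℋ_-` are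
their classes. -/
def MinusCauchy (A : H0 E →L[ℂ] H0 E) (v : ℕ → H0 E) : Prop :=
  ∀ δ : ℝ, 0 < δ → ∃ N, ∀ m ≥ N, ∀ n ≥ N, minusNormSq A (v m - v n) < δ

/-- `ℋ_-` is functionally completed: the vector of `ℋ_-` represented by a Cauchy sequence `v` is a
function on `E`, the pointwise limit of `v`, and the vector is zero if this function is. -/
def HypothesisH (A : H0 E →L[ℂ] H0 E) : Prop :=
  ∀ v : ℕ → H0 E, MinusCauchy A v →
    (∀ x : E, ∃ z : ℂ, Tendsto (fun n => v n x) atTop (𝓝 z)) ∧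
    ((∀ x : E, Tendsto (fun n => v n x) atTop (𝓝 0)) →
      Tendsto (fun n => minusNormSq A (v n)) atTop (𝓝 0))

/-- `h ∈ ℋ_+` and `‖h‖_+ = r`. Here `ℋ_+ ⊆ ℋ_0` is the completion of `Ran A` with respect to
`‖Av‖_+^2 = (Av, A⁻¹Av)_0 = ‖v‖_-^2`. -/
def HasPlusNorm (A : H0 E →L[ℂ] H0 E) (h : H0 E) (r : ℝ) : Prop :=
  0 ≤ r ∧ ∃ v : ℕ → H0 E, MinusCauchy A v ∧ Tendsto (fun n => A (v n)) atTop (𝓝 h) ∧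
    Tendsto (fun n => minusNormSq A (v n)) atTop (𝓝 (r ^ 2))

/-- The span of `{e_x : x ∈ S}`. -/
def locSpan (S : Set E) : Submodule ℂ (H0 E) := Submodule.span ℂ (basisVec '' S)

/-- `α(x;ξ)`: the limit over finite `Λ ↑ E` of the decreasing net
`α_Λ = inf {‖e_x - f‖_-^2 : f ∈ span{e_y : y ∈ Λ ∩ ξ}}`. -/
def intensity (A : H0 E →L[ℂ] H0 E) (x : E) (ξ : Config E) : ℝ :=
  ⨅ Λ : Finset E,
    sInf {r : ℝ | ∃ f ∈ locSpan {y : E | y ∈ Λ ∧ ξ y = true}, r = minusNormSq A (basisVec x - f)}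

/-- `β(x;ξ)`: the limit over finite `Λ ↑ E` of the decreasing net
`β_Λ = inf {‖e_x - g‖_+^2 : g ∈ span{e_y : y ∈ Λ \ (ξ ∪ {x})}}`. -/
def dualIntensity (A : H0 E →L[ℂ] H0 E) (x : E) (ξ : Config E) : ℝ :=
  ⨅ Λ : Finset E,
    sInf {s : ℝ | ∃ g ∈ locSpan {y : E | y ∈ Λ ∧ ξ y = false ∧ y ≠ x},
      ∃ r : ℝ, HasPlusNorm A (basisVec x - g) r ∧ s = r ^ 2}

/-- `K = A (I + A)⁻¹`. -/
def dppKernel (A : H0 E →L[ℂ] H0 E) : H0 E →L[ℂ] H0 E := A * Ring.inverse (1 + A)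

/-- `μ` is the determinantal point process with kernel operator `K`. -/
def IsDPP (K : H0 E →L[ℂ] H0 E) (μ : Measure (Config E)) : Prop :=
  IsProbabilityMeasure μ ∧ ∀ S : Finset E,
    ((μ.real {ξ : Config E | ∀ x ∈ S, ξ x = true} : ℝ) : ℂ) =
      (Matrix.of fun i j : S => entry K (i : E) (j : E)).det

/-- `μ_Λ(ξ_Λ) = μ {ζ : ζ_Λ = ξ_Λ}`. -/
def localMarginal (μ : Measure (Config E)) (Λ : Finset E) (ξ : Config E) : ℝ :=
  μ.real {ζ : Config E | ∀ y ∈ Λ, ζ y = ξ y}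

/-- `a` is the Papangelou intensity of `μ` at `x ∉ ξ`: the limit over finite `Λ ↑ E` of
`μ_Λ(ξ_Λ ∪ {x}) / μ_Λ(ξ_Λ)`. -/
def IsPapangelou (μ : Measure (Config E)) (x : E) (ξ : Config E) (a : ℝ) : Prop :=
  Tendsto (fun Λ : Finset E => localMarginal μ Λ (ins x ξ) / localMarginal μ Λ ξ) atTop (𝓝 a)

/-! ### The rates built from the intensities -/

/-- `b(x;ξ) = α(x;ξ) / (1 + α(x;ξ))` for `x ∉ ξ`. -/
def birthRate (A : H0 E →L[ℂ] H0 E) (x : E) (ξ : Config E) : ℝ :=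
  if ξ x = false then intensity A x ξ / (1 + intensity A x ξ) else 0

/-- `d(x;ξ) = β(x;ξ \ {x}) / (1 + β(x;ξ \ {x}))` for `x ∈ ξ`. -/
def deathRate (A : H0 E →L[ℂ] H0 E) (x : E) (ξ : Config E) : ℝ :=
  if ξ x = true then dualIntensity A x (del x ξ) / (1 + dualIntensity A x (del x ξ)) else 0

/-- `g_t(u,v) = (1 / ((1+u)(1+v)))^t`. -/
def gFun (t u v : ℝ) : ℝ := (1 / ((1 + u) * (1 + v))) ^ t

/-- `c(x,y;ξ) = w(x,y) α(y;ξ \ {x}) g_t(α(x;ξ \ {x}), α(y;ξ \ {x}))` for `x ∈ ξ`, `y ∉ ξ`, and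
zero otherwise. -/
def jumpRate (A : H0 E →L[ℂ] H0 E) (w : E → E → ℝ≥0) (t : ℝ) (x y : E) (ξ : Config E) : ℝ :=
  if ξ x = true ∧ ξ y = false then
    (w x y : ℝ) * intensity A y (del x ξ) *
      gFun t (intensity A x (del x ξ)) (intensity A y (del x ξ))
  else 0

/-- `∑_{y ≠ x} w(x,y)`. -/
def weightSum (w : E → E → ℝ≥0) (x : E) : ℝ≥0∞ := ∑' y, if y = x then 0 else (w x y : ℝ≥0∞)

/-- `M_1^{(G)}`. -/
def glauberM1 (A : H0 E →L[ℂ] H0 E) : ℝ≥0∞ :=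
  ⨆ x : E, ∑' u, if u = x then 0 else
    ⨆ (ξ : Config E) (_ : ξ x = false ∧ ξ u = false),
      ENNReal.ofReal (intensity A x ξ - intensity A x (ins u ξ))

/-- The largest change of `α(x;ξ) + α(y;ξ)`, `ξ ∌ x, y`, when `u ≠ x` becomes occupied. If `u = y`,
no jump between `x` and `y` remains possible, and the intensities of the pair then count
as zero. -/
def intensityVariation (A : H0 E →L[ℂ] H0 E) (x y u : E) : ℝ≥0∞ :=
  if y = u then
    ⨆ (ξ : Config E) (_ : ξ x = false ∧ ξ u = false),
      ENNReal.ofReal (intensity A x ξ + intensity A u ξ)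
  else
    ⨆ (ξ : Config E) (_ : ξ x = false ∧ ξ y = false ∧ ξ u = false),
      ENNReal.ofReal ((intensity A x ξ - intensity A x (ins u ξ)) +
        (intensity A y ξ - intensity A y (ins u ξ)))

/-- `M_1^{(K)}`. -/
def kawasakiM1 (A : H0 E →L[ℂ] H0 E) (w : E → E → ℝ≥0) : ℝ≥0∞ :=
  ⨆ x : E, ∑' u, if u = x then 0 else
    ∑' y, if y = x then 0 else (w x y : ℝ≥0∞) * intensityVariation A x y u

end DPPDynamics

end

/-! The intensity α(x;ξ) is a squared distance in ℋ_-, so it lies in [0, ‖A‖] and decreases as ξ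
grows. If M₁ is finite, its drops caused by single sites are summable. By monotonicity α is then
controlled, up to a small tail, by the configuration on a finite set; hence it is continuous where
the dynamics needs it.

With B = A^{1/2} one has ‖f‖_- = ‖Bf‖ and ‖Bk‖_+ = ‖k‖, and (H) puts every e_x into Ran B.
Cauchy–Schwarz gives αβ ≥ 1 always. An orthogonal projection gives β(x;ξ) α(x;ξ') ≤ 1 when ξ' is ξ
filled up outside a finite set, and summable variation removes the difference between ξ' and ξ. So
αβ = 1 (`HasVariation.intensity_mul_dualIntensity`). This has two uses. The death rate becomes
1/(1+α), so the Glauber rates are 1-Lipschitz functions of α. And α is the Papangelou intensity: the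
local probabilities are determinants whose rows are taken from K or 1 - K, their ratios are minima
of quadratic forms (`det_rowsOrOne_ratio`), and these bounds squeeze the ratio between 1/β_Λ and α_Λ
(`isPapangelou_intensity`). The Kawasaki rates involve α only; on [0, ‖A‖] they are Lipschitz in the
two intensities, up to the weight, with constant 1 + ‖A‖ for every t in [0,1]. Hence a₀ = 2 + ‖A‖
serves both dynamics.

The rest is Liggett's existence theorem, proved for abstract moves and rates (`IsSpinSystem`). At a
configuration where |f(η) - f(η \ u)| is maximal, each move can only decrease this discrepancy,
except for an influx governed by Γ. This is the maximum principle (1 + lε) Δ_f(u) ≤ Δ_{f - lLf}(u) +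
l (ΓΔ_f)(u), obtained from `oscR_resolvent`; along a semigroup it integrates to Δ ≤ e^{-εs} exp(sΓ)
Δ_f. Finitely many moves give a bounded generator and a contraction semigroup with this bound for ε
= 0, uniformly in the set of moves. Duhamel's formula then makes these semigroups converge. The
limit T leaves D(𝒳) invariant, so D(𝒳), being dense, is a core, and the inequality for the full
generator can be run along T to recover ε. For the two dynamics the hypotheses of this theorem are
checked by the basic coupling of η and η \ u (`isSpinSystem_glauber`, `jump_discrepancy_le`). -/

noncomputable section

namespace DPPDynamics

/-! ### Strongly continuous contraction semigroups on a Banach space -/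

section Semigroup

variable {V : Type*} [NormedAddCommGroup V] [NormedSpace ℝ V]

/-- A strongly continuous semigroup of contractions. -/
structure IsContractionSemigroup (T : ℝ≥0 → V →L[ℝ] V) : Prop where
  zero : ∀ f, T 0 f = f
  add : ∀ s t f, T (s + t) f = T s (T t f)
  norm_le : ∀ s f, ‖T s f‖ ≤ ‖f‖
  continuous : ∀ f, Continuous fun s => T s f

/-- The graph of the infinitesimal generator. -/
def generatorGraph (T : ℝ≥0 → V →L[ℝ] V) : Set (V × V) :=
  {p | Tendsto (fun s : ℝ≥0 => (s : ℝ)⁻¹ • (T s p.1 - p.1)) (𝓝[>] 0) (𝓝 p.2)}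

/-- The orbit of a vector, with real time parameter. -/
def orbit (T : ℝ≥0 → V →L[ℝ] V) (f : V) (s : ℝ) : V := T s.toNNReal f

theorem tendsto_coe_nhdsGT_zero : Tendsto (fun z : ℝ≥0 => (z : ℝ)) (𝓝[>] 0) (𝓝[>] 0) := by
  refine tendsto_nhdsWithin_iff.2 ⟨?_, ?_⟩
  · exact (NNReal.continuous_coe.tendsto 0).mono_left nhdsWithin_le_nhds
  · filter_upwards [self_mem_nhdsWithin] with z hz
    simpa using hz

namespace IsContractionSemigroup

variable {T : ℝ≥0 → V →L[ℝ] V} (hT : IsContractionSemigroup T)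
include hT

theorem continuous_orbit (f : V) : Continuous (orbit T f) :=
  (hT.continuous f).comp continuous_real_toNNReal

theorem orbit_zero (f : V) : orbit T f 0 = f := by simp [orbit, hT.zero]

theorem orbit_add (f : V) {s t : ℝ} (hs : 0 ≤ s) (ht : 0 ≤ t) :
    orbit T f (s + t) = orbit T (orbit T f t) s := by
  simp [orbit, Real.toNNReal_add hs ht, hT.add]

theorem norm_orbit_le (f : V) (s : ℝ) : ‖orbit T f s‖ ≤ ‖f‖ := hT.norm_le _ _

theorem hasDerivWithinAt_orbit {f h : V} (hf : (f, h) ∈ generatorGraph T) {s : ℝ} (hs : 0 ≤ s) :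
    HasDerivWithinAt (orbit T f) (orbit T h s) (Set.Ioi s) s := by
  rw [hasDerivWithinAt_iff_tendsto_slope' (by simp)]
  have h1 : Tendsto (fun z : ℝ => (z - s).toNNReal) (𝓝[>] s) (𝓝[>] 0) := by
    refine tendsto_nhdsWithin_iff.2 ⟨?_, ?_⟩
    · have : Continuous fun z : ℝ => (z - s).toNNReal := by fun_prop
      simpa using (this.tendsto s).mono_left nhdsWithin_le_nhds
    · filter_upwards [self_mem_nhdsWithin] with z hz
      simpa using hz
  have h2 : Tendsto (fun z : ℝ => T s.toNNReal (((z - s).toNNReal : ℝ)⁻¹ •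
      (T (z - s).toNNReal f - f))) (𝓝[>] s) (𝓝 (T s.toNNReal h)) :=
    ((T s.toNNReal).continuous.tendsto h).comp (hf.comp h1)
  refine h2.congr' ?_
  filter_upwards [self_mem_nhdsWithin] with z hz
  have hz' : 0 ≤ z - s := sub_nonneg.2 (le_of_lt hz)
  have h3 : z.toNNReal = s.toNNReal + (z - s).toNNReal := by
    rw [← Real.toNNReal_add hs hz']; congr 1; ring
  simp only [slope_def_module, orbit, map_smul, map_sub, Real.coe_toNNReal _ hz']
  rw [h3, hT.add]

theorem hasDerivAt_integral_orbit [CompleteSpace V] (h : V) (s : ℝ) :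
    HasDerivAt (fun s => ∫ r in (0 : ℝ)..s, orbit T h r) (orbit T h s) s :=
  ((hT.continuous_orbit h).integral_hasStrictDerivAt 0 s).hasDerivAt

/-- The right derivative at 0 propagates along the orbit, and a continuous function is the integral
of its continuous right derivative. The integrated form survives limits in both f and h, which is
what closedness and the core argument need. -/
theorem mem_generatorGraph_iff [CompleteSpace V] {f h : V} :
    (f, h) ∈ generatorGraph T ↔
      ∀ s : ℝ, 0 ≤ s → orbit T f s - f = ∫ r in (0 : ℝ)..s, orbit T h r := by
  constructor
  · intro hf s hs
    rw [intervalIntegral.integral_eq_sub_of_hasDeriv_right_of_le hs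
      (hT.continuous_orbit f).continuousOn
      (fun r hr => hT.hasDerivWithinAt_orbit hf hr.1.le)
      ((hT.continuous_orbit h).intervalIntegrable _ _), hT.orbit_zero]
  · intro H
    have h0 := (hT.hasDerivAt_integral_orbit h 0).hasDerivWithinAt (s := Set.Ioi 0)
    rw [hasDerivWithinAt_iff_tendsto_slope' (by simp), hT.orbit_zero] at h0
    refine (h0.comp tendsto_coe_nhdsGT_zero).congr' ?_
    filter_upwards [self_mem_nhdsWithin] with z hz
    have := H z z.2
    simp only [orbit, Real.toNNReal_coe] at this
    simp only [Function.comp, slope_def_module, this, intervalIntegral.integral_same, sub_zero]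
    rfl

theorem norm_integral_orbit_le (f : V) (s : ℝ) :
    ‖∫ r in (0 : ℝ)..s, orbit T f r‖ ≤ ‖f‖ * |s| := by
  simpa using intervalIntegral.norm_integral_le_of_norm_le_const (a := 0) (b := s)
    (f := orbit T f) (C := ‖f‖) (fun x _ => hT.norm_orbit_le f x)

theorem integral_orbit_sub (f g : V) (s : ℝ) :
    ∫ r in (0 : ℝ)..s, orbit T (f - g) r =
      (∫ r in (0 : ℝ)..s, orbit T f r) - ∫ r in (0 : ℝ)..s, orbit T g r := by
  rw [← intervalIntegral.integral_sub ((hT.continuous_orbit f).intervalIntegrable _ _)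
    ((hT.continuous_orbit g).intervalIntegrable _ _)]
  simp [orbit]

theorem continuous_integral_orbit (s : ℝ) :
    Continuous fun f : V => ∫ r in (0 : ℝ)..s, orbit T f r := by
  refine (LipschitzWith.of_dist_le_mul (K := |s|.toNNReal) fun f g => ?_).continuous
  rw [dist_eq_norm, ← hT.integral_orbit_sub, dist_eq_norm, Real.coe_toNNReal _ (abs_nonneg s),
    mul_comm]
  exact hT.norm_integral_orbit_le _ _

theorem isClosed_generatorGraph [CompleteSpace V] : IsClosed (generatorGraph T) := by
  have : generatorGraph T = ⋂ s : ℝ, ⋂ _ : 0 ≤ s,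
      {p : V × V | orbit T p.1 s - p.1 = ∫ r in (0 : ℝ)..s, orbit T p.2 r} := by
    ext ⟨f, h⟩
    simp [hT.mem_generatorGraph_iff]
  rw [this]
  refine isClosed_iInter fun s => isClosed_iInter fun _ => isClosed_eq ?_ ?_
  · exact ((T s.toNNReal).continuous.comp continuous_fst).sub continuous_fst
  · exact (hT.continuous_integral_orbit s).comp continuous_snd

/-- Shifting the integral of the orbit by s leaves only two end pieces. This smoothing puts vectors
into the domain for arbitrary f. -/
theorem integral_mem_generatorGraph [CompleteSpace V] (f : V) {τ : ℝ} (hτ : 0 ≤ τ) :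
    (∫ r in (0 : ℝ)..τ, orbit T f r, orbit T f τ - f) ∈ generatorGraph T := by
  rw [hT.mem_generatorGraph_iff]
  intro s hs
  have hi : ∀ a b : ℝ, IntervalIntegrable (orbit T f) volume a b :=
    fun a b => (hT.continuous_orbit f).intervalIntegrable _ _
  have e1 : orbit T (∫ r in (0 : ℝ)..τ, orbit T f r) s = ∫ r in (s : ℝ)..(s + τ), orbit T f r := by
    have : orbit T (∫ r in (0 : ℝ)..τ, orbit T f r) s =
        ∫ r in (0 : ℝ)..τ, T s.toNNReal (orbit T f r) :=
      ((T s.toNNReal).intervalIntegral_comp_comm (hi 0 τ)).symm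
    rw [this]
    have e2 : ∫ r in (0 : ℝ)..τ, T s.toNNReal (orbit T f r) =
        ∫ r in (0 : ℝ)..τ, orbit T f (s + r) := by
      refine intervalIntegral.integral_congr fun r hr => ?_
      rw [Set.uIcc_of_le hτ] at hr
      exact (hT.orbit_add f hs hr.1).symm
    rw [e2, intervalIntegral.integral_comp_add_left (fun r => orbit T f r) s, add_zero]
  have e3 : ∫ r in (0 : ℝ)..s, orbit T (orbit T f τ) r = ∫ r in (τ : ℝ)..(s + τ), orbit T f r := by
    have : ∫ r in (0 : ℝ)..s, orbit T (orbit T f τ) r = ∫ r in (0 : ℝ)..s, orbit T f (r + τ) := by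
      refine intervalIntegral.integral_congr fun r hr => ?_
      rw [Set.uIcc_of_le hs] at hr
      exact (hT.orbit_add f hr.1 hτ).symm
    rw [this, intervalIntegral.integral_comp_add_right (fun r => orbit T f r) τ, zero_add]
  rw [hT.integral_orbit_sub, e1, e3,
    ← intervalIntegral.integral_add_adjacent_intervals (hi 0 s) (hi s τ),
    ← intervalIntegral.integral_add_adjacent_intervals (hi s τ) (hi τ (s + τ))]
  abel

/-- A dense invariant subspace of the domain of the generator is a core. -/
theorem generatorGraph_subset_closure [CompleteSpace V] (G : Submodule ℝ (V × V))
    (hG : (G : Set (V × V)) ⊆ generatorGraph T)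
    (hdense : Dense (Prod.fst '' (G : Set (V × V))))
    (hinv : ∀ p ∈ G, ∀ s, (T s p.1, T s p.2) ∈ G) :
    generatorGraph T ⊆ closure (G : Set (V × V)) := by
  have hi : ∀ f (a b : ℝ), IntervalIntegrable (orbit T f) volume a b :=
    fun f a b => (hT.continuous_orbit f).intervalIntegrable _ _
  have hclosed : IsClosed (closure (G : Set (V × V))) := isClosed_closure
  have hconv : Convex ℝ (closure (G : Set (V × V))) := G.convex.closure
  -- Time averages of orbits lie in the closure of G: for f in the projection of G by convexity and
  -- invariance, for general f because the condition is closed in f and the projection is dense.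
  have key : ∀ τ : ℝ, 0 < τ → ∀ f : V,
      (τ⁻¹ • ∫ r in (0 : ℝ)..τ, orbit T f r, τ⁻¹ • (orbit T f τ - f)) ∈
        closure (G : Set (V × V)) := by
    intro τ hτ
    have hcl : IsClosed {f : V | (τ⁻¹ • ∫ r in (0 : ℝ)..τ, orbit T f r,
        τ⁻¹ • (orbit T f τ - f)) ∈ closure (G : Set (V × V))} := by
      refine hclosed.preimage ?_
      exact ((hT.continuous_integral_orbit τ).const_smul _).prodMk
        (((T τ.toNNReal).continuous.sub continuous_id).const_smul _)
    have hsub : Prod.fst '' (G : Set (V × V)) ⊆ {f : V | (τ⁻¹ • ∫ r in (0 : ℝ)..τ, orbit T f r,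
        τ⁻¹ • (orbit T f τ - f)) ∈ closure (G : Set (V × V))} := by
      rintro _ ⟨⟨f, h⟩, hp, rfl⟩
      have h1 := (hT.mem_generatorGraph_iff.1 (hG hp)) τ hτ.le
      simp only [Set.mem_ofPred_eq]
      rw [h1]
      have hc : Continuous fun r => (orbit T f r, orbit T h r) :=
        (hT.continuous_orbit f).prodMk (hT.continuous_orbit h)
      have hav := hconv.set_average_mem hclosed (μ := volume) (t := Set.uIoc 0 τ)
        (f := fun r => (orbit T f r, orbit T h r)) (by simp [Set.uIoc_of_le hτ.le, hτ])
        (by simp [Set.uIoc_of_le hτ.le]) (ae_of_all _ fun r => subset_closure (hinv _ hp _))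
        (intervalIntegrable_iff.1 (hc.intervalIntegrable 0 τ))
      rw [interval_average_eq, sub_zero] at hav
      convert hav using 1
      have hci := hc.intervalIntegrable 0 τ (μ := volume)
      have e1 := (ContinuousLinearMap.fst ℝ V V).intervalIntegral_comp_comm hci
      have e2 := (ContinuousLinearMap.snd ℝ V V).intervalIntegral_comp_comm hci
      simp only [ContinuousLinearMap.coe_fst', ContinuousLinearMap.coe_snd'] at e1 e2
      rw [e1, e2]
      rfl
    intro f
    exact hcl.closure_subset_iff.2 hsub (hdense f)
  -- As τ ↓ 0 the averaged pairs converge to (f, h), by continuity of the orbit and by the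
  -- definition of the generator.
  rintro ⟨f, h⟩ hf
  have h0 := (hT.hasDerivAt_integral_orbit f 0).hasDerivWithinAt (s := Set.Ioi 0)
  rw [hasDerivWithinAt_iff_tendsto_slope' (by simp), hT.orbit_zero] at h0
  refine hclosed.mem_of_tendsto ((h0.comp tendsto_coe_nhdsGT_zero).prodMk_nhds hf) ?_
  filter_upwards [self_mem_nhdsWithin] with z hz
  have := key z (by exact_mod_cast hz) f
  simpa [slope_def_module, orbit] using this

/-- The resolvent equation `f - r G f = g` is solvable for all `r > 0`. -/
theorem exists_resolvent [CompleteSpace V] {r : ℝ} (hr : 0 < r) (g : V) :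
    ∃ f h, (f, h) ∈ generatorGraph T ∧ f - r • h = g := by
  -- The rescaled, damped semigroup U has generator rG - 1, so the resolvent equation asks for f
  -- with -(generator of U) f = g. The time integral of U over [0,1] applied to g' has generator
  -- value U₁g' - g', and ‖U₁‖ ≤ e⁻¹ < 1 lets g' - U₁g' = g be solved by a Neumann series.
  let U : ℝ≥0 → V →L[ℝ] V := fun t => Real.exp (-t) • T (r.toNNReal * t)
  have hU : IsContractionSemigroup U := by
    refine ⟨fun f => ?_, fun s t f => ?_, fun s f => ?_, fun f => ?_⟩
    · simp [U, hT.zero]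
    · simp only [U, NNReal.coe_add, neg_add, Real.exp_add, mul_add, smul_apply,
        hT.add, map_smul, smul_smul]
      rw [mul_comm]
    · simp only [U, smul_apply, norm_smul, Real.norm_eq_abs, Real.abs_exp]
      calc Real.exp (-s) * ‖T (r.toNNReal * s) f‖ ≤ 1 * ‖f‖ := by
            gcongr
            · simp
            · exact hT.norm_le _ _
        _ = ‖f‖ := one_mul _
    · have := (hT.continuous f).comp (continuous_const_mul r.toNNReal)
      exact (Real.continuous_exp.comp NNReal.continuous_coe.neg).smul this
  have hgen : ∀ p ∈ generatorGraph U, (p.1, r⁻¹ • (p.2 + p.1)) ∈ generatorGraph T := by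
    rintro ⟨f, h⟩ hp
    have hp' : Tendsto (fun s : ℝ≥0 => (s : ℝ)⁻¹ • (U s f - f)) (𝓝[>] 0) (𝓝 h) := hp
    have he : Tendsto (fun s : ℝ≥0 => (s : ℝ)⁻¹ * (Real.exp s - 1)) (𝓝[>] 0) (𝓝 1) := by
      have h0 := (Real.hasDerivAt_exp 0).hasDerivWithinAt (s := Set.Ioi 0)
      rw [hasDerivWithinAt_iff_tendsto_slope' (by simp), Real.exp_zero] at h0
      simpa [slope_def_module, Function.comp_def] using h0.comp tendsto_coe_nhdsGT_zero
    have hexp : Tendsto (fun s : ℝ≥0 => Real.exp s) (𝓝[>] 0) (𝓝 1) := by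
      have : Continuous fun s : ℝ≥0 => Real.exp s := by fun_prop
      simpa using (this.tendsto 0).mono_left nhdsWithin_le_nhds
    have h2 : Tendsto (fun s : ℝ≥0 => (s : ℝ)⁻¹ • (T (r.toNNReal * s) f - f)) (𝓝[>] 0)
        (𝓝 (h + f)) := by
      have := (hexp.smul hp').add (he.smul_const f)
      rw [one_smul, one_smul] at this
      refine this.congr fun s => ?_
      simp only [U, smul_apply, smul_sub, sub_smul, smul_smul, mul_sub, mul_one]
      have : Real.exp s * ((s : ℝ)⁻¹ * Real.exp (-s)) = (s : ℝ)⁻¹ := by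
        rw [mul_left_comm, ← Real.exp_add]; simp
      rw [this, mul_comm (Real.exp _)]
      abel
    have hsc : Tendsto (fun s : ℝ≥0 => r.toNNReal⁻¹ * s) (𝓝[>] 0) (𝓝[>] 0) := by
      refine tendsto_nhdsWithin_iff.2 ⟨?_, ?_⟩
      · simpa using ((continuous_const_mul r.toNNReal⁻¹).tendsto 0).mono_left nhdsWithin_le_nhds
      · filter_upwards [self_mem_nhdsWithin] with z hz
        have : 0 < r.toNNReal := by simpa using hr
        exact mul_pos (inv_pos.2 this) hz
    have h3 := (h2.comp hsc).const_smul r⁻¹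
    refine h3.congr fun s => ?_
    have hr' : r.toNNReal ≠ 0 := by simpa using hr
    have hrr : ((r.toNNReal : ℝ≥0) : ℝ) = r := Real.coe_toNNReal r hr.le
    simp only [Function.comp]
    rw [mul_inv_cancel_left₀ hr']
    simp only [smul_smul, NNReal.coe_mul, NNReal.coe_inv, hrr]
    congr 1
    field_simp
  have hnorm : ‖U 1‖ < 1 := by
    have h1 : ‖U 1‖ ≤ Real.exp (-1) := by
      refine ContinuousLinearMap.opNorm_le_bound _ (Real.exp_pos _).le fun f => ?_
      simp only [U, smul_apply, norm_smul, Real.norm_eq_abs, Real.abs_exp]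
      exact mul_le_mul_of_nonneg_left (hT.norm_le _ _) (Real.exp_pos _).le
    exact h1.trans_lt (by simp)
  obtain ⟨g', hg'⟩ : ∃ g' : V, g' - U 1 g' = g := by
    let u := Units.oneSub (U 1) hnorm
    refine ⟨(↑u⁻¹ : V →L[ℝ] V) g, ?_⟩
    have h2 : (u : V →L[ℝ] V) * (↑u⁻¹ : V →L[ℝ] V) = 1 := u.mul_inv
    have := congrArg (fun W : V →L[ℝ] V => W g) h2
    simpa [u, Units.val_oneSub] using this
  have hm := hgen _ (hU.integral_mem_generatorGraph g' zero_le_one)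
  refine ⟨_, _, hm, ?_⟩
  rw [smul_smul, mul_inv_cancel₀ hr.ne', one_smul]
  have : orbit U g' 1 = U 1 g' := by simp [orbit]
  simp only [this]
  rw [← hg']
  abel

end IsContractionSemigroup

end Semigroup

end DPPDynamics

end

noncomputable section

namespace DPPDynamics

variable {E : Type*} [DecidableEq E]

/-! ### Oscillations -/

/-- `Δ_f(x)` as a real number. -/
def oscR (f : C(Config E, ℝ)) (x : E) : ℝ := (osc f x).toReal

theorem osc_le_iff {f : C(Config E, ℝ)} {x : E} {c : ℝ} (hc : 0 ≤ c) :
    osc f x ≤ ENNReal.ofReal c ↔ ∀ ξ, |f (ins x ξ) - f ξ| ≤ c := by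
  simp [osc, iSup_le_iff, ENNReal.ofReal_le_ofReal_iff hc]

theorem osc_lt_top (f : C(Config E, ℝ)) (x : E) : osc f x < ⊤ := by
  refine lt_of_le_of_lt ((osc_le_iff (c := 2 * ‖f‖) (by positivity)).2 fun ξ => ?_)
    ENNReal.ofReal_lt_top
  have h1 := f.norm_coe_le_norm (ins x ξ)
  have h2 := f.norm_coe_le_norm ξ
  have h3 := norm_sub_le (f (ins x ξ)) (f ξ)
  rw [← Real.norm_eq_abs]
  linarith

theorem ofReal_oscR (f : C(Config E, ℝ)) (x : E) : ENNReal.ofReal (oscR f x) = osc f x :=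
  ENNReal.ofReal_toReal (osc_lt_top f x).ne

theorem oscR_nonneg (f : C(Config E, ℝ)) (x : E) : 0 ≤ oscR f x := ENNReal.toReal_nonneg

theorem oscR_le_iff {f : C(Config E, ℝ)} {x : E} {c : ℝ} (hc : 0 ≤ c) :
    oscR f x ≤ c ↔ ∀ ξ, |f (ins x ξ) - f ξ| ≤ c := by
  rw [← osc_le_iff hc, ← ofReal_oscR, ENNReal.ofReal_le_ofReal_iff hc]

theorem abs_ins_sub_le (f : C(Config E, ℝ)) (x : E) (ξ : Config E) :
    |f (ins x ξ) - f ξ| ≤ oscR f x :=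
  (oscR_le_iff (oscR_nonneg f x)).1 le_rfl ξ

theorem ins_eq_self {x : E} {ξ : Config E} (h : ξ x = true) : ins x ξ = ξ := by
  simp [ins, ← h]

theorem del_eq_self {x : E} {ξ : Config E} (h : ξ x = false) : del x ξ = ξ := by
  simp [del, ← h]

@[simp] theorem ins_same (x : E) (ξ : Config E) : ins x ξ x = true := by simp [ins]

@[simp] theorem del_same (x : E) (ξ : Config E) : del x ξ x = false := by simp [del]

theorem ins_of_ne {x y : E} (h : y ≠ x) (ξ : Config E) : ins x ξ y = ξ y := by simp [ins, h]

theorem del_of_ne {x y : E} (h : y ≠ x) (ξ : Config E) : del x ξ y = ξ y := by simp [del, h]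

@[simp] theorem ins_del (x : E) (ξ : Config E) : ins x (del x ξ) = ins x ξ := by simp [ins, del]

@[simp] theorem del_ins (x : E) (ξ : Config E) : del x (ins x ξ) = del x ξ := by simp [ins, del]

theorem continuous_ins (x : E) : Continuous (ins x : Config E → Config E) :=
  continuous_id.update x continuous_const

theorem continuous_del (x : E) : Continuous (del x : Config E → Config E) :=
  continuous_id.update x continuous_const

theorem abs_sub_le_of_eq_off (f : C(Config E, ℝ)) {x : E} {η ζ : Config E}
    (h : ∀ y, y ≠ x → η y = ζ y) : |f η - f ζ| ≤ oscR f x := by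
  by_cases hx : η x = ζ x
  · have : η = ζ := by
      ext1 y
      by_cases hy : y = x
      · rw [hy, hx]
      · exact h y hy
    simp [this, oscR_nonneg]
  · cases h1 : η x
    · have h2 : ζ = ins x η := by
        ext1 y
        by_cases hy : y = x
        · subst hy; simpa [h1] using hx
        · rw [ins_of_ne hy, h y hy]
      rw [h2, abs_sub_comm]
      exact abs_ins_sub_le f x η
    · have h2 : η = ins x ζ := by
        ext1 y
        by_cases hy : y = x
        · subst hy; simp [h1]
        · rw [ins_of_ne hy, h y hy]
      rw [h2]
      exact abs_ins_sub_le f x ζ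

theorem abs_sub_le_sum_oscR (f : C(Config E, ℝ)) (S : Finset E) {η ζ : Config E}
    (h : ∀ y, y ∉ S → η y = ζ y) : |f η - f ζ| ≤ ∑ x ∈ S, oscR f x := by
  induction S using Finset.induction_on generalizing η with
  | empty =>
    have : η = ζ := by ext1 y; exact h y (by simp)
    simp [this]
  | insert a S ha ih =>
    rw [Finset.sum_insert ha]
    have h1 := abs_sub_le_of_eq_off f (x := a) (η := η) (ζ := Function.update η a (ζ a))
      (fun y hy => by simp [hy])
    have h2 := ih (η := Function.update η a (ζ a)) (fun y hy => by
      by_cases hya : y = a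
      · subst hya; simp
      · simp only [Function.update_of_ne hya]
        exact h y (by simp [hy, hya]))
    calc |f η - f ζ| ≤ |f η - f (Function.update η a (ζ a))| +
          |f (Function.update η a (ζ a)) - f ζ| := abs_sub_le _ _ _
      _ ≤ _ := add_le_add h1 h2

theorem oscR_le_add (f g : C(Config E, ℝ)) (x : E) : oscR f x ≤ oscR g x + 2 * ‖f - g‖ := by
  rw [oscR_le_iff (add_nonneg (oscR_nonneg _ _) (by positivity))]
  intro ξ
  have h1 := abs_ins_sub_le g x ξ
  have h2 := (f - g).norm_coe_le_norm (ins x ξ)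
  have h3 := (f - g).norm_coe_le_norm ξ
  simp only [ContinuousMap.coe_sub, Pi.sub_apply, Real.norm_eq_abs] at h2 h3
  rw [abs_le] at *
  constructor <;> linarith [h1.1, h1.2, h2.1, h2.2, h3.1, h3.2]

theorem oscR_le_two_norm (f : C(Config E, ℝ)) (x : E) : oscR f x ≤ 2 * ‖f‖ := by
  have := oscR_le_add f 0 x
  have h0 : oscR (0 : C(Config E, ℝ)) x ≤ 0 := (oscR_le_iff le_rfl).2 (by simp)
  rw [sub_zero] at this
  linarith

theorem continuous_oscR (x : E) : Continuous fun f : C(Config E, ℝ) => oscR f x := by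
  refine (LipschitzWith.of_dist_le_mul (K := 2) fun f g => ?_).continuous
  rw [Real.dist_eq, dist_eq_norm, abs_le]
  have h1 := oscR_le_add f g x
  have h2 := oscR_le_add g f x
  rw [norm_sub_rev] at h2
  simp only [NNReal.coe_ofNat]
  constructor <;> linarith

theorem oscR_neg (f : C(Config E, ℝ)) (x : E) : oscR (-f) x = oscR f x := by
  have : ∀ g : C(Config E, ℝ), oscR (-g) x ≤ oscR g x := fun g => by
    rw [oscR_le_iff (oscR_nonneg _ _)]
    intro ξ
    have := abs_ins_sub_le g x ξ
    rw [abs_sub_comm] at this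
    simpa [neg_add_eq_sub] using this
  refine le_antisymm (this f) ?_
  simpa using this (-f)

/-- Compactness of the configuration space: the supremum is attained. The maximum principle is
evaluated at this pair. -/
theorem exists_maximal_pair (f : C(Config E, ℝ)) (x : E) :
    ∃ η : Config E, η x = true ∧ |f η - f (del x η)| = oscR f x := by
  have hc : Continuous fun ξ : Config E => |f (ins x ξ) - f (del x ξ)| :=
    ((f.continuous.comp (continuous_ins x)).sub (f.continuous.comp (continuous_del x))).abs
  obtain ⟨ξ, -, hξ⟩ := isCompact_univ.exists_isMaxOn (Set.univ_nonempty) hc.continuousOn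
  refine ⟨ins x ξ, by simp, le_antisymm ?_ ?_⟩
  · exact abs_sub_le_of_eq_off f fun y hy => by rw [del_of_ne hy]
  · rw [oscR_le_iff (abs_nonneg _)]
    intro ζ
    cases h : ζ x
    · have := hξ (Set.mem_univ ζ)
      simp only [Set.mem_ofPred_eq, del_eq_self h] at this
      simpa using this
    · simp [ins_eq_self h]

theorem osc_add_le (f g : C(Config E, ℝ)) (x : E) : osc (f + g) x ≤ osc f x + osc g x := by
  rw [← ofReal_oscR f, ← ofReal_oscR g, ← ENNReal.ofReal_add (oscR_nonneg _ _) (oscR_nonneg _ _),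
    osc_le_iff (add_nonneg (oscR_nonneg _ _) (oscR_nonneg _ _))]
  intro ξ
  have h1 := abs_ins_sub_le f x ξ
  have h2 := abs_ins_sub_le g x ξ
  calc |(f + g) (ins x ξ) - (f + g) ξ| = |(f (ins x ξ) - f ξ) + (g (ins x ξ) - g ξ)| := by
        congr 1; simp only [ContinuousMap.add_apply]; ring
    _ ≤ _ := (abs_add_le _ _).trans (add_le_add h1 h2)

theorem osc_smul_le (c : ℝ) (f : C(Config E, ℝ)) (x : E) :
    osc (c • f) x ≤ ENNReal.ofReal |c| * osc f x := by
  rw [← ofReal_oscR f, ← ENNReal.ofReal_mul (abs_nonneg _),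
    osc_le_iff (mul_nonneg (abs_nonneg _) (oscR_nonneg _ _))]
  intro ξ
  simp only [ContinuousMap.coe_smul, Pi.smul_apply, smul_eq_mul, ← mul_sub, abs_mul]
  exact mul_le_mul_of_nonneg_left (abs_ins_sub_le f x ξ) (abs_nonneg _)

/-- The space `D(𝒳)`. -/
def finiteOsc (E : Type*) [DecidableEq E] : Submodule ℝ C(Config E, ℝ) where
  carrier := {f | tripleNorm f < ⊤}
  zero_mem' := by
    have : ∀ x : E, osc (0 : C(Config E, ℝ)) x = 0 := fun x => by simp [osc]
    simp [tripleNorm, this]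
  add_mem' {f g} hf hg := by
    refine lt_of_le_of_lt (ENNReal.tsum_le_tsum (osc_add_le f g)) ?_
    rw [ENNReal.tsum_add]
    exact ENNReal.add_lt_top.2 ⟨hf, hg⟩
  smul_mem' c f hf := by
    refine lt_of_le_of_lt (ENNReal.tsum_le_tsum (osc_smul_le c f)) ?_
    rw [ENNReal.tsum_mul_left]
    exact ENNReal.mul_lt_top ENNReal.ofReal_lt_top hf

/-- The algebra of functions that depend on finitely many sites. -/
def localFunctions (E : Type*) [DecidableEq E] : Subalgebra ℝ C(Config E, ℝ) where
  carrier := {f | ∃ Λ : Finset E, ∀ η ζ : Config E, (∀ x ∈ Λ, η x = ζ x) → f η = f ζ}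
  mul_mem' := by
    rintro f g ⟨Λ, hf⟩ ⟨Λ', hg⟩
    refine ⟨Λ ∪ Λ', fun η ζ h => ?_⟩
    simp only [ContinuousMap.mul_apply]
    rw [hf η ζ fun x hx => h x (Finset.mem_union_left _ hx),
      hg η ζ fun x hx => h x (Finset.mem_union_right _ hx)]
  add_mem' := by
    rintro f g ⟨Λ, hf⟩ ⟨Λ', hg⟩
    refine ⟨Λ ∪ Λ', fun η ζ h => ?_⟩
    simp only [ContinuousMap.add_apply]
    rw [hf η ζ fun x hx => h x (Finset.mem_union_left _ hx),
      hg η ζ fun x hx => h x (Finset.mem_union_right _ hx)]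
  algebraMap_mem' c := ⟨∅, fun η ζ _ => by simp⟩

/-- Stone–Weierstrass for functions of finitely many sites, which have only finitely many nonzero
oscillations. -/
theorem dense_finiteOsc : Dense (finiteOsc E : Set C(Config E, ℝ)) := by
  have h1 : (localFunctions E).topologicalClosure = ⊤ := by
    refine ContinuousMap.subalgebra_topologicalClosure_eq_top_of_separatesPoints _ ?_
    intro η ζ hne
    obtain ⟨x, hx⟩ := Function.ne_iff.1 hne
    let f : C(Config E, ℝ) := ⟨fun ξ => if ξ x then 1 else 0,
      (continuous_of_discreteTopology (f := fun b : Bool => if b then (1 : ℝ) else 0)).comp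
        (continuous_apply x)⟩
    refine ⟨f, ⟨f, ⟨{x}, fun η ζ h => ?_⟩, rfl⟩, ?_⟩
    · simp [f, h x (by simp)]
    · simp only [f, ContinuousMap.coe_mk]
      cases h1 : η x <;> cases h2 : ζ x <;> simp_all
  have h2 : Dense (localFunctions E : Set C(Config E, ℝ)) := by
    rw [dense_iff_closure_eq, ← Subalgebra.topologicalClosure_coe, h1]
    rfl
  refine h2.mono ?_
  rintro f ⟨Λ, hf⟩
  change ∑' x, osc f x < ⊤
  rw [tsum_eq_sum (s := Λ)]
  · exact ENNReal.sum_lt_top.2 fun x _ => osc_lt_top f x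
  · intro x hx
    simp only [osc, ENNReal.iSup_eq_zero, ENNReal.ofReal_eq_zero]
    intro ξ
    rw [hf (ins x ξ) ξ fun y hy => ins_of_ne (by rintro rfl; exact hx hy) ξ]
    simp

/-- If `F' = dF/ds` and the resolvent-type inequality
`(1 + lε) Δ_F ≤ Δ_{F - lF'} + l e^{-εs} p(s)` holds along the path `F`, then
`Δ_{F(s)} ≤ e^{-εs} (Δ_{F(0)} + ∫_0^s p)`. -/
theorem oscR_le_of_resolvent_bound {F F' : ℝ → C(Config E, ℝ)} {u : E} {τ ε : ℝ} {p P : ℝ → ℝ}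
    (hF : ContinuousOn F (Set.Icc 0 τ)) (hF' : ContinuousOn F' (Set.Icc 0 τ))
    (hd : ∀ s ∈ Set.Ico 0 τ, HasDerivWithinAt F (F' s) (Set.Ioi s) s)
    (hp : Continuous p) (hP : ∀ s, HasDerivAt P (p s) s)
    (hres : ∀ s ∈ Set.Icc 0 τ, ∀ l : ℝ, 0 ≤ l →
      (1 + l * ε) * oscR (F s) u ≤ oscR (F s - l • F' s) u + l * (Real.exp (-ε * s) * p s)) :
    ∀ s ∈ Set.Icc 0 τ, oscR (F s) u ≤ Real.exp (-ε * s) * (oscR (F 0) u + (P s - P 0)) := by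
  have hφ : ContinuousOn (fun s => oscR (F s) u) (Set.Icc 0 τ) :=
    (continuous_oscR u).comp_continuousOn hF
  -- The oscillation need not be differentiable in s, so the comparison uses only an upper bound on
  -- right difference quotients of e^{εs} Δ.
  have main : ∀ s ∈ Set.Icc 0 τ, Real.exp (ε * s) * oscR (F s) u ≤
      oscR (F 0) u + (P s - P 0) := by
    refine fun s hs => image_le_of_liminf_slope_right_le_deriv_boundary
      (f := fun s => Real.exp (ε * s) * oscR (F s) u) (B := fun s => oscR (F 0) u + (P s - P 0))
      (B' := p) (a := 0) (b := τ) ?_ ?_ ?_ ?_ ?_ hs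
    · exact ContinuousOn.mul (by fun_prop) hφ
    · simp
    · exact continuousOn_const.add (ContinuousOn.sub
        (fun s _ => (hP s).continuousAt.continuousWithinAt) continuousOn_const)
    · intro s _
      exact (((hP s).sub_const (P 0)).const_add _).hasDerivWithinAt
    · intro s hs c hc
      refine Eventually.frequently ?_
      have hIoo : ∀ᶠ z in 𝓝[>] s, z ∈ Set.Ioo s τ := Ioo_mem_nhdsGT hs.2
      have hmem : Tendsto (fun z => z) (𝓝[>] s) (𝓝[Set.Icc 0 τ] s) := by
        refine tendsto_nhdsWithin_iff.2 ⟨tendsto_id.mono_left nhdsWithin_le_nhds, ?_⟩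
        filter_upwards [hIoo] with z hz
        exact ⟨hs.1.trans hz.1.le, hz.2.le⟩
      have hs' : s ∈ Set.Icc 0 τ := ⟨hs.1, hs.2.le⟩
      have hFz : Tendsto (fun z => oscR (F z) u) (𝓝[>] s) (𝓝 (oscR (F s) u)) :=
        (hφ s hs').tendsto.comp hmem
      have hF'z : Tendsto F' (𝓝[>] s) (𝓝 (F' s)) := (hF' s hs').tendsto.comp hmem
      have hslope := hd s hs
      rw [hasDerivWithinAt_iff_tendsto_slope' (by simp)] at hslope
      have hω : Tendsto (fun z => 2 * ‖slope F s z - F' z‖) (𝓝[>] s) (𝓝 0) := by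
        simpa using ((hslope.sub hF'z).norm.const_mul 2)
      have hexp : Tendsto (fun z => (Real.exp (ε * z) - Real.exp (ε * s) -
          Real.exp (ε * s) * ((z - s) * ε)) / (z - s)) (𝓝[>] s) (𝓝 0) := by
        have h1 : HasDerivAt (fun z => Real.exp (ε * z)) (Real.exp (ε * s) * ε) s := by
          simpa using ((hasDerivAt_id s).const_mul ε).exp
        have h2 := h1.hasDerivWithinAt (s := Set.Ioi s)
        rw [hasDerivWithinAt_iff_tendsto_slope' (by simp)] at h2
        have h3 := h2.sub_const (Real.exp (ε * s) * ε)
        rw [sub_self] at h3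
        refine h3.congr' ?_
        filter_upwards [hIoo] with z hz
        have : z - s ≠ 0 := (sub_pos.2 hz.1).ne'
        rw [slope_def_field]
        field_simp
      have hQ : Tendsto (fun z => Real.exp (-ε * z) * p z) (𝓝[>] s)
          (𝓝 (Real.exp (-ε * s) * p s)) := by
        have : Continuous fun z => Real.exp (-ε * z) * p z := by fun_prop
        exact (this.tendsto s).mono_left nhdsWithin_le_nhds
      have hlim := ((hexp.mul hFz).add ((hω.add hQ).const_mul (Real.exp (ε * s))))
      have hval : 0 * oscR (F s) u + Real.exp (ε * s) * (0 + Real.exp (-ε * s) * p s) = p s := by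
        rw [zero_mul, zero_add, zero_add, ← mul_assoc, ← Real.exp_add]; simp
      rw [hval] at hlim
      filter_upwards [hlim.eventually_lt_const hc, hIoo] with z hz hzs
      refine lt_of_le_of_lt ?_ hz
      have hpos : 0 < z - s := sub_pos.2 hzs.1
      -- An implicit Euler step: the hypothesis is used at the later time z with l = z - s, where
      -- F(z) - l F'(z) equals F(s) up to o(z - s).
      have h1 := hres z ⟨hs.1.trans hzs.1.le, hzs.2.le⟩ (z - s) hpos.le
      have h2 := oscR_le_add (F z - (z - s) • F' z) (F s) u
      have h3 : F z - (z - s) • F' z - F s = (z - s) • (slope F s z - F' z) := by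
        rw [slope_def_module, smul_sub, smul_smul, mul_inv_cancel₀ hpos.ne', one_smul]
        abel
      rw [h3, norm_smul, Real.norm_of_nonneg hpos.le] at h2
      have hes := Real.exp_pos (ε * s)
      rw [slope_def_field, div_le_iff₀ hpos]
      have h4 : (1 + (z - s) * ε) * oscR (F z) u - oscR (F s) u ≤
          (z - s) * (2 * ‖slope F s z - F' z‖ + Real.exp (-ε * z) * p z) := by linarith
      have h5 := mul_le_mul_of_nonneg_left h4 hes.le
      have h6 : (Real.exp (ε * z) - Real.exp (ε * s) - Real.exp (ε * s) * ((z - s) * ε)) /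
          (z - s) * oscR (F z) u * (z - s) = (Real.exp (ε * z) - Real.exp (ε * s) -
            Real.exp (ε * s) * ((z - s) * ε)) * oscR (F z) u := by
        field_simp
      rw [add_mul, h6]
      linarith
  intro s hs
  have h := mul_le_mul_of_nonneg_left (main s hs) (Real.exp_pos (-ε * s)).le
  rwa [← mul_assoc, ← Real.exp_add, neg_mul, neg_add_cancel, Real.exp_zero, one_mul,
    ← neg_mul] at h

end DPPDynamics

end

noncomputable section

namespace DPPDynamics

variable {E : Type*} [DecidableEq E]

/-! ### The action of `Γ` -/

section Gamma

omit [DecidableEq E]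

variable {γ : E → E → ℝ≥0∞}

theorem gammaAct_mono {β β' : E → ℝ≥0∞} (h : ∀ x, β x ≤ β' x) (u : E) :
    gammaAct γ β u ≤ gammaAct γ β' u :=
  ENNReal.tsum_le_tsum fun x => mul_le_mul_left (h x) _

theorem gammaAct_const_mul (c : ℝ≥0∞) (β : E → ℝ≥0∞) (u : E) :
    gammaAct γ (fun x => c * β x) u = c * gammaAct γ β u := by
  simp [gammaAct, mul_assoc, ENNReal.tsum_mul_left]

theorem gammaAct_add (β β' : E → ℝ≥0∞) (u : E) :
    gammaAct γ (fun x => β x + β' x) u = gammaAct γ β u + gammaAct γ β' u := by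
  simp [gammaAct, add_mul, ENNReal.tsum_add]

theorem gammaAct_sum {ι : Type*} (s : Finset ι) (β : ι → E → ℝ≥0∞) (u : E) :
    gammaAct γ (fun x => ∑ i ∈ s, β i x) u = ∑ i ∈ s, gammaAct γ (β i) u := by
  simp only [gammaAct, Finset.sum_mul]
  exact Summable.tsum_finsetSum fun _ _ => ENNReal.summable

theorem tsum_gammaAct_le (β : E → ℝ≥0∞) : ∑' u, gammaAct γ β u ≤ rowSup γ * ∑' x, β x := by
  simp only [gammaAct]
  rw [ENNReal.tsum_comm, ← ENNReal.tsum_mul_left]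
  refine ENNReal.tsum_le_tsum fun x => ?_
  rw [ENNReal.tsum_mul_left, mul_comm]
  exact mul_le_mul_left (le_iSup (fun x => ∑' u, γ x u) x) _

theorem tsum_gammaAct_iterate_le (n : ℕ) (β : E → ℝ≥0∞) :
    ∑' u, ((gammaAct γ)^[n] β) u ≤ rowSup γ ^ n * ∑' x, β x := by
  induction n with
  | zero => simp
  | succ n ih =>
    rw [Function.iterate_succ_apply', pow_succ', mul_assoc]
    exact (tsum_gammaAct_le _).trans (mul_le_mul_right ih _)

theorem gammaAct_iterate_lt_top (hγ : rowSup γ < ⊤) (n : ℕ) {β : E → ℝ≥0∞}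
    (hβ : ∑' x, β x < ⊤) (u : E) : ((gammaAct γ)^[n] β) u < ⊤ :=
  (ENNReal.le_tsum u).trans_lt ((tsum_gammaAct_iterate_le n β).trans_lt
    (ENNReal.mul_lt_top (ENNReal.pow_lt_top hγ) hβ))

theorem tsum_expGamma_le (hγ : rowSup γ < ⊤) (s : ℝ≥0) (β : E → ℝ≥0∞) :
    ∑' u, expGamma γ s β u ≤ ENNReal.ofReal (Real.exp ((rowSup γ).toReal * s)) * ∑' x, β x := by
  simp only [expGamma]
  rw [ENNReal.tsum_comm]
  have hsum : ENNReal.ofReal (Real.exp ((rowSup γ).toReal * s)) =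
      ∑' n : ℕ, ENNReal.ofReal ((s : ℝ) ^ n / (n.factorial : ℝ)) * rowSup γ ^ n := by
    have h1 := NormedSpace.expSeries_div_hasSum_exp ((rowSup γ).toReal * (s : ℝ))
    rw [← Real.exp_eq_exp_ℝ] at h1
    rw [← h1.tsum_eq, ENNReal.ofReal_tsum_of_nonneg (fun n => by positivity) h1.summable]
    refine tsum_congr fun n => ?_
    rw [mul_pow, mul_div_assoc, mul_comm, ENNReal.ofReal_mul (by positivity),
      ENNReal.ofReal_pow ENNReal.toReal_nonneg, ENNReal.ofReal_toReal hγ.ne]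
  rw [hsum, ← ENNReal.tsum_mul_right]
  refine ENNReal.tsum_le_tsum fun n => ?_
  rw [ENNReal.tsum_mul_left, mul_assoc]
  exact mul_le_mul_right (tsum_gammaAct_iterate_le n β) _

theorem tsum_expGamma_lt_top (hγ : rowSup γ < ⊤) (s : ℝ≥0) {β : E → ℝ≥0∞}
    (hβ : ∑' x, β x < ⊤) : ∑' u, expGamma γ s β u < ⊤ :=
  (tsum_expGamma_le hγ s β).trans_lt (ENNReal.mul_lt_top ENNReal.ofReal_lt_top hβ)

theorem expGamma_mono {s t : ℝ≥0} (hst : s ≤ t) (β : E → ℝ≥0∞) (u : E) :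
    expGamma γ s β u ≤ expGamma γ t β u := by
  refine ENNReal.tsum_le_tsum fun n => mul_le_mul_left (ENNReal.ofReal_le_ofReal ?_) _
  have : (s : ℝ) ≤ t := by exact_mod_cast hst
  gcongr

end Gamma

/-- The inequality `dΔ/ds ≤ -εΔ + ΓΔ` along a path integrates to `Δ ≤ e^{-εs} exp(sΓ) Δ_0`, provided
`Δ` is dominated by a summable function. -/
theorem osc_le_expGamma_of_resolvent_bound {γ : E → E → ℝ≥0∞} (hγ : rowSup γ < ⊤)
    {F F' : ℝ → C(Config E, ℝ)} {τ ε : ℝ} (hτ : 0 ≤ τ) (hε : 0 ≤ ε)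
    (hF : ContinuousOn F (Set.Icc 0 τ)) (hF' : ContinuousOn F' (Set.Icc 0 τ))
    (hd : ∀ s ∈ Set.Ico 0 τ, HasDerivWithinAt F (F' s) (Set.Ioi s) s)
    {χ : E → ℝ≥0∞} (hχ : ∑' x, χ x < ⊤) (hdom : ∀ s ∈ Set.Icc 0 τ, ∀ u, osc (F s) u ≤ χ u)
    (hres : ∀ s ∈ Set.Icc 0 τ, ∀ u, ∀ l : ℝ, 0 ≤ l → (1 + l * ε) * oscR (F s) u ≤
      oscR (F s - l • F' s) u + l * (gammaAct γ (osc (F s)) u).toReal) :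
    ∀ s ∈ Set.Icc 0 τ, ∀ u, osc (F s) u ≤
      ENNReal.ofReal (Real.exp (-ε * s)) * expGamma γ s.toNNReal (osc (F 0)) u := by
  -- The factor e^{ετ} compensates e^{-εs} in the case N = 0 of the claim below.
  set χ' : E → ℝ≥0∞ := fun x => ENNReal.ofReal (Real.exp (ε * τ)) * χ x with hχ'def
  have hχ' : ∑' x, χ' x < ⊤ := by
    rw [ENNReal.tsum_mul_left]
    exact ENNReal.mul_lt_top ENNReal.ofReal_lt_top hχ
  have h0 : ∑' x, osc (F 0) x < ⊤ :=
    (ENNReal.tsum_le_tsum (hdom 0 ⟨le_rfl, hτ⟩)).trans_lt hχ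
  -- Picard iteration: inserting the bound of order N into the influx Γ Δ and integrating in time
  -- gives the bound of order N + 1. The dominating function only enters the remainder.
  have claim : ∀ N : ℕ, ∀ s ∈ Set.Icc 0 τ, ∀ u, osc (F s) u ≤ ENNReal.ofReal (Real.exp (-ε * s)) *
      (∑ n ∈ Finset.range N, ENNReal.ofReal (s ^ n / (n.factorial : ℝ)) *
        ((gammaAct γ)^[n] (osc (F 0))) u +
        ENNReal.ofReal (s ^ N / (N.factorial : ℝ)) * ((gammaAct γ)^[N] χ') u) := by
    intro N
    induction N with
    | zero =>
      intro s hs u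
      simp only [Finset.range_zero, Finset.sum_empty, zero_add, pow_zero, Nat.factorial_zero,
        Nat.cast_one, div_one, ENNReal.ofReal_one, one_mul, Function.iterate_zero, id, hχ'def]
      rw [← mul_assoc, ← ENNReal.ofReal_mul (Real.exp_pos _).le, ← Real.exp_add]
      refine (hdom s hs u).trans (le_mul_of_one_le_left zero_le ?_)
      rw [ENNReal.one_le_ofReal, Real.one_le_exp_iff]
      nlinarith [hs.1, hs.2]
    | succ N ih =>
      intro s hs u
      set a : ℕ → ℝ := fun n => (((gammaAct γ)^[n] (osc (F 0))) u).toReal with ha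
      set c : ℝ := (((gammaAct γ)^[N + 1] χ') u).toReal with hc
      have ha' : ∀ n, ((gammaAct γ)^[n] (osc (F 0))) u = ENNReal.ofReal (a n) := fun n =>
        (ENNReal.ofReal_toReal (gammaAct_iterate_lt_top hγ n h0 u).ne).symm
      have hc' : ((gammaAct γ)^[N + 1] χ') u = ENNReal.ofReal c :=
        (ENNReal.ofReal_toReal (gammaAct_iterate_lt_top hγ _ hχ' u).ne).symm
      have ha0 : ∀ n, 0 ≤ a n := fun n => ENNReal.toReal_nonneg
      have hc0 : 0 ≤ c := ENNReal.toReal_nonneg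
      have hsum : ∀ (r : ℝ), 0 ≤ r → ∀ (k : ℕ) (b : ℕ → ℝ), (∀ n, 0 ≤ b n) →
          0 ≤ ∑ n ∈ Finset.range k, r ^ n / (n.factorial : ℝ) * b n := fun r hr k b hb =>
        Finset.sum_nonneg fun n _ => mul_nonneg (by positivity) (hb n)
      have hconv : ∀ (r : ℝ), 0 ≤ r → ∀ (k m : ℕ) (b : ℕ → ℝ), (∀ n, 0 ≤ b n) →
          ENNReal.ofReal (∑ n ∈ Finset.range k, r ^ n / (n.factorial : ℝ) * b n +
            r ^ m / (m.factorial : ℝ) * c) =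
          ∑ n ∈ Finset.range k, ENNReal.ofReal (r ^ n / (n.factorial : ℝ)) *
            ENNReal.ofReal (b n) + ENNReal.ofReal (r ^ m / (m.factorial : ℝ)) *
              ENNReal.ofReal c := by
        intro r hr k m b hb
        rw [ENNReal.ofReal_add (hsum r hr k b hb) (by positivity),
          ENNReal.ofReal_sum_of_nonneg fun n _ => mul_nonneg (by positivity) (hb n),
          ENNReal.ofReal_mul (by positivity)]
        congr 1
        exact Finset.sum_congr rfl fun n _ => ENNReal.ofReal_mul (by positivity)
      -- `p` is Γ applied to the bound of order N at the site u, without its exponential factor; `P`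
      -- below is the antiderivative of `p` with `P 0 = 0`.
      set p : ℝ → ℝ := fun r => ∑ n ∈ Finset.range N, r ^ n / (n.factorial : ℝ) * a (n + 1) +
        r ^ N / (N.factorial : ℝ) * c with hp
      set P : ℝ → ℝ := fun r => ∑ n ∈ Finset.range N,
        r ^ (n + 1) / ((n + 1).factorial : ℝ) * a (n + 1) +
        r ^ (N + 1) / ((N + 1).factorial : ℝ) * c with hPdef
      have hpow : ∀ (n : ℕ) (r : ℝ), HasDerivAt (fun r : ℝ => r ^ (n + 1) / ((n + 1).factorial : ℝ))
          (r ^ n / (n.factorial : ℝ)) r := by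
        intro n r
        have h1 := (hasDerivAt_pow (n + 1) r).div_const ((n + 1).factorial : ℝ)
        refine h1.congr_deriv ?_
        rw [Nat.factorial_succ]
        have := Nat.factorial_pos n
        push_cast
        field_simp
      have hderiv : ∀ r, HasDerivAt P (p r) r := by
        intro r
        exact (HasDerivAt.fun_sum fun n _ => (hpow n r).mul_const _).add ((hpow N r).mul_const _)
      have hgamma : ∀ r ∈ Set.Icc 0 τ, (gammaAct γ (osc (F r)) u).toReal ≤
          Real.exp (-ε * r) * p r := by
        intro r hr
        have hp0 : 0 ≤ p r :=
          add_nonneg (hsum r hr.1 N _ fun n => ha0 (n + 1)) (by have := hr.1; positivity)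
        refine ENNReal.toReal_le_of_le_ofReal (mul_nonneg (Real.exp_pos _).le hp0) ?_
        refine (gammaAct_mono (ih r hr) u).trans ?_
        rw [gammaAct_const_mul, gammaAct_add, gammaAct_sum, gammaAct_const_mul,
          ENNReal.ofReal_mul (Real.exp_pos _).le, hp, hconv r hr.1 N N (fun n => a (n + 1))
            fun n => ha0 (n + 1)]
        refine le_of_eq ?_
        simp only [gammaAct_const_mul, ← ha', ← hc', Function.iterate_succ_apply']
      have hmain := oscR_le_of_resolvent_bound (u := u) (ε := ε) (p := p) (P := P) hF hF' hd
        (by fun_prop) hderiv (fun r hr l hl => (hres r hr u l hl).trans (by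
          have := mul_le_mul_of_nonneg_left (hgamma r hr) hl
          linarith)) s hs
      have hP0 : P 0 = 0 := by simp [hPdef]
      rw [hP0, sub_zero] at hmain
      rw [← ofReal_oscR (F s) u]
      refine (ENNReal.ofReal_le_ofReal hmain).trans (le_of_eq ?_)
      simp only [ha', hc']
      rw [ENNReal.ofReal_mul (Real.exp_pos _).le, ← hconv s hs.1 (N + 1) (N + 1) a ha0]
      congr 2
      rw [Finset.sum_range_succ', hPdef]
      simp only [ha, oscR, pow_zero, Nat.factorial_zero, Nat.cast_one, div_one, one_mul,
        Function.iterate_zero, id]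
      ring
  intro s hs u
  -- A single coordinate of Γ^N χ' is at most its total mass, hence at most M^N times the mass of
  -- χ'. The remainder is then O((sM)^N / N!).
  have hrem : ∀ N : ℕ, osc (F s) u ≤ ENNReal.ofReal (Real.exp (-ε * s)) *
      (expGamma γ s.toNNReal (osc (F 0)) u +
        ENNReal.ofReal ((s * (rowSup γ).toReal) ^ N / (N.factorial : ℝ) *
          (∑' x, χ' x).toReal)) := by
    intro N
    refine (claim N s hs u).trans (mul_le_mul_right (add_le_add ?_ ?_) _)
    · simp only [expGamma, Real.coe_toNNReal _ hs.1]
      exact ENNReal.sum_le_tsum _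
    · have h1 : ((gammaAct γ)^[N] χ') u ≤ rowSup γ ^ N * ∑' x, χ' x :=
        (ENNReal.le_tsum u).trans (tsum_gammaAct_iterate_le N χ')
      refine (mul_le_mul_right h1 _).trans (le_of_eq ?_)
      have hs0 := hs.1
      rw [mul_pow, mul_div_right_comm, ENNReal.ofReal_mul (by positivity),
        ENNReal.ofReal_mul (by positivity), ENNReal.ofReal_pow ENNReal.toReal_nonneg,
        ENNReal.ofReal_toReal hγ.ne, ENNReal.ofReal_toReal hχ'.ne, mul_assoc]
  have hlim : Tendsto (fun N : ℕ => ENNReal.ofReal (Real.exp (-ε * s)) *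
      (expGamma γ s.toNNReal (osc (F 0)) u +
        ENNReal.ofReal ((s * (rowSup γ).toReal) ^ N / (N.factorial : ℝ) *
          (∑' x, χ' x).toReal))) atTop (𝓝 (ENNReal.ofReal (Real.exp (-ε * s)) *
      (expGamma γ s.toNNReal (osc (F 0)) u + 0))) := by
    refine ENNReal.Tendsto.const_mul (Tendsto.add tendsto_const_nhds ?_)
      (Or.inr ENNReal.ofReal_ne_top)
    have := (FloorSemiring.tendsto_pow_div_factorial_atTop
      (s * (rowSup γ).toReal)).mul_const (∑' x, χ' x).toReal
    rw [zero_mul] at this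
    simpa using ENNReal.tendsto_ofReal this
  rw [add_zero] at hlim
  exact ge_of_tendsto' hlim hrem

end DPPDynamics

end

noncomputable section

namespace DPPDynamics

variable {E : Type*} [DecidableEq E]

/-! ### Spin systems given by moves `σ_i` with rates `r_i` -/

section Terms

variable {ι : Type*} (σ : ι → C(Config E, Config E)) (r : ι → C(Config E, ℝ))

/-- The operator `f ↦ r_i (f ∘ σ_i - f)`. -/
def rateTerm (i : ι) : C(Config E, ℝ) →L[ℝ] C(Config E, ℝ) :=
  LinearMap.mkContinuous
    { toFun := fun f => r i * (f.comp (σ i) - f)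
      map_add' := fun f g => by ext ξ; simp; ring
      map_smul' := fun c f => by ext ξ; simp; ring }
    (2 * ‖r i‖) (fun f => by
      rw [ContinuousMap.norm_le _ (by positivity)]
      intro ξ
      have h1 := (r i).norm_coe_le_norm ξ
      have h2 := f.norm_coe_le_norm (σ i ξ)
      have h3 := f.norm_coe_le_norm ξ
      have h4 := norm_sub_le (f (σ i ξ)) (f ξ)
      simp only [LinearMap.coe_mk, AddHom.coe_mk, ContinuousMap.mul_apply, ContinuousMap.sub_apply,
        ContinuousMap.comp_apply, norm_mul]
      calc ‖r i ξ‖ * ‖f (σ i ξ) - f ξ‖ ≤ ‖r i‖ * (‖f‖ + ‖f‖) := by gcongr; linarith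
        _ = 2 * ‖r i‖ * ‖f‖ := by ring)

omit [DecidableEq E] in
@[simp] theorem rateTerm_apply (i : ι) (f : C(Config E, ℝ)) (ξ : Config E) :
    rateTerm σ r i f ξ = r i ξ * (f (σ i ξ) - f ξ) := rfl

/-- The bounded generator with the moves `i ∈ J` only. -/
def partialGen (J : Finset ι) : C(Config E, ℝ) →L[ℝ] C(Config E, ℝ) := ∑ i ∈ J, rateTerm σ r i

omit [DecidableEq E] in
theorem partialGen_apply (J : Finset ι) (f : C(Config E, ℝ)) :
    partialGen σ r J f = ∑ i ∈ J, rateTerm σ r i f := by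
  simp [partialGen]

/-- `L f = ∑_i r_i (f ∘ σ_i - f)`. -/
def fullGen (f : C(Config E, ℝ)) : C(Config E, ℝ) := ∑' i, rateTerm σ r i f

end Terms

/-- Conditions on moves and rates: the move `i` changes the configuration in the finite set
`S i` only, the total rate of change at a site is bounded, and the discrepancy at a site
creates discrepancies at other sites at rates bounded by `γ` and disappears at a rate at
least `ε`. -/
structure IsSpinSystem {ι : Type*} (σ : ι → C(Config E, Config E)) (r : ι → C(Config E, ℝ))
    (S : ι → Finset E) (γ : E → E → ℝ≥0∞) (ε : ℝ≥0∞) : Prop where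
  rate_nonneg : ∀ i ξ, 0 ≤ r i ξ
  move_eq : ∀ i ξ x, x ∉ S i → σ i ξ x = ξ x
  total_rate : ∃ C : ℝ≥0, ∀ x, ∑' i, (if x ∈ S i then ‖r i‖ₑ else 0) ≤ C
  rowSup_lt_top : rowSup γ < ⊤
  discrepancy : ∀ (u : E) (η : Config E), η u = true →
    ∃ (G : ι → E → ℝ≥0∞) (e : ι → ℝ) (e₀ : ℝ), (∀ i x, x ∉ S i → G i x = 0) ∧
      (∀ x, ∑' i, G i x ≤ γ x u) ∧ (∀ i, 0 ≤ e i) ∧ HasSum e e₀ ∧ ε.toReal ≤ e₀ ∧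
      ∀ f : C(Config E, ℝ), (∀ ξ, |f (ins u ξ) - f (del u ξ)| ≤ f η - f (del u η)) → ∀ i,
        ENNReal.ofReal (rateTerm σ r i f η - rateTerm σ r i f (del u η) +
          e i * (f η - f (del u η))) ≤ ∑' x, G i x * osc f x

/-- If `h` decreases maximal discrepancies of `f` at rate `e` up to an error `Γ`, then
`f ↦ f - l h` satisfies the resolvent-type inequality. -/
theorem oscR_resolvent {f h : C(Config E, ℝ)} {u : E} {e Γ : ℝ}
    (H : ∀ η : Config E, η u = true → ∀ s : ℝ, s = 1 ∨ s = -1 →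
      (∀ ξ, |(s • f) (ins u ξ) - (s • f) (del u ξ)| ≤ (s • f) η - (s • f) (del u η)) →
      (s • h) η - (s • h) (del u η) + e * ((s • f) η - (s • f) (del u η)) ≤ Γ)
    {l : ℝ} (hl : 0 ≤ l) : (1 + l * e) * oscR f u ≤ oscR (f - l • h) u + l * Γ := by
  obtain ⟨η, hη, hmax⟩ := exists_maximal_pair f u
  -- The sign s makes the maximal discrepancy positive; `H` is assumed for both f and -f for this
  -- reason.
  obtain ⟨s, hs, habs⟩ : ∃ s : ℝ, (s = 1 ∨ s = -1) ∧ s * (f η - f (del u η)) = oscR f u := by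
    rcases abs_choice (f η - f (del u η)) with h1 | h1
    · exact ⟨1, Or.inl rfl, by rw [one_mul, ← h1, hmax]⟩
    · exact ⟨-1, Or.inr rfl, by rw [← hmax, h1]; ring⟩
  have hs1 : |s| = 1 := by rcases hs with rfl | rfl <;> simp
  have h1 := H η hη s hs (fun ξ => by
    simp only [ContinuousMap.coe_smul, Pi.smul_apply, smul_eq_mul, ← mul_sub, abs_mul, hs1, one_mul,
      habs]
    exact abs_sub_le_of_eq_off f fun y hy => by rw [ins_of_ne hy, del_of_ne hy])
  simp only [ContinuousMap.coe_smul, Pi.smul_apply, smul_eq_mul, ← mul_sub, habs] at h1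
  have h2 : |(f - l • h) η - (f - l • h) (del u η)| ≤ oscR (f - l • h) u :=
    abs_sub_le_of_eq_off _ fun y hy => by rw [del_of_ne hy]
  have h3 : s * ((f - l • h) η - (f - l • h) (del u η)) ≤
      |(f - l • h) η - (f - l • h) (del u η)| := by
    refine (le_abs_self _).trans (le_of_eq ?_)
    rw [abs_mul, hs1, one_mul]
  simp only [ContinuousMap.coe_sub, ContinuousMap.coe_smul, Pi.sub_apply, Pi.smul_apply,
    smul_eq_mul] at h2 h3
  have h4 : s * (f η - l * h η - (f (del u η) - l * h (del u η))) =
      oscR f u - l * (s * (h η - h (del u η))) := by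
    rw [← habs]; ring
  rw [h4] at h3
  have h5 := mul_le_mul_of_nonneg_left h1 hl
  linarith

namespace IsSpinSystem

variable {ι : Type*} {σ : ι → C(Config E, Config E)} {r : ι → C(Config E, ℝ)}
  {S : ι → Finset E} {γ : E → E → ℝ≥0∞} {ε : ℝ≥0∞} (h : IsSpinSystem σ r S γ ε)
include h

theorem gamma_lt_top (x u : E) : γ x u < ⊤ :=
  ((ENNReal.le_tsum u).trans (le_iSup (fun x => ∑' u, γ x u) x)).trans_lt h.rowSup_lt_top

theorem norm_rateTerm_le (i : ι) (f : C(Config E, ℝ)) :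
    ‖rateTerm σ r i f‖ ≤ ‖r i‖ * ∑ x ∈ S i, oscR f x := by
  have h0 : 0 ≤ ∑ x ∈ S i, oscR f x := Finset.sum_nonneg fun x _ => oscR_nonneg f x
  rw [ContinuousMap.norm_le _ (by positivity)]
  intro ξ
  rw [rateTerm_apply, norm_mul]
  gcongr
  · exact (r i).norm_coe_le_norm ξ
  · exact abs_sub_le_sum_oscR f (S i) fun y hy => h.move_eq i ξ y hy

/-- Exchanging the sums, each site x contributes Φ(x) times the total rate of moves touching x,
which is bounded. With Φ = Δ_f this gives convergence of L f; with Φ = exp(τΓ)Δ_f it bounds the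
omitted moves for all partial semigroups at once. -/
theorem summable_weight {Φ : E → ℝ≥0∞} (hΦ : ∑' x, Φ x < ⊤) :
    Summable fun i => ‖r i‖ * ∑ x ∈ S i, (Φ x).toReal := by
  obtain ⟨C, hC⟩ := h.total_rate
  have h1 : ∑' i, ‖r i‖ₑ * ∑ x ∈ S i, Φ x ≤ C * ∑' x, Φ x := by
    have h2 : ∀ i, ‖r i‖ₑ * ∑ x ∈ S i, Φ x = ∑' x, (if x ∈ S i then ‖r i‖ₑ else 0) * Φ x := by
      intro i
      rw [tsum_eq_sum (s := S i) (by intro x hx; simp [hx]), Finset.mul_sum]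
      exact Finset.sum_congr rfl fun x hx => by simp [hx]
    simp only [h2]
    rw [ENNReal.tsum_comm, ← ENNReal.tsum_mul_left]
    refine ENNReal.tsum_le_tsum fun x => ?_
    rw [ENNReal.tsum_mul_right]
    exact mul_le_mul_left (hC x) _
  have h3 : ∑' i, ‖r i‖ₑ * ∑ x ∈ S i, Φ x ≠ ⊤ :=
    (h1.trans_lt (ENNReal.mul_lt_top ENNReal.coe_lt_top hΦ)).ne
  refine (ENNReal.summable_toReal h3).congr fun i => ?_
  rw [ENNReal.toReal_mul, toReal_enorm,
    ENNReal.toReal_sum fun x _ => ((ENNReal.le_tsum x).trans_lt hΦ).ne]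

theorem summable_rateTerm {f : C(Config E, ℝ)} (hf : tripleNorm f < ⊤) :
    Summable fun i => rateTerm σ r i f :=
  (h.summable_weight hf).of_norm_bounded fun i => h.norm_rateTerm_le i f

theorem hasSum_fullGen {f : C(Config E, ℝ)} (hf : tripleNorm f < ⊤) :
    HasSum (fun i => rateTerm σ r i f) (fullGen σ r f) := (h.summable_rateTerm hf).hasSum

/-- The rates e are fixed before f and J, so that the finite set J can later exhaust all moves with
the same e. -/
theorem sum_discrepancy_le (u : E) (η : Config E) (hη : η u = true) :
    ∃ (e : ι → ℝ) (e₀ : ℝ), (∀ i, 0 ≤ e i) ∧ HasSum e e₀ ∧ ε.toReal ≤ e₀ ∧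
      ∀ f : C(Config E, ℝ), (∀ ξ, |f (ins u ξ) - f (del u ξ)| ≤ f η - f (del u η)) →
        ∀ J : Finset ι, ∑ i ∈ J, (rateTerm σ r i f η - rateTerm σ r i f (del u η) +
          e i * (f η - f (del u η))) ≤ ∑ x ∈ J.biUnion S, (γ x u).toReal * oscR f x := by
  obtain ⟨G, e, e₀, hGS, hGγ, he, hsum, hε, hG⟩ := h.discrepancy u η hη
  refine ⟨e, e₀, he, hsum, hε, fun f hf J => ?_⟩
  have hnn : 0 ≤ ∑ x ∈ J.biUnion S, (γ x u).toReal * oscR f x :=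
    Finset.sum_nonneg fun x _ => mul_nonneg ENNReal.toReal_nonneg (oscR_nonneg _ _)
  have h1 : ∀ a : ι → ℝ, ENNReal.ofReal (∑ i ∈ J, a i) ≤ ∑ i ∈ J, ENNReal.ofReal (a i) := by
    intro a
    induction J using Finset.cons_induction with
    | empty => simp
    | cons i J hi ih =>
      rw [Finset.sum_cons, Finset.sum_cons]
      refine ENNReal.ofReal_add_le.trans (add_le_add le_rfl (ih ?_))
      exact Finset.sum_nonneg fun x _ => mul_nonneg ENNReal.toReal_nonneg (oscR_nonneg _ _)
  rw [← ENNReal.ofReal_le_ofReal_iff hnn]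
  calc _ ≤ ∑ i ∈ J, ∑' x, G i x * osc f x := (h1 _).trans (Finset.sum_le_sum fun i _ => hG f hf i)
    _ = ∑ i ∈ J, ∑ x ∈ J.biUnion S, G i x * osc f x := by
        refine Finset.sum_congr rfl fun i hi => tsum_eq_sum fun x hx => ?_
        rw [hGS i x fun hxi => hx (Finset.mem_biUnion.2 ⟨i, hi, hxi⟩), zero_mul]
    _ = ∑ x ∈ J.biUnion S, (∑ i ∈ J, G i x) * osc f x := by
        rw [Finset.sum_comm]
        exact Finset.sum_congr rfl fun x _ => by rw [Finset.sum_mul]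
    _ ≤ ∑ x ∈ J.biUnion S, γ x u * osc f x :=
        Finset.sum_le_sum fun x _ => mul_le_mul_left ((ENNReal.sum_le_tsum J).trans (hGγ x)) _
    _ = _ := by
        rw [ENNReal.ofReal_sum_of_nonneg
          fun x _ => mul_nonneg ENNReal.toReal_nonneg (oscR_nonneg _ _)]
        refine Finset.sum_congr rfl fun x _ => ?_
        rw [ENNReal.ofReal_mul ENNReal.toReal_nonneg, ofReal_oscR,
          ENNReal.ofReal_toReal (h.gamma_lt_top x u).ne]

/-- Finitely many moves need not heal a discrepancy at rate ε, so the nonnegative healing terms are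
discarded and 0 stands in place of ε. The influx is a finite sum, so f need not have finite triple
norm. -/
theorem oscR_partialGen (J : Finset ι) (f : C(Config E, ℝ)) (u : E) {l : ℝ} (hl : 0 ≤ l) :
    (1 + l * 0) * oscR f u ≤ oscR (f - l • partialGen σ r J f) u +
      l * ∑ x ∈ J.biUnion S, (γ x u).toReal * oscR f x := by
  refine oscR_resolvent (fun η hη s hs hmax => ?_) hl
  obtain ⟨e, e₀, he, hsum, hε, H⟩ := h.sum_discrepancy_le u η hη
  have h1 := H (s • f) hmax J
  have h2 : ∀ x, oscR (s • f) x = oscR f x := by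
    intro x
    rcases hs with rfl | rfl
    · rw [one_smul]
    · rw [neg_one_smul, oscR_neg]
  simp only [h2] at h1
  refine le_trans ?_ h1
  rw [zero_mul, add_zero, Finset.sum_add_distrib, Finset.sum_sub_distrib, ← map_smul,
    partialGen_apply, ContinuousMap.sum_apply, ContinuousMap.sum_apply]
  refine le_add_of_nonneg_right (Finset.sum_nonneg fun i _ => mul_nonneg (he i) ?_)
  exact (abs_nonneg _).trans (hmax η)

theorem gammaAct_osc_lt_top {f : C(Config E, ℝ)} (hf : tripleNorm f < ⊤) (u : E) :
    gammaAct γ (osc f) u < ⊤ :=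
  gammaAct_iterate_lt_top h.rowSup_lt_top 1 hf u

theorem sum_gamma_mul_oscR_le {f : C(Config E, ℝ)} (hf : tripleNorm f < ⊤) (u : E) (Λ : Finset E) :
    ∑ x ∈ Λ, (γ x u).toReal * oscR f x ≤ (gammaAct γ (osc f) u).toReal := by
  have hnn : ∀ x ∈ Λ, 0 ≤ (γ x u).toReal * oscR f x :=
    fun x _ => mul_nonneg ENNReal.toReal_nonneg (oscR_nonneg _ _)
  rw [← ENNReal.ofReal_le_ofReal_iff ENNReal.toReal_nonneg,
    ENNReal.ofReal_toReal (h.gammaAct_osc_lt_top hf u).ne, ENNReal.ofReal_sum_of_nonneg hnn]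
  refine le_trans (le_of_eq (Finset.sum_congr rfl fun x _ => ?_))
    (ENNReal.sum_le_tsum (f := fun x => osc f x * γ x u) Λ)
  rw [ENNReal.ofReal_mul ENNReal.toReal_nonneg, ofReal_oscR,
    ENNReal.ofReal_toReal (h.gamma_lt_top x u).ne, mul_comm]

/-- In the limit over all moves the healing rates add up to at least ε. -/
theorem oscR_fullGen {f : C(Config E, ℝ)} (hf : tripleNorm f < ⊤) (u : E) {l : ℝ} (hl : 0 ≤ l) :
    (1 + l * ε.toReal) * oscR f u ≤ oscR (f - l • fullGen σ r f) u +
      l * (gammaAct γ (osc f) u).toReal := by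
  refine oscR_resolvent (fun η hη s hs hmax => ?_) hl
  obtain ⟨e, e₀, he, hsum, hε, H⟩ := h.sum_discrepancy_le u η hη
  have h2 : ∀ x, oscR (s • f) x = oscR f x := by
    intro x
    rcases hs with rfl | rfl
    · rw [one_smul]
    · rw [neg_one_smul, oscR_neg]
  have hd : 0 ≤ (s • f) η - (s • f) (del u η) := (abs_nonneg _).trans (hmax η)
  have hev : ∀ ξ, HasSum (fun i => rateTerm σ r i (s • f) ξ) ((s • fullGen σ r f) ξ) := by
    intro ξ
    have h3 := (h.hasSum_fullGen hf).const_smul s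
    have h4 := h3.mapL (ContinuousMap.evalCLM ℝ ξ)
    simpa using h4
  have hS := ((hev η).sub (hev (del u η))).add (hsum.mul_right ((s • f) η - (s • f) (del u η)))
  have hle := le_of_tendsto' hS fun J => (H (s • f) hmax J).trans (by
    simp only [h2]
    exact h.sum_gamma_mul_oscR_le hf u _)
  have := mul_le_mul_of_nonneg_right hε hd
  linarith

end IsSpinSystem

end DPPDynamics

end

/-! ### Semigroups of finitely many moves and their convergence -/

noncomputable section

namespace DPPDynamics

variable {E : Type*} [DecidableEq E]

section Exponential

variable {V : Type*} [NormedAddCommGroup V] [NormedSpace ℝ V] [CompleteSpace V]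

theorem norm_exp_le_exp_norm (L : V →L[ℝ] V) : ‖NormedSpace.exp L‖ ≤ Real.exp ‖L‖ := by
  have h1 := NormedSpace.exp_series_hasSum_exp' (𝕂 := ℝ) L
  have h2 := NormedSpace.exp_series_hasSum_exp' (𝕂 := ℝ) ‖L‖
  rw [← Real.exp_eq_exp_ℝ] at h2
  rw [← h1.tsum_eq]
  refine tsum_of_norm_bounded h2 fun n => ?_
  rw [norm_smul, Real.norm_of_nonneg (by positivity), smul_eq_mul]
  gcongr
  cases n with
  | zero => exact ContinuousLinearMap.norm_id_le
  | succ n => exact norm_pow_le' L (Nat.succ_pos n)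

/-- The semigroup `exp(sL)` of a bounded operator. -/
def expSemigroup (L : V →L[ℝ] V) (s : ℝ) : V →L[ℝ] V := NormedSpace.exp (s • L)

omit [CompleteSpace V] in
@[simp] theorem expSemigroup_zero (L : V →L[ℝ] V) (f : V) : expSemigroup L 0 f = f := by
  simp [expSemigroup, NormedSpace.exp_zero]

theorem expSemigroup_add (L : V →L[ℝ] V) (s t : ℝ) (f : V) :
    expSemigroup L (s + t) f = expSemigroup L s (expSemigroup L t f) := by
  let _ : NormedAlgebra ℚ (V →L[ℝ] V) := NormedAlgebra.restrictScalars ℚ ℝ _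
  rw [expSemigroup, add_smul, NormedSpace.exp_add_of_commute]
  · rfl
  · exact ((Commute.refl _).smul_left s).smul_right t

theorem hasDerivAt_expSemigroup_apply (L : V →L[ℝ] V) (f : V) (s : ℝ) :
    HasDerivAt (fun s => expSemigroup L s f) (expSemigroup L s (L f)) s := by
  simpa [expSemigroup] using (hasDerivAt_exp_smul_const (𝕂 := ℝ) L s).clm_apply (hasDerivAt_const s f)

theorem hasDerivAt_expSemigroup_apply' (L : V →L[ℝ] V) (f : V) (s : ℝ) :
    HasDerivAt (fun s => expSemigroup L s f) (L (expSemigroup L s f)) s := by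
  simpa [expSemigroup] using (hasDerivAt_exp_smul_const' (𝕂 := ℝ) L s).clm_apply (hasDerivAt_const s f)

/-- The Duhamel interpolation: the path runs from exp(sL')f at t = 0 to exp(sL)f at t = s, and its
velocity contains only the difference of the generators. -/
theorem hasDerivAt_expSemigroup_comp (L L' : V →L[ℝ] V) (f : V) (s t : ℝ) :
    HasDerivAt (fun t => expSemigroup L' (s - t) (expSemigroup L t f))
      (-expSemigroup L' (s - t) (L' (expSemigroup L t f) - L (expSemigroup L t f))) t := by
  have h1 : HasDerivAt (fun t => expSemigroup L' (s - t)) (-(expSemigroup L' (s - t) * L')) t := by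
    have := (hasDerivAt_exp_smul_const (𝕂 := ℝ) L' (s - t)).scomp t ((hasDerivAt_id t).const_sub s)
    rw [neg_one_smul] at this
    exact this
  refine (h1.clm_apply (hasDerivAt_expSemigroup_apply' L f t)).congr_deriv ?_
  simp only [neg_apply, mul_apply_eq_comp, map_sub]
  abel

theorem continuous_expSemigroup_apply (L : V →L[ℝ] V) (f : V) :
    Continuous fun s => expSemigroup L s f :=
  continuous_iff_continuousAt.2 fun s => (hasDerivAt_expSemigroup_apply L f s).continuousAt

theorem expSemigroup_apply_of_eq_zero {L : V →L[ℝ] V} {f : V} (hf : L f = 0) (s : ℝ) :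
    expSemigroup L s f = f := by
  have h1 : ∀ t, HasDerivAt (fun s => expSemigroup L s f) 0 t := fun t => by
    simpa [hf] using hasDerivAt_expSemigroup_apply L f t
  have h2 := is_const_of_deriv_eq_zero (fun t => (h1 t).differentiableAt) (fun t => (h1 t).deriv) s 0
  simpa using h2

/-- `exp(sL)` is a contraction if `‖L + c‖ ≤ c` for some `c`. -/
theorem norm_expSemigroup_apply_le {L : V →L[ℝ] V} {c : ℝ} (hc : ‖L + c • 1‖ ≤ c) {s : ℝ}
    (hs : 0 ≤ s) (f : V) : ‖expSemigroup L s f‖ ≤ ‖f‖ := by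
  let _ : NormedAlgebra ℚ (V →L[ℝ] V) := NormedAlgebra.restrictScalars ℚ ℝ _
  -- Multiples of the identity commute with L, so exp(sL) = e^{-sc} exp(s(L + c)), and the second
  -- factor has norm at most e^{sc}.
  have e2 : expSemigroup L s = NormedSpace.exp (s • (L + c • 1)) *
      NormedSpace.exp (-(s * c) • 1) := by
    rw [← NormedSpace.exp_add_of_commute]
    · rw [expSemigroup]
      congr 1
      rw [smul_add, smul_smul, add_assoc, ← add_smul]
      simp
    · exact (Commute.one_right _).smul_right _
  have e3 : NormedSpace.exp (-(s * c) • (1 : V →L[ℝ] V)) = Real.exp (-(s * c)) • 1 := by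
    have := NormedSpace.algebraMap_exp_comm (𝕂 := ℝ) (𝔸 := V →L[ℝ] V) (-(s * c))
    rw [Algebra.algebraMap_eq_smul_one, Algebra.algebraMap_eq_smul_one, ← Real.exp_eq_exp_ℝ] at this
    exact this.symm
  rw [e2, e3, mul_smul_comm, mul_one, smul_apply, norm_smul, Real.norm_of_nonneg (Real.exp_pos _).le]
  have h4 : ‖NormedSpace.exp (s • (L + c • 1))‖ ≤ Real.exp (s * c) := by
    refine (norm_exp_le_exp_norm _).trans (Real.exp_le_exp.2 ?_)
    rw [norm_smul, Real.norm_of_nonneg hs]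
    exact mul_le_mul_of_nonneg_left hc hs
  calc Real.exp (-(s * c)) * ‖NormedSpace.exp (s • (L + c • 1)) f‖
      ≤ Real.exp (-(s * c)) * (Real.exp (s * c) * ‖f‖) := by
        gcongr
        exact (ContinuousLinearMap.le_opNorm _ _).trans (by gcongr)
    _ = ‖f‖ := by rw [← mul_assoc, ← Real.exp_add]; simp

end Exponential

namespace IsSpinSystem

variable {ι : Type*} {σ : ι → C(Config E, Config E)} {r : ι → C(Config E, ℝ)}
  {S : ι → Finset E} {γ : E → E → ℝ≥0∞} {ε : ℝ≥0∞}

variable (σ r) in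
/-- The semigroup `exp(s L_J)` of the moves `i ∈ J`. -/
def partialSemigroup (J : Finset ι) (s : ℝ) : C(Config E, ℝ) →L[ℝ] C(Config E, ℝ) :=
  expSemigroup (partialGen σ r J) s

omit [DecidableEq E] in
theorem partialSemigroup_one (J : Finset ι) (s : ℝ) : partialSemigroup σ r J s 1 = 1 := by
  refine expSemigroup_apply_of_eq_zero ?_ s
  rw [partialGen_apply]
  refine Finset.sum_eq_zero fun i _ => ?_
  ext ξ
  simp

omit [DecidableEq E] in
-- Uniformization: after adding c = ∑ ‖r_i‖, the generator is the sum of the terms r_i (g ∘ σ_i) +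
-- (‖r_i‖ - r_i) g, whose coefficients are nonnegative and add up to c.
theorem norm_partialSemigroup_apply_le (hr : ∀ i ξ, 0 ≤ r i ξ) (J : Finset ι) {s : ℝ} (hs : 0 ≤ s)
    (f : C(Config E, ℝ)) : ‖partialSemigroup σ r J s f‖ ≤ ‖f‖ := by
  refine norm_expSemigroup_apply_le (c := ∑ i ∈ J, ‖r i‖) ?_ hs f
  have hc0 : 0 ≤ ∑ i ∈ J, ‖r i‖ := Finset.sum_nonneg fun i _ => norm_nonneg _
  refine ContinuousLinearMap.opNorm_le_bound _ hc0 fun g => ?_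
  rw [ContinuousMap.norm_le _ (by positivity)]
  intro ξ
  have e1 : (partialGen σ r J + (∑ i ∈ J, ‖r i‖) • 1) g ξ =
      ∑ i ∈ J, (r i ξ * g (σ i ξ) + (‖r i‖ - r i ξ) * g ξ) := by
    simp only [add_apply, smul_apply, ContinuousMap.add_apply,
      ContinuousMap.smul_apply, partialGen_apply, ContinuousMap.sum_apply, rateTerm_apply,
      one_apply_eq_self, smul_eq_mul, Finset.sum_mul, ← Finset.sum_add_distrib]
    exact Finset.sum_congr rfl fun i _ => by ring
  rw [e1, Finset.sum_mul]
  refine (norm_sum_le _ _).trans (Finset.sum_le_sum fun i _ => ?_)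
  have h1 : 0 ≤ ‖r i‖ - r i ξ := sub_nonneg.2 ((le_abs_self _).trans ((r i).norm_coe_le_norm ξ))
  calc ‖r i ξ * g (σ i ξ) + (‖r i‖ - r i ξ) * g ξ‖
      ≤ r i ξ * ‖g‖ + (‖r i‖ - r i ξ) * ‖g‖ := by
        refine (norm_add_le _ _).trans (add_le_add ?_ ?_)
        · rw [norm_mul, Real.norm_of_nonneg (hr i ξ)]
          exact mul_le_mul_of_nonneg_left (g.norm_coe_le_norm _) (hr i ξ)
        · rw [norm_mul, Real.norm_of_nonneg h1]
          exact mul_le_mul_of_nonneg_left (g.norm_coe_le_norm _) h1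
    _ = ‖r i‖ * ‖g‖ := by ring

theorem osc_partialSemigroup_le (h : IsSpinSystem σ r S γ ε) (J : Finset ι)
    {f : C(Config E, ℝ)} (hf : tripleNorm f < ⊤) {s : ℝ} (hs : 0 ≤ s) (u : E) :
    osc (partialSemigroup σ r J s f) u ≤ expGamma γ s.toNNReal (osc f) u := by
  set F : ℝ → C(Config E, ℝ) := fun t => partialSemigroup σ r J t f with hF
  set F' : ℝ → C(Config E, ℝ) := fun t => partialGen σ r J (F t) with hF'
  have hFc : Continuous F := continuous_expSemigroup_apply _ f
  have hFc' : Continuous F' := (partialGen σ r J).continuous.comp hFc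
  have hd : ∀ t ∈ Set.Ico 0 s, HasDerivWithinAt F (F' t) (Set.Ioi t) t :=
    fun t _ => (hasDerivAt_expSemigroup_apply' _ f t).hasDerivWithinAt
  have hF0 : F 0 = f := by simp [hF, partialSemigroup]
  -- The exponential bound needs a summable dominating function in advance. Bounding every
  -- oscillation in the finite influx by 2‖f‖ gives growth at most linear in time with slope c, and
  -- c is summable because it is a finite combination of rows of γ.
  set c : E → ℝ := fun v => ∑ x ∈ J.biUnion S, (γ x v).toReal * (2 * ‖f‖) with hc
  have hc0 : ∀ v, 0 ≤ c v := fun v => Finset.sum_nonneg fun x _ =>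
    mul_nonneg ENNReal.toReal_nonneg (by positivity)
  have apriori : ∀ t ∈ Set.Icc 0 s, ∀ v, oscR (F t) v ≤ oscR f v + s * c v := by
    intro t ht v
    have := oscR_le_of_resolvent_bound (F := F) (F' := F') (u := v) (τ := s) (ε := 0)
      (p := fun _ => c v) (P := fun t => t * c v) hFc.continuousOn hFc'.continuousOn hd
      continuous_const (fun t => by simpa using (hasDerivAt_id t).mul_const (c v))
      (fun t ht l hl => (h.oscR_partialGen J (F t) v hl).trans (by
        gcongr
        simp only [neg_zero, zero_mul, Real.exp_zero, one_mul, hc]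
        refine Finset.sum_le_sum fun x _ => mul_le_mul_of_nonneg_left ?_ ENNReal.toReal_nonneg
        refine (oscR_le_two_norm _ _).trans ?_
        have := norm_partialSemigroup_apply_le (σ := σ) h.rate_nonneg J ht.1 f
        gcongr)) t ht
    simp only [neg_zero, zero_mul, Real.exp_zero, one_mul, hF0, sub_zero] at this
    exact this.trans (by have := mul_le_mul_of_nonneg_right ht.2 (hc0 v); linarith)
  set χ : E → ℝ≥0∞ := fun v => osc f v + ENNReal.ofReal (s * c v) with hχdef
  have hχ : ∑' v, χ v < ⊤ := by
    rw [ENNReal.tsum_add]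
    refine ENNReal.add_lt_top.2 ⟨hf, ?_⟩
    have h1 : ∀ v, ENNReal.ofReal (s * c v) =
        ENNReal.ofReal (s * (2 * ‖f‖)) * ∑ x ∈ J.biUnion S, γ x v := by
      intro v
      have h2 : s * c v = s * (2 * ‖f‖) * ∑ x ∈ J.biUnion S, (γ x v).toReal := by
        rw [hc]; simp only [← Finset.sum_mul]; ring
      rw [h2, ENNReal.ofReal_mul (by positivity),
        ← ENNReal.toReal_sum fun x _ => (h.gamma_lt_top x v).ne, ENNReal.ofReal_toReal]
      exact (ENNReal.sum_lt_top.2 fun x _ => h.gamma_lt_top x v).ne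
    simp only [h1]
    rw [ENNReal.tsum_mul_left, Summable.tsum_finsetSum fun _ _ => ENNReal.summable]
    refine ENNReal.mul_lt_top ENNReal.ofReal_lt_top (ENNReal.sum_lt_top.2 fun x _ => ?_)
    exact (le_iSup (fun x => ∑' u, γ x u) x).trans_lt h.rowSup_lt_top
  have hdom : ∀ t ∈ Set.Icc 0 s, ∀ v, osc (F t) v ≤ χ v := by
    intro t ht v
    change osc (F t) v ≤ osc f v + ENNReal.ofReal (s * c v)
    rw [← ofReal_oscR (F t), ← ofReal_oscR f,
      ← ENNReal.ofReal_add (oscR_nonneg _ _) (mul_nonneg hs (hc0 v))]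
    exact ENNReal.ofReal_le_ofReal (apriori t ht v)
  have := osc_le_expGamma_of_resolvent_bound h.rowSup_lt_top (F := F) (F' := F') hs (ε := 0) le_rfl
    hFc.continuousOn hFc'.continuousOn hd hχ hdom (fun t ht v l hl =>
      (h.oscR_partialGen J (F t) v hl).trans (by
        gcongr
        refine h.sum_gamma_mul_oscR_le ?_ v _
        exact (ENNReal.tsum_le_tsum (hdom t ht)).trans_lt hχ)) s ⟨hs, le_rfl⟩ u
  simpa [hF0] using this

variable (h : IsSpinSystem σ r S γ ε)
include h

/-- Comparison of the partial semigroups for two nested sets of moves. -/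
theorem norm_partialSemigroup_sub_le {f : C(Config E, ℝ)} (hf : tripleNorm f < ⊤) {τ : ℝ≥0}
    {J J' : Finset ι} (hJ : J ⊆ J') {s : ℝ} (hs : 0 ≤ s) (hsτ : s ≤ τ) [DecidableEq ι] :
    ‖partialSemigroup σ r J' s f - partialSemigroup σ r J s f‖ ≤
      s * ∑ i ∈ J' \ J, ‖r i‖ * ∑ x ∈ S i, (expGamma γ τ (osc f) x).toReal := by
  set Q : ℝ := ∑ i ∈ J' \ J, ‖r i‖ * ∑ x ∈ S i, (expGamma γ τ (osc f) x).toReal with hQ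
  have hd : ∀ t ∈ Set.Icc 0 s, HasDerivWithinAt
      (fun t => partialSemigroup σ r J' (s - t) (partialSemigroup σ r J t f))
      (-partialSemigroup σ r J' (s - t)
        (partialGen σ r J' (partialSemigroup σ r J t f) -
          partialGen σ r J (partialSemigroup σ r J t f))) (Set.Icc 0 s) t :=
    fun t _ => (hasDerivAt_expSemigroup_comp _ _ f s t).hasDerivWithinAt
  have hb : ∀ t ∈ Set.Ico 0 s, ‖-partialSemigroup σ r J' (s - t)
        (partialGen σ r J' (partialSemigroup σ r J t f) -
          partialGen σ r J (partialSemigroup σ r J t f))‖ ≤ Q := by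
    intro t ht
    rw [norm_neg]
    -- The outer semigroup is a contraction and the two generators differ by the moves in J' \ J.
    -- The oscillations of the inner path are bounded independently of J.
    refine (norm_partialSemigroup_apply_le h.rate_nonneg J' (sub_nonneg.2 ht.2.le) _).trans ?_
    rw [partialGen_apply, partialGen_apply, ← Finset.sum_sdiff hJ, add_sub_cancel_right]
    refine (norm_sum_le _ _).trans (Finset.sum_le_sum fun i _ => ?_)
    refine (h.norm_rateTerm_le i _).trans ?_
    gcongr with x _
    refine ENNReal.toReal_mono ?_ ?_
    · exact ((ENNReal.le_tsum x).trans_lt (tsum_expGamma_lt_top h.rowSup_lt_top τ hf)).ne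
    · refine (h.osc_partialSemigroup_le J hf ht.1 x).trans (expGamma_mono ?_ _ _)
      exact Real.toNNReal_le_iff_le_coe.2 (ht.2.le.trans hsτ)
  have := norm_image_sub_le_of_norm_deriv_le_segment' hd hb s ⟨hs, le_rfl⟩
  simp only [sub_self, sub_zero, partialSemigroup, expSemigroup_zero] at this
  rw [norm_sub_rev, mul_comm]
  exact this

/-- On D(𝒳) the comparison of nested sets leaves a tail of a convergent series; contractivity and
density extend this to all f. -/
theorem cauchySeq_partialSemigroup (f : C(Config E, ℝ)) (s : ℝ≥0) :
    CauchySeq fun J : Finset ι => partialSemigroup σ r J s f := by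
  classical
  have hD : ∀ g : C(Config E, ℝ), tripleNorm g < ⊤ →
      CauchySeq fun J : Finset ι => partialSemigroup σ r J s g := by
    intro g hg
    have hW := h.summable_weight (tsum_expGamma_lt_top h.rowSup_lt_top s hg)
    rw [Metric.cauchySeq_iff']
    intro δ hδ
    -- s + 1 instead of s keeps the divisor positive at s = 0.
    have hs1 : (0 : ℝ) < s + 1 := by positivity
    obtain ⟨J, hJ⟩ := (summable_iff_vanishing_norm.1 hW) (δ / (s + 1)) (by positivity)
    refine ⟨J, fun J' hJJ' => ?_⟩
    rw [dist_eq_norm]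
    have h1 := h.norm_partialSemigroup_sub_le hg (τ := s) hJJ' s.2 le_rfl
    have h2 := (le_abs_self _).trans_lt (hJ (J' \ J) Finset.sdiff_disjoint)
    have h3 : 0 ≤ ∑ i ∈ J' \ J, ‖r i‖ * ∑ x ∈ S i, (expGamma γ s (osc g) x).toReal :=
      Finset.sum_nonneg fun i _ => mul_nonneg (norm_nonneg _)
        (Finset.sum_nonneg fun x _ => ENNReal.toReal_nonneg)
    rw [lt_div_iff₀ hs1] at h2
    refine h1.trans_lt (lt_of_le_of_lt ?_ h2)
    change (s : ℝ) * _ ≤ _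
    nlinarith
  rw [Metric.cauchySeq_iff']
  intro δ hδ
  obtain ⟨g, hg, hgf⟩ := Metric.dense_iff.1 dense_finiteOsc f (δ / 3) (by positivity)
  rw [Metric.mem_ball, dist_comm, dist_eq_norm] at hg
  obtain ⟨J, hJ⟩ := Metric.cauchySeq_iff'.1 (hD g hgf) (δ / 3) (by positivity)
  refine ⟨J, fun J' hJJ' => ?_⟩
  have h1 := hJ J' hJJ'
  have hb : ∀ J : Finset ι, dist (partialSemigroup σ r J s f) (partialSemigroup σ r J s g) < δ / 3 := by
    intro J
    rw [dist_eq_norm, ← map_sub]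
    exact (norm_partialSemigroup_apply_le h.rate_nonneg J s.2 _).trans_lt hg
  calc dist (partialSemigroup σ r J' s f) (partialSemigroup σ r J s f)
      ≤ dist (partialSemigroup σ r J' s f) (partialSemigroup σ r J' s g) +
        dist (partialSemigroup σ r J' s g) (partialSemigroup σ r J s g) +
        dist (partialSemigroup σ r J s g) (partialSemigroup σ r J s f) := dist_triangle4 _ _ _ _
    _ < δ / 3 + δ / 3 + δ / 3 := by
        have h2 := hb J
        rw [dist_comm] at h2
        exact add_lt_add (add_lt_add (hb J') h1) h2
    _ = δ := by ring

theorem exists_limit_semigroup : ∃ T : ℝ≥0 → C(Config E, ℝ) →L[ℝ] C(Config E, ℝ),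
    ∀ (s : ℝ≥0) f, Tendsto (fun J : Finset ι => partialSemigroup σ r J s f) atTop (𝓝 (T s f)) := by
  choose L hL using fun (s : ℝ≥0) (f : C(Config E, ℝ)) =>
    cauchySeq_tendsto_of_complete (h.cauchySeq_partialSemigroup f s)
  refine ⟨fun s => LinearMap.mkContinuous
    { toFun := L s
      map_add' := fun f g => tendsto_nhds_unique (hL s (f + g)) (by
        simpa using (hL s f).add (hL s g))
      map_smul' := fun c f => tendsto_nhds_unique (hL s (c • f)) (by
        simpa using (hL s f).const_smul c) } 1 (fun f => ?_), fun s f => hL s f⟩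
  rw [one_mul]
  exact le_of_tendsto' (hL s f).norm fun J => norm_partialSemigroup_apply_le h.rate_nonneg J s.2 f

end IsSpinSystem

end DPPDynamics

end

/-! ### The limit semigroup and the existence theorem -/

noncomputable section

namespace DPPDynamics

variable {E : Type*} [DecidableEq E]

namespace IsSpinSystem

variable {ι : Type*} {σ : ι → C(Config E, Config E)} {r : ι → C(Config E, ℝ)}
  {S : ι → Finset E} {γ : E → E → ℝ≥0∞} {ε : ℝ≥0∞} (h : IsSpinSystem σ r S γ ε)
  {T : ℝ≥0 → C(Config E, ℝ) →L[ℝ] C(Config E, ℝ)}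
  (hT : ∀ (s : ℝ≥0) f, Tendsto (fun J : Finset ι => partialSemigroup σ r J s f) atTop (𝓝 (T s f)))
include h hT

theorem norm_limit_le (s : ℝ≥0) (f : C(Config E, ℝ)) : ‖T s f‖ ≤ ‖f‖ :=
  le_of_tendsto' (hT s f).norm fun J => norm_partialSemigroup_apply_le h.rate_nonneg J s.2 f

/-- For g in D(𝒳) the norms ‖L_J g‖ are bounded uniformly in J, so all orbits are Lipschitz with one
constant. General orbits are uniform limits of these. -/
theorem continuous_limit (f : C(Config E, ℝ)) : Continuous fun s => T s f := by
  have hD : ∀ g : C(Config E, ℝ), tripleNorm g < ⊤ → Continuous fun s => T s g := by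
    intro g hg
    have hW := h.summable_weight hg
    set B : ℝ := ∑' i, ‖r i‖ * ∑ x ∈ S i, oscR g x with hB
    have hgen : ∀ J, ‖partialGen σ r J g‖ ≤ B := by
      intro J
      rw [partialGen_apply]
      refine (norm_sum_le _ _).trans ((Finset.sum_le_sum fun i _ => h.norm_rateTerm_le i g).trans ?_)
      exact hW.sum_le_tsum J fun i _ => mul_nonneg (norm_nonneg _)
        (Finset.sum_nonneg fun x _ => oscR_nonneg g x)
    have hB0 : 0 ≤ B := (norm_nonneg _).trans (hgen ∅)
    refine (LipschitzWith.of_dist_le_mul (K := B.toNNReal) fun s t => ?_).continuous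
    rw [dist_eq_norm, Real.coe_toNNReal _ hB0]
    refine le_of_tendsto' ((hT s g).sub (hT t g)).norm fun J => ?_
    have := (convex_Ici (0 : ℝ)).norm_image_sub_le_of_norm_hasDerivWithin_le (C := B)
      (f := fun s => partialSemigroup σ r J s g)
      (fun x _ => (hasDerivAt_expSemigroup_apply (partialGen σ r J) g x).hasDerivWithinAt)
      (fun x hx => (norm_partialSemigroup_apply_le h.rate_nonneg J hx _).trans (hgen J))
      (show (t : ℝ) ∈ Set.Ici 0 from t.2) (show (s : ℝ) ∈ Set.Ici 0 from s.2)
    exact this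
  refine continuous_of_uniform_approx_of_continuous fun U hU => ?_
  obtain ⟨δ, hδ, hδU⟩ := Metric.mem_uniformity_dist.1 hU
  obtain ⟨g, hg, hgf⟩ := Metric.dense_iff.1 dense_finiteOsc f δ hδ
  refine ⟨fun s => T s g, hD g hgf, fun s => hδU ?_⟩
  rw [Metric.mem_ball, dist_comm, dist_eq_norm] at hg
  rw [dist_eq_norm, ← map_sub]
  exact (h.norm_limit_le hT s _).trans_lt hg

theorem isContractionSemigroup : IsContractionSemigroup T where
  zero f := tendsto_nhds_unique (hT 0 f) (by simp [partialSemigroup])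
  add s t f := by
    refine tendsto_nhds_unique (hT (s + t) f) ?_
    have h1 : Tendsto (fun J : Finset ι => partialSemigroup σ r J s (T t f) +
        partialSemigroup σ r J s (partialSemigroup σ r J t f - T t f)) atTop
        (𝓝 (T s (T t f) + 0)) := by
      refine (hT s (T t f)).add ?_
      refine squeeze_zero_norm (a := fun J => ‖partialSemigroup σ r J t f - T t f‖)
        (fun J => norm_partialSemigroup_apply_le h.rate_nonneg J s.2 _) ?_
      exact tendsto_iff_norm_sub_tendsto_zero.1 (hT t f)
    rw [add_zero] at h1
    refine h1.congr fun J => ?_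
    rw [map_sub, add_sub_cancel, NNReal.coe_add]
    exact (expSemigroup_add _ _ _ _).symm
  norm_le := h.norm_limit_le hT
  continuous := h.continuous_limit hT

/-- This bound without ε gives the invariance of D(𝒳) and the summable domination on which the bound
with ε relies. -/
theorem osc_limit_le {f : C(Config E, ℝ)} (hf : tripleNorm f < ⊤) (s : ℝ≥0) (u : E) :
    osc (T s f) u ≤ expGamma γ s (osc f) u := by
  have h1 : Tendsto (fun J : Finset ι => osc (partialSemigroup σ r J s f) u) atTop
      (𝓝 (osc (T s f) u)) := by
    simp only [← ofReal_oscR]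
    exact ENNReal.tendsto_ofReal (((continuous_oscR u).tendsto _).comp (hT s f))
  refine le_of_tendsto' h1 fun J => ?_
  simpa using h.osc_partialSemigroup_le J hf s.2 u

theorem tripleNorm_limit_lt_top {f : C(Config E, ℝ)} (hf : tripleNorm f < ⊤) (s : ℝ≥0) :
    tripleNorm (T s f) < ⊤ :=
  (ENNReal.tsum_le_tsum (h.osc_limit_le hT hf s)).trans_lt
    (tsum_expGamma_lt_top h.rowSup_lt_top s hf)

/-- For a large finite J, T_s f and exp(sL_J) f differ by at most a small multiple of s, uniformly
for s ≤ 1. The derivative at 0 can therefore be computed with the bounded generator L_J, which is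
itself close to L on f. -/
theorem fullGen_mem_generatorGraph {f : C(Config E, ℝ)} (hf : tripleNorm f < ⊤) :
    (f, fullGen σ r f) ∈ generatorGraph T := by
  classical
  change Tendsto (fun s : ℝ≥0 => (s : ℝ)⁻¹ • (T s f - f)) (𝓝[>] 0) (𝓝 (fullGen σ r f))
  rw [Metric.tendsto_nhds]
  intro δ hδ
  have hW := h.summable_weight (tsum_expGamma_lt_top h.rowSup_lt_top 1 hf)
  obtain ⟨J₁, hJ₁⟩ := (summable_iff_vanishing_norm.1 hW) (δ / 3) (by positivity)
  have hgen := Metric.tendsto_atTop.1 (h.hasSum_fullGen hf : Tendsto _ _ _) (δ / 3) (by positivity)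
  obtain ⟨J₂, hJ₂⟩ := hgen
  set J := J₁ ∪ J₂ with hJ
  have h2 : ‖partialGen σ r J f - fullGen σ r f‖ < δ / 3 := by
    have := hJ₂ J Finset.subset_union_right
    rwa [dist_eq_norm, ← partialGen_apply] at this
  have h1 : ∀ s : ℝ≥0, s ≤ 1 → ‖T s f - partialSemigroup σ r J s f‖ ≤ s * (δ / 3) := by
    intro s hs
    refine le_of_tendsto ((hT s f).sub_const _).norm ?_
    filter_upwards [eventually_ge_atTop J] with J' hJ'
    refine (h.norm_partialSemigroup_sub_le hf (τ := 1) hJ' s.2 (by exact_mod_cast hs)).trans ?_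
    refine mul_le_mul_of_nonneg_left ?_ s.2
    refine ((le_abs_self _).trans_lt (hJ₁ (J' \ J) ?_)).le
    exact (Finset.sdiff_disjoint (s := J) (t := J')).mono_right Finset.subset_union_left
  have h3 := (hasDerivAt_expSemigroup_apply (partialGen σ r J) f 0).hasDerivWithinAt (s := Set.Ioi 0)
  rw [hasDerivWithinAt_iff_tendsto_slope' (by simp), expSemigroup_zero] at h3
  have h4 := Metric.tendsto_nhds.1 (h3.comp tendsto_coe_nhdsGT_zero) (δ / 3) (by positivity)
  have h5 : ∀ᶠ s : ℝ≥0 in 𝓝[>] 0, s ≤ 1 :=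
    mem_nhdsWithin_of_mem_nhds (Iic_mem_nhds (by norm_num))
  filter_upwards [h4, h5, self_mem_nhdsWithin] with s hs4 hs5 hs0
  have hs0' : (0 : ℝ) < s := by exact_mod_cast hs0
  simp only [Function.comp, slope_def_module, sub_zero, expSemigroup_zero, dist_eq_norm] at hs4
  rw [dist_eq_norm]
  have e : (s : ℝ)⁻¹ • (T s f - f) - fullGen σ r f =
      (s : ℝ)⁻¹ • (T s f - partialSemigroup σ r J s f) +
        ((s : ℝ)⁻¹ • (partialSemigroup σ r J s f - f) - partialGen σ r J f) +
        (partialGen σ r J f - fullGen σ r f) := by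
    simp only [smul_sub]; abel
  rw [e]
  have h6 : ‖(s : ℝ)⁻¹ • (T s f - partialSemigroup σ r J s f)‖ ≤ δ / 3 := by
    rw [norm_smul, norm_inv, Real.norm_of_nonneg hs0'.le, inv_mul_le_iff₀ hs0']
    exact h1 s hs5
  refine (norm_add₃_le).trans_lt ?_
  have : ‖(s : ℝ)⁻¹ • (partialSemigroup σ r J s f - f) - partialGen σ r J f‖ < δ / 3 := hs4
  linarith

theorem fullGen_limit {f : C(Config E, ℝ)} (hf : tripleNorm f < ⊤) (s : ℝ≥0) :
    fullGen σ r (T s f) = T s (fullGen σ r f) := by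
  have h1 := h.fullGen_mem_generatorGraph hT (h.tripleNorm_limit_lt_top hT hf s)
  have h2 : Tendsto (fun t : ℝ≥0 => (t : ℝ)⁻¹ • (T t (T s f) - T s f)) (𝓝[>] 0)
      (𝓝 (T s (fullGen σ r f))) := by
    have h3 := ((T s).continuous.tendsto _).comp (h.fullGen_mem_generatorGraph hT hf)
    refine h3.congr fun t => ?_
    simp only [Function.comp, map_smul, map_sub]
    rw [← (h.isContractionSemigroup hT).add, ← (h.isContractionSemigroup hT).add, add_comm]
  exact tendsto_nhds_unique h1 h2

/-- Along the orbit the derivative T_s L f equals L T_s f and T_s f stays in D(𝒳), so the inequality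
for the full generator, which contains ε, applies at every time. -/
theorem osc_limit_le_exp {f : C(Config E, ℝ)} (hf : tripleNorm f < ⊤) (s : ℝ≥0) (u : E) :
    osc (T s f) u ≤ ENNReal.ofReal (Real.exp (-ε.toReal * s)) * expGamma γ s (osc f) u := by
  have hS := h.isContractionSemigroup hT
  have hdom : ∀ t ∈ Set.Icc (0 : ℝ) s, ∀ v, osc (orbit T f t) v ≤ expGamma γ s (osc f) v := by
    intro t ht v
    refine (h.osc_limit_le hT hf t.toNNReal v).trans (expGamma_mono ?_ _ _)
    exact Real.toNNReal_le_iff_le_coe.2 ht.2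
  have := osc_le_expGamma_of_resolvent_bound h.rowSup_lt_top (F := orbit T f)
    (F' := orbit T (fullGen σ r f)) (τ := s) (ε := ε.toReal) s.2 ENNReal.toReal_nonneg
    (hS.continuous_orbit f).continuousOn (hS.continuous_orbit _).continuousOn
    (fun t ht => hS.hasDerivWithinAt_orbit (h.fullGen_mem_generatorGraph hT hf) ht.1)
    (tsum_expGamma_lt_top h.rowSup_lt_top s hf) hdom
    (fun t _ v l hl => by
      have h1 := h.oscR_fullGen (h.tripleNorm_limit_lt_top hT hf t.toNNReal) v hl
      rwa [h.fullGen_limit hT hf] at h1) s ⟨s.2, le_rfl⟩ u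
  simpa [orbit, hS.zero] using this

omit hT in
/-- The existence theorem for spin systems. -/
theorem existenceConclusions (terms : C(Config E, ℝ) → Config E → ι → ℝ)
    (hterms : ∀ f ξ i, terms f ξ i = rateTerm σ r i f ξ) : ExistenceConclusions terms γ ε := by
  obtain ⟨T, hT⟩ := h.exists_limit_semigroup
  have hS := h.isContractionSemigroup hT
  let L : C(Config E, ℝ) →ₗ.[ℝ] C(Config E, ℝ) :=
    { domain := finiteOsc E
      toFun :=
        { toFun := fun f => fullGen σ r f
          map_add' := fun f g => by
            have := ((h.hasSum_fullGen f.2).add (h.hasSum_fullGen g.2)).tsum_eq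
            simpa [fullGen] using this
          map_smul' := fun c f => by
            have := ((h.hasSum_fullGen f.2).const_smul c).tsum_eq
            simpa [fullGen] using this } }
  have hLgraph : ∀ p : C(Config E, ℝ) × C(Config E, ℝ),
      p ∈ L.graph ↔ tripleNorm p.1 < ⊤ ∧ fullGen σ r p.1 = p.2 := by
    intro p
    rw [LinearPMap.mem_graph_iff]
    constructor
    · rintro ⟨y, hy, hy2⟩
      rw [← hy]
      exact ⟨y.2, hy2⟩
    · rintro ⟨h1, h2⟩
      exact ⟨⟨p.1, h1⟩, rfl, h2⟩
  have hsub : (L.graph : Set (C(Config E, ℝ) × C(Config E, ℝ))) ⊆ generatorGraph T := by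
    intro p hp
    obtain ⟨h1, h2⟩ := (hLgraph p).1 hp
    have := h.fullGen_mem_generatorGraph hT h1
    rwa [h2] at this
  have hclosure : closure (L.graph : Set (C(Config E, ℝ) × C(Config E, ℝ))) = generatorGraph T := by
    refine Set.Subset.antisymm (closure_minimal hsub hS.isClosed_generatorGraph) ?_
    refine hS.generatorGraph_subset_closure L.graph hsub ?_ ?_
    · refine dense_finiteOsc.mono fun f hf => ?_
      exact ⟨(f, fullGen σ r f), (hLgraph _).2 ⟨hf, rfl⟩, rfl⟩
    · intro p hp s
      obtain ⟨h1, h2⟩ := (hLgraph p).1 hp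
      refine (hLgraph _).2 ⟨h.tripleNorm_limit_lt_top hT h1 s, ?_⟩
      rw [← h2]
      exact h.fullGen_limit hT h1 s
  -- A pair (0, h) in the closure of the graph belongs to the generator of T, and T_s 0 = 0 forces h
  -- = 0.
  have hclosable : L.IsClosable := by
    refine ⟨L.graph.topologicalClosure.toLinearPMap, ?_⟩
    refine (Submodule.toLinearPMap_graph_eq _ ?_).symm
    intro p hp hp0
    have hp' : p ∈ generatorGraph T := by
      rw [← hclosure, ← Submodule.topologicalClosure_coe]
      exact hp
    have hp'' : Tendsto (fun s : ℝ≥0 => (s : ℝ)⁻¹ • (T s p.1 - p.1)) (𝓝[>] 0) (𝓝 p.2) := hp'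
    rw [hp0] at hp''
    simp only [map_zero, sub_zero, smul_zero] at hp''
    exact (tendsto_nhds_unique hp'' tendsto_const_nhds)
  have hgen : ∀ p : C(Config E, ℝ) × C(Config E, ℝ),
      p ∈ L.closure.graph ↔ p ∈ generatorGraph T := by
    intro p
    rw [← hclosable.graph_closure_eq_closure_graph, ← hclosure,
      ← Submodule.topologicalClosure_coe]
    rfl
  have hone : ∀ s, T s 1 = 1 := fun s =>
    tendsto_nhds_unique (hT s 1) (by simp [partialSemigroup_one])
  -- A contraction that fixes 1 is positive: if f ≥ 0 then ‖f‖ - f has norm at most ‖f‖, so ‖f‖ -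
  -- T_s f ≤ ‖f‖.
  have hnonneg : ∀ s f, 0 ≤ f → 0 ≤ T s f := by
    intro s f hf
    rw [ContinuousMap.le_def]
    intro ξ
    have h1 := h.norm_limit_le hT s (‖f‖ • 1 - f)
    have h2 : ‖‖f‖ • (1 : C(Config E, ℝ)) - f‖ ≤ ‖f‖ := by
      rw [ContinuousMap.norm_le _ (norm_nonneg _)]
      intro η
      have h3 := f.norm_coe_le_norm η
      have h4 : 0 ≤ f η := hf η
      rw [Real.norm_eq_abs, abs_of_nonneg h4] at h3
      simp only [ContinuousMap.sub_apply, ContinuousMap.smul_apply, ContinuousMap.one_apply,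
        smul_eq_mul, mul_one, Real.norm_eq_abs, abs_le]
      constructor <;> linarith
    have h5 := ((T s (‖f‖ • 1 - f)).norm_coe_le_norm ξ).trans (h1.trans h2)
    rw [map_sub, map_smul, hone] at h5
    simp only [ContinuousMap.sub_apply, ContinuousMap.smul_apply, ContinuousMap.one_apply,
      smul_eq_mul, mul_one, Real.norm_eq_abs, abs_le] at h5
    change 0 ≤ T s f ξ
    linarith [h5.2]
  refine ⟨L, ⟨fun f => Iff.rfl, fun f ξ => ?_⟩, hclosable, fun s => (T s).toLinearMap, ?_, ⟨?_, ?_⟩,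
    L.closureHasCore, ?_, ?_⟩
  · have := (h.hasSum_fullGen f.2).mapL (ContinuousMap.evalCLM ℝ ξ)
    rw [funext (hterms f ξ)]
    exact this
  · exact
      { zero := by ext1 f; exact hS.zero f
        add := fun s t => by ext1 f; exact hS.add s t f
        right_continuous := fun f t => (hS.continuous f).continuousWithinAt
        one := hone
        nonneg := hnonneg }
  · refine ⟨⟨?_, ?_, ?_⟩, hclosable.closure_isClosed, 1, one_pos, fun c hc _ g => ?_⟩
    · rw [hgen]
      change Tendsto (fun s : ℝ≥0 => (s : ℝ)⁻¹ • (T s 1 - 1)) (𝓝[>] 0) (𝓝 0)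
      simp [hone]
    · exact dense_finiteOsc.mono L.le_closure.1
    · intro f c hc m hm
      have hmem := (hgen _).1 (L.closure.mem_graph f)
      have hlim : Tendsto (fun s : ℝ≥0 => (s : ℝ)⁻¹ • (T s (f : C(Config E, ℝ)) - f)) (𝓝[>] 0)
        (𝓝 (L.closure f)) := hmem
      -- At a minimizer η of f, positivity of T gives T_s f(η) ≥ f(η), so the generator is
      -- nonnegative there; this yields the minimum principle.
      obtain ⟨η, -, hη⟩ := isCompact_univ.exists_isMinOn Set.univ_nonempty
        (f : C(Config E, ℝ)).continuous.continuousOn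
      have hη' : ∀ ξ, (f : C(Config E, ℝ)) η ≤ (f : C(Config E, ℝ)) ξ := fun ξ =>
        hη (Set.mem_univ ξ)
      have hpos : 0 ≤ L.closure f η := by
        have h1 := ((ContinuousMap.evalCLM ℝ η).continuous.tendsto _).comp hlim
        refine ge_of_tendsto' h1 fun s => ?_
        have h2 := hnonneg s (f - (f : C(Config E, ℝ)) η • 1) (by
          rw [ContinuousMap.le_def]
          intro ξ
          simpa using hη' ξ) η
        rw [map_sub, map_smul, hone] at h2
        change 0 ≤ T s f η - (f : C(Config E, ℝ)) η * 1 at h2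
        rw [mul_one] at h2
        simp only [Function.comp, ContinuousMap.evalCLM_apply, ContinuousMap.smul_apply,
          ContinuousMap.sub_apply, smul_eq_mul]
        exact mul_nonneg (inv_nonneg.2 s.2) h2
      intro ξ
      have h3 := hm η
      simp only [ContinuousMap.sub_apply, ContinuousMap.smul_apply, smul_eq_mul] at h3
      linarith [hη' ξ, mul_nonneg hc hpos]
    · obtain ⟨f, k, hfk, hg⟩ := hS.exists_resolvent hc g
      have hm := (hgen _).2 hfk
      rw [LinearPMap.mem_graph_iff] at hm
      obtain ⟨y, hy1, hy2⟩ := hm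
      refine ⟨y, ?_⟩
      rw [hy1, hy2]
      exact hg
  · intro f k
    exact hgen (f, k)
  · exact fun f hf s u => h.osc_limit_le_exp hT hf s u
  · intro f hf s
    refine ⟨h.tripleNorm_limit_lt_top hT hf s, ?_⟩
    refine (ENNReal.tsum_le_tsum (h.osc_limit_le_exp hT hf s)).trans ?_
    rw [ENNReal.tsum_mul_left]
    refine (mul_le_mul_right (tsum_expGamma_le h.rowSup_lt_top s (osc f)) _).trans (le_of_eq ?_)
    rw [← mul_assoc, ← ENNReal.ofReal_mul (Real.exp_pos _).le, ← Real.exp_add]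
    congr 3
    ring

end IsSpinSystem

end DPPDynamics

end

noncomputable section

namespace DPPDynamics

variable {E : Type*} [DecidableEq E]

/-! ### The intensities -/

section Hilbert

/-- The square root B replaces both completions by ℋ_0 itself: ℋ_- is isometric to the closure of
Ran B via f ↦ Bf, and ℋ_+ is Ran B with ‖Bk‖_+ = ‖k‖ when A is injective. -/
theorem exists_positive_sqrt {H : Type*} [NormedAddCommGroup H] [InnerProductSpace ℂ H]
    [CompleteSpace H] {A : H →L[ℂ] H} (hA : A.IsPositive) :
    ∃ B : H →L[ℂ] H, B.IsPositive ∧ ∀ f, B (B f) = A f := by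
  have h := (ContinuousLinearMap.nonneg_iff_isPositive A).2 hA
  refine ⟨CFC.sqrt A, (ContinuousLinearMap.nonneg_iff_isPositive _).1 (CFC.sqrt_nonneg A),
    fun f => ?_⟩
  exact congrArg (fun W : H →L[ℂ] H => W f) (CFC.sqrt_mul_sqrt_self A h)

theorem inner_basisVec_left (x : E) (f : H0 E) : inner ℂ (basisVec x) f = f x :=
  (lp.inner_single_left (𝕜 := ℂ) (G := fun _ : E => ℂ) x 1 f).trans (by simp)

theorem basisVec_apply (x y : E) : (basisVec x : H0 E) y = if y = x then 1 else 0 := by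
  rw [basisVec, lp.single_apply]
  by_cases h : y = x
  · subst h; simp
  · simp [h]

theorem norm_basisVec (x : E) : ‖(basisVec x : H0 E)‖ = 1 := by
  simp [basisVec, lp.norm_single]

theorem eq_sum_basisVec {f : H0 E} {F : Finset E} (hf : ∀ z, z ∉ F → f z = 0) :
    f = ∑ y ∈ F, f y • basisVec y := by
  ext z
  rw [lp.coeFn_sum, Finset.sum_apply]
  simp only [lp.coeFn_smul, Pi.smul_apply, basisVec_apply, smul_eq_mul, mul_ite, mul_one, mul_zero,
    Finset.sum_ite_eq]
  split_ifs with h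
  · rfl
  · exact hf z h

theorem locSpan_mono {S S' : Set E} (h : S ⊆ S') : locSpan S ≤ locSpan S' :=
  Submodule.span_mono (Set.image_mono h)

theorem apply_eq_zero_of_mem_locSpan {S : Set E} {f : H0 E} (hf : f ∈ locSpan S) {y : E}
    (hy : y ∉ S) : f y = 0 := by
  refine Submodule.span_induction (p := fun f _ => f y = 0) ?_ ?_ ?_ ?_ hf
  · rintro _ ⟨x, hx, rfl⟩
    rw [basisVec_apply, if_neg]
    rintro rfl
    exact hy hx
  · simp
  · intro f g _ _ h1 h2
    simp [h1, h2]
  · intro c f _ h1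
    simp [h1]

theorem exists_finset_mem_locSpan {S : Set E} {f : H0 E} (hf : f ∈ locSpan S) :
    ∃ Λ : Finset E, f ∈ locSpan {y | y ∈ Λ ∧ y ∈ S} := by
  refine Submodule.span_induction (p := fun f _ => ∃ Λ : Finset E, f ∈ locSpan {y | y ∈ Λ ∧ y ∈ S})
    ?_ ?_ ?_ ?_ hf
  · rintro _ ⟨x, hx, rfl⟩
    exact ⟨{x}, Submodule.subset_span ⟨x, ⟨by simp, hx⟩, rfl⟩⟩
  · exact ⟨∅, Submodule.zero_mem _⟩
  · rintro f g _ _ ⟨Λ, h1⟩ ⟨Λ', h2⟩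
    refine ⟨Λ ∪ Λ', Submodule.add_mem _ (locSpan_mono ?_ h1) (locSpan_mono ?_ h2)⟩
    · exact fun y hy => ⟨Finset.mem_union_left _ hy.1, hy.2⟩
    · exact fun y hy => ⟨Finset.mem_union_right _ hy.1, hy.2⟩
  · rintro c f _ ⟨Λ, h1⟩
    exact ⟨Λ, Submodule.smul_mem _ c h1⟩

variable {A : H0 E →L[ℂ] H0 E}

omit [DecidableEq E] in
theorem minusNormSq_nonneg (hpos : A.IsPositive) (f : H0 E) : 0 ≤ minusNormSq A f :=
  hpos.re_inner_nonneg_right f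

omit [DecidableEq E] in
theorem minusNormSq_eq {B : H0 E →L[ℂ] H0 E} (hB : B.IsPositive) (hBA : ∀ f, B (B f) = A f)
    (f : H0 E) : minusNormSq A f = ‖B f‖ ^ 2 := by
  rw [minusNormSq, ← hBA, ← hB.inner_left_eq_inner_right, inner_self_eq_norm_sq_to_K]
  norm_cast

theorem intensity_bddBelow (hpos : A.IsPositive) (x : E) (S : Set E) :
    BddBelow {r : ℝ | ∃ f ∈ locSpan S, r = minusNormSq A (basisVec x - f)} :=
  ⟨0, by rintro _ ⟨f, _, rfl⟩; exact minusNormSq_nonneg hpos _⟩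

theorem intensity_local_nonneg (hpos : A.IsPositive) (x : E) (S : Set E) :
    0 ≤ sInf {r : ℝ | ∃ f ∈ locSpan S, r = minusNormSq A (basisVec x - f)} :=
  Real.sInf_nonneg (by rintro _ ⟨f, _, rfl⟩; exact minusNormSq_nonneg hpos _)

theorem intensity_nonneg (hpos : A.IsPositive) (x : E) (ξ : Config E) : 0 ≤ intensity A x ξ :=
  Real.iInf_nonneg fun _ => intensity_local_nonneg hpos _ _

/-- A vector of the span uses finitely many sites, so the limit over Λ is the infimum over the span
of all occupied sites. -/
theorem intensity_le (hpos : A.IsPositive) (x : E) {ξ : Config E} {f : H0 E}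
    (hf : f ∈ locSpan {y | ξ y = true}) : intensity A x ξ ≤ minusNormSq A (basisVec x - f) := by
  obtain ⟨Λ, hΛ⟩ := exists_finset_mem_locSpan hf
  refine (ciInf_le ⟨0, ?_⟩ Λ).trans (csInf_le (intensity_bddBelow hpos _ _) ⟨f, hΛ, rfl⟩)
  rintro _ ⟨Λ, rfl⟩
  exact intensity_local_nonneg hpos _ _

theorem exists_minusNormSq_lt (A : H0 E →L[ℂ] H0 E) (x : E) (ξ : Config E) {δ : ℝ} (hδ : 0 < δ) :
    ∃ (Λ : Finset E) (f : H0 E), f ∈ locSpan {y | y ∈ Λ ∧ ξ y = true} ∧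
      minusNormSq A (basisVec x - f) < intensity A x ξ + δ := by
  obtain ⟨Λ, hΛ⟩ := exists_lt_of_ciInf_lt (lt_add_of_pos_right (intensity A x ξ) hδ)
  obtain ⟨_, ⟨f, hf, rfl⟩, hlt⟩ := exists_lt_of_csInf_lt
    (by exact ⟨_, 0, Submodule.zero_mem _, rfl⟩) hΛ
  exact ⟨Λ, f, hf, hlt⟩

theorem intensity_anti (hpos : A.IsPositive) (x : E) {ξ η : Config E}
    (h : ∀ y, ξ y = true → η y = true) : intensity A x η ≤ intensity A x ξ := by
  refine le_of_forall_pos_le_add fun δ hδ => ?_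
  obtain ⟨Λ, f, hf, hlt⟩ := exists_minusNormSq_lt A x ξ hδ
  exact (intensity_le hpos x (locSpan_mono (fun y hy => h y hy.2) hf)).trans hlt.le

theorem intensity_le_norm (hpos : A.IsPositive) (x : E) (ξ : Config E) :
    intensity A x ξ ≤ ‖A‖ := by
  refine (intensity_le hpos x (Submodule.zero_mem _)).trans ?_
  rw [sub_zero, minusNormSq]
  refine (Complex.re_le_norm _).trans ((norm_inner_le_norm _ _).trans ?_)
  rw [norm_basisVec, one_mul]
  simpa [norm_basisVec] using A.le_opNorm (basisVec x)

variable {B : H0 E →L[ℂ] H0 E}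

omit [DecidableEq E] in
theorem injective_sqrt (hker : ∀ f, A f = 0 → f = 0) (hBA : ∀ f, B (B f) = A f) {f : H0 E}
    (hf : B f = 0) : f = 0 := hker f (by rw [← hBA, hf, map_zero])

omit [DecidableEq E] in
theorem denseRange_sqrt (hker : ∀ f, A f = 0 → f = 0) (hB : B.IsPositive)
    (hBA : ∀ f, B (B f) = A f) : DenseRange B := by
  have h1 : (LinearMap.range (B : H0 E →ₗ[ℂ] H0 E)).topologicalClosure = ⊤ := by
    rw [Submodule.topologicalClosure_eq_top_iff, Submodule.eq_bot_iff]
    intro k hk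
    refine injective_sqrt hker hBA ?_
    rw [← inner_self_eq_zero (𝕜 := ℂ), hB.inner_left_eq_inner_right]
    exact Submodule.inner_left_of_mem_orthogonal (LinearMap.mem_range_self _ _) hk
  have h2 := Submodule.dense_iff_topologicalClosure_eq_top.2 h1
  exact h2

omit [DecidableEq E] in
-- A sequence v is Cauchy for ‖·‖_- exactly when Bv converges, and its limit k satisfies Bk = lim
-- Av. Conversely every k is such a limit, since the range of the injective self-adjoint B is dense.
theorem hasPlusNorm_iff (hker : ∀ f, A f = 0 → f = 0) (hB : B.IsPositive)
    (hBA : ∀ f, B (B f) = A f) {h : H0 E} {r : ℝ} :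
    HasPlusNorm A h r ↔ ∃ k, B k = h ∧ ‖k‖ = r := by
  constructor
  · rintro ⟨hr, v, hv, hlim, hnorm⟩
    have hc : CauchySeq fun n => B (v n) := by
      rw [Metric.cauchySeq_iff]
      intro δ hδ
      obtain ⟨N, hN⟩ := hv (δ ^ 2) (by positivity)
      refine ⟨N, fun m hm n hn => ?_⟩
      have := hN m hm n hn
      rw [minusNormSq_eq hB hBA, map_sub] at this
      rw [dist_eq_norm]
      exact lt_of_pow_lt_pow_left₀ 2 hδ.le this
    obtain ⟨k, hk⟩ := cauchySeq_tendsto_of_complete hc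
    refine ⟨k, ?_, ?_⟩
    · have h1 := (B.continuous.tendsto k).comp hk
      refine tendsto_nhds_unique h1 (hlim.congr fun n => ?_)
      simp [hBA]
    · have h1 := hk.norm.pow 2
      simp only [minusNormSq_eq hB hBA] at hnorm
      have h2 := tendsto_nhds_unique h1 hnorm
      exact (pow_left_inj₀ (norm_nonneg _) hr two_ne_zero).1 h2
  · rintro ⟨k, rfl, rfl⟩
    obtain ⟨u, hu, hlim⟩ := mem_closure_iff_seq_limit.1 ((denseRange_sqrt hker hB hBA) k)
    choose v hv using hu
    obtain rfl : (fun n => B (v n)) = u := funext hv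
    refine ⟨norm_nonneg _, v, ?_, ?_, ?_⟩
    · intro δ hδ
      obtain ⟨N, hN⟩ := Metric.cauchySeq_iff.1 hlim.cauchySeq (Real.sqrt δ) (Real.sqrt_pos.2 hδ)
      refine ⟨N, fun m hm n hn => ?_⟩
      have := hN m hm n hn
      rw [dist_eq_norm, ← map_sub] at this
      rw [minusNormSq_eq hB hBA, ← Real.lt_sqrt (norm_nonneg _)]
      exact this
    · refine ((B.continuous.tendsto k).comp hlim).congr fun n => ?_
      simp [hBA]
    · simp only [minusNormSq_eq hB hBA]
      exact hlim.norm.pow 2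

omit [DecidableEq E] in
/-- The evaluation at a site is bounded with respect to `‖·‖_-`. -/
theorem exists_evaluation_bound (hB : B.IsPositive)
    (hBA : ∀ f, B (B f) = A f) (hH : HypothesisH A) (x : E) :
    ∃ C : ℝ, ∀ v : H0 E, ‖v x‖ ≤ C * ‖B v‖ := by
  by_contra! hcon
  -- The square leaves room for rescaling: the vectors w have modulus n + 1 at x while ‖B w‖ ≤ 1/(n
  -- + 1). They are Cauchy for ‖·‖_- but diverge at x, against (H).
  choose v hv using fun n : ℕ => hcon (((n : ℝ) + 1) ^ 2)
  have hv0 : ∀ n, 0 < ‖v n x‖ := fun n => lt_of_le_of_lt (by positivity) (hv n)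
  set w : ℕ → H0 E := fun n => (((n : ℝ) + 1) / ‖v n x‖ : ℂ) • v n with hw
  have hwB : ∀ n, ‖B (w n)‖ ≤ 1 / ((n : ℝ) + 1) := by
    intro n
    have h1 : ‖(((n : ℝ) + 1) / ‖v n x‖ : ℂ)‖ = ((n : ℝ) + 1) / ‖v n x‖ := by
      rw [norm_div, Complex.norm_real, norm_norm]
      congr 1
      have : (((n : ℝ) : ℂ) + 1) = (((n : ℝ) + 1 : ℝ) : ℂ) := by push_cast; rfl
      rw [this, Complex.norm_real, Real.norm_of_nonneg (by positivity)]
    rw [hw, map_smul, norm_smul, h1, div_mul_eq_mul_div, div_le_div_iff₀ (hv0 n) (by positivity)]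
    have := hv n
    nlinarith
  have hwx : ∀ n, ‖w n x‖ = (n : ℝ) + 1 := by
    intro n
    have : (((n : ℝ) : ℂ) + 1) = (((n : ℝ) + 1 : ℝ) : ℂ) := by push_cast; rfl
    rw [hw]
    simp only [lp.coeFn_smul, Pi.smul_apply, norm_smul, norm_div, Complex.norm_real, norm_norm, this]
    rw [Real.norm_of_nonneg (by positivity), div_mul_cancel₀ _ (hv0 n).ne']
  have hlim : Tendsto (fun n => B (w n)) atTop (𝓝 0) :=
    squeeze_zero_norm hwB tendsto_one_div_add_atTop_nhds_zero_nat
  have hc : MinusCauchy A w := by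
    intro δ hδ
    obtain ⟨N, hN⟩ := Metric.cauchySeq_iff.1 hlim.cauchySeq (Real.sqrt δ) (Real.sqrt_pos.2 hδ)
    refine ⟨N, fun m hm n hn => ?_⟩
    have := hN m hm n hn
    rw [dist_eq_norm, ← map_sub] at this
    rw [minusNormSq_eq hB hBA, ← Real.lt_sqrt (norm_nonneg _)]
    exact this
  obtain ⟨z, hz⟩ := (hH w hc).1 x
  have h1 := hz.norm
  simp only [hwx] at h1
  exact not_tendsto_nhds_of_tendsto_atTop
    (tendsto_atTop_add_const_right _ _ tendsto_natCast_atTop_atTop) _ h1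

/-- The functional Bv ↦ v(x) is bounded on Ran B. Extending it by Hahn–Banach and representing it by
a vector ψ gives (ψ, Bv) = (e_x, v), that is, Bψ = e_x. So e_x belongs to ℋ_+. -/
theorem exists_sqrt_eq_basisVec (hker : ∀ f, A f = 0 → f = 0) (hB : B.IsPositive)
    (hBA : ∀ f, B (B f) = A f) (hH : HypothesisH A) (x : E) : ∃ ψ, B ψ = basisVec x := by
  obtain ⟨C, hC⟩ := exists_evaluation_bound hB hBA hH x
  have hinj : Function.Injective (B : H0 E →ₗ[ℂ] H0 E) :=
    (injective_iff_map_eq_zero _).2 fun f hf => injective_sqrt hker hBA hf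
  let e := LinearEquiv.ofInjective (B : H0 E →ₗ[ℂ] H0 E) hinj
  let φ : LinearMap.range (B : H0 E →ₗ[ℂ] H0 E) →L[ℂ] ℂ :=
    LinearMap.mkContinuous
      ((innerSL ℂ (basisVec x : H0 E)).toLinearMap ∘ₗ e.symm.toLinearMap) C (fun y => by
        obtain ⟨v, rfl⟩ := e.surjective y
        have h1 := hC v
        simpa [e, inner_basisVec_left] using h1)
  obtain ⟨g, hg, -⟩ := exists_extension_norm_eq _ φ
  refine ⟨(InnerProductSpace.toDual ℂ (H0 E)).symm g, ?_⟩
  refine ext_inner_right ℂ fun v => ?_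
  rw [hB.inner_left_eq_inner_right, InnerProductSpace.toDual_symm_apply]
  have h2 := hg (e v)
  have h3 : ((e v : LinearMap.range (B : H0 E →ₗ[ℂ] H0 E)) : H0 E) = B v := rfl
  rw [h3] at h2
  rw [h2]
  simp [φ]

end Hilbert

end DPPDynamics

end

/-! ### Duality of α and β -/

noncomputable section

namespace DPPDynamics

variable {E : Type*} [DecidableEq E]

section Duality

variable {A B : H0 E →L[ℂ] H0 E}

theorem dualIntensity_local_nonneg (A : H0 E →L[ℂ] H0 E) (x : E) (S : Set E) :
    0 ≤ sInf {s : ℝ | ∃ g ∈ locSpan S, ∃ r : ℝ, HasPlusNorm A (basisVec x - g) r ∧ s = r ^ 2} :=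
  Real.sInf_nonneg (by rintro _ ⟨g, _, r, _, rfl⟩; positivity)

theorem dualIntensity_nonneg (A : H0 E →L[ℂ] H0 E) (x : E) (ξ : Config E) :
    0 ≤ dualIntensity A x ξ :=
  Real.iInf_nonneg fun _ => dualIntensity_local_nonneg _ _ _

theorem dualIntensity_le (x : E) {ξ : Config E} {g : H0 E}
    (hg : g ∈ locSpan {y | ξ y = false ∧ y ≠ x}) {r : ℝ} (hr : HasPlusNorm A (basisVec x - g) r) :
    dualIntensity A x ξ ≤ r ^ 2 := by
  obtain ⟨Λ, hΛ⟩ := exists_finset_mem_locSpan hg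
  refine (ciInf_le ⟨0, ?_⟩ Λ).trans (csInf_le ⟨0, ?_⟩ ⟨g, hΛ, r, hr, rfl⟩)
  · rintro _ ⟨Λ, rfl⟩
    exact dualIntensity_local_nonneg _ _ _
  · rintro _ ⟨g, _, r, _, rfl⟩
    positivity

theorem exists_plusNorm_lt (hpos : A.IsPositive) (hker : ∀ f, A f = 0 → f = 0)
    (hH : HypothesisH A) (x : E) (ξ : Config E) {δ : ℝ} (hδ : 0 < δ) :
    ∃ (Λ : Finset E) (g : H0 E) (r : ℝ), g ∈ locSpan {y | y ∈ Λ ∧ ξ y = false ∧ y ≠ x} ∧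
      HasPlusNorm A (basisVec x - g) r ∧ r ^ 2 < dualIntensity A x ξ + δ := by
  obtain ⟨B, hB, hBA⟩ := exists_positive_sqrt hpos
  obtain ⟨ψ, hψ⟩ := exists_sqrt_eq_basisVec hker hB hBA hH x
  obtain ⟨Λ, hΛ⟩ := exists_lt_of_ciInf_lt (lt_add_of_pos_right (dualIntensity A x ξ) hδ)
  -- The choice g = 0 is admissible because e_x lies in ℋ_+. Otherwise the set could be empty and
  -- its infimum the default value 0.
  obtain ⟨_, ⟨g, hg, r, hr, rfl⟩, hlt⟩ := exists_lt_of_csInf_lt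
    (by exact ⟨_, 0, Submodule.zero_mem _, _,
      (hasPlusNorm_iff hker hB hBA).2 ⟨ψ, by simpa using hψ, rfl⟩, rfl⟩) hΛ
  exact ⟨Λ, g, r, hg, hr, hlt⟩

/-- The supports of e_x - f and e_x - g meet only at x, so their inner product in ℋ_0 is 1. Writing
e_x - g = Bk and moving B to the other side, Cauchy–Schwarz gives the bound. -/
theorem one_le_minusNormSq_mul (hpos : A.IsPositive) (hker : ∀ f, A f = 0 → f = 0) {x : E}
    {ξ : Config E} (hx : ξ x = false) {f g : H0 E} (hf : f ∈ locSpan {y | ξ y = true})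
    (hg : g ∈ locSpan {y | ξ y = false ∧ y ≠ x}) {r : ℝ} (hr : HasPlusNorm A (basisVec x - g) r) :
    1 ≤ minusNormSq A (basisVec x - f) * r ^ 2 := by
  obtain ⟨B, hB, hBA⟩ := exists_positive_sqrt hpos
  obtain ⟨k, hk, rfl⟩ := (hasPlusNorm_iff hker hB hBA).1 hr
  rw [minusNormSq_eq hB hBA, ← mul_pow]
  have horth : ∀ g', g' ∈ locSpan {y | ξ y = false ∧ y ≠ x} → inner ℂ f g' = 0 := by
    intro g' hg'
    refine Submodule.span_induction (p := fun f _ => inner ℂ f g' = 0) ?_ ?_ ?_ ?_ hf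
    · rintro _ ⟨y, hy, rfl⟩
      rw [inner_basisVec_left]
      refine apply_eq_zero_of_mem_locSpan hg' fun hy' => ?_
      have := hy'.1
      rw [show ξ y = true from hy] at this
      cases this
    · simp
    · intro f₁ f₂ _ _ h1 h2
      rw [inner_add_left, h1, h2, add_zero]
    · intro c f₁ _ h1
      rw [inner_smul_left, h1, mul_zero]
  have h1 : inner ℂ (basisVec x - f) (basisVec x - g) = 1 := by
    have e1 : inner ℂ (basisVec x : H0 E) (basisVec x) = 1 := by
      rw [inner_basisVec_left, basisVec_apply, if_pos rfl]
    have e2 : inner ℂ (basisVec x : H0 E) g = 0 := by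
      rw [inner_basisVec_left]
      exact apply_eq_zero_of_mem_locSpan hg fun h => h.2 rfl
    have e3 : inner ℂ f (basisVec x : H0 E) = 0 := by
      rw [← inner_conj_symm, inner_basisVec_left, apply_eq_zero_of_mem_locSpan hf (y := x), map_zero]
      simp [hx]
    rw [inner_sub_left, inner_sub_right, inner_sub_right, e1, e2, e3, horth g hg]
    simp
  rw [← hk, ← hB.inner_left_eq_inner_right] at h1
  have h2 := norm_inner_le_norm (𝕜 := ℂ) (B (basisVec x - f)) k
  rw [h1, norm_one] at h2
  exact one_le_pow₀ h2

theorem one_le_intensity_mul_dualIntensity (hpos : A.IsPositive) (hker : ∀ f, A f = 0 → f = 0)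
    (hH : HypothesisH A) {x : E} {ξ : Config E} (hx : ξ x = false) :
    1 ≤ intensity A x ξ * dualIntensity A x ξ := by
  have key : ∀ δ : ℝ, 0 < δ → 1 ≤ (intensity A x ξ + δ) * (dualIntensity A x ξ + δ) := by
    intro δ hδ
    obtain ⟨Λ, f, hf, hf'⟩ := exists_minusNormSq_lt A x ξ hδ
    obtain ⟨Λ', g, r, hg, hr, hg'⟩ := exists_plusNorm_lt hpos hker hH x ξ hδ
    refine (one_le_minusNormSq_mul hpos hker hx (locSpan_mono (fun y hy => hy.2) hf)
      (locSpan_mono (fun y hy => hy.2) hg) hr).trans ?_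
    have := intensity_nonneg hpos x ξ
    gcongr
  have hlim : Tendsto (fun δ : ℝ => (intensity A x ξ + δ) * (dualIntensity A x ξ + δ)) (𝓝[>] 0)
      (𝓝 ((intensity A x ξ + 0) * (dualIntensity A x ξ + 0))) := by
    have : Continuous fun δ : ℝ => (intensity A x ξ + δ) * (dualIntensity A x ξ + δ) := by fun_prop
    exact (this.tendsto 0).mono_left nhdsWithin_le_nhds
  rw [add_zero, add_zero] at hlim
  exact ge_of_tendsto hlim (by filter_upwards [self_mem_nhdsWithin] with δ hδ using key δ hδ)

theorem intensity_pos (hpos : A.IsPositive) (hker : ∀ f, A f = 0 → f = 0)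
    (hH : HypothesisH A) {x : E} {ξ : Config E} (hx : ξ x = false) : 0 < intensity A x ξ := by
  have h1 := one_le_intensity_mul_dualIntensity hpos hker hH hx
  refine (intensity_nonneg hpos x ξ).lt_of_ne fun h => ?_
  rw [← h, zero_mul] at h1
  linarith

/-- The configuration that agrees with `ξ` on `Λ` and is full outside. -/
def fillOff (Λ : Finset E) (ξ : Config E) : Config E := fun y => if y ∈ Λ then ξ y else true

/-- Let p be the part of B e_x orthogonal to the B-images of the occupied sites of the filled
configuration. Then Bp vanishes at these sites, so it lives on the finitely many empty ones, with
value ‖p‖² at x. Hence p/‖p‖² is mapped by B to some e_x - g with g admissible for β(x;ξ), and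
β(x;ξ) ≤ 1/‖p‖². Filling outside Λ is what makes the support finite. -/
theorem dualIntensity_mul_fillOff_le (hpos : A.IsPositive) (hker : ∀ f, A f = 0 → f = 0)
    (hH : HypothesisH A) {x : E} {ξ : Config E} (hx : ξ x = false) {Λ : Finset E} (hxΛ : x ∈ Λ) :
    dualIntensity A x ξ * intensity A x (fillOff Λ ξ) ≤ 1 := by
  obtain ⟨B, hB, hBA⟩ := exists_positive_sqrt hpos
  have hfx : fillOff Λ ξ x = false := by simp [fillOff, hxΛ, hx]
  have hαpos := intensity_pos hpos hker hH hfx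
  set V : Submodule ℂ (H0 E) :=
    ((locSpan {y | fillOff Λ ξ y = true}).map (B : H0 E →ₗ[ℂ] H0 E)).topologicalClosure with hV
  have hVc : CompleteSpace V := (Submodule.isClosed_topologicalClosure _).completeSpace_coe
  set φ : H0 E := B (basisVec x) with hφ
  set p : H0 E := φ - V.starProjection φ with hp
  have hpV : ∀ v ∈ V, inner ℂ v p = 0 := fun v hv =>
    Submodule.inner_right_of_mem_orthogonal hv (V.sub_starProjection_mem_orthogonal φ)
  -- The projection is only a limit of images of admissible vectors, so the bound by α is carried
  -- over to the closure.
  have hαp : intensity A x (fillOff Λ ξ) ≤ ‖p‖ ^ 2 := by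
    have hcl : V.starProjection φ ∈ closure
        (((locSpan {y | fillOff Λ ξ y = true}).map (B : H0 E →ₗ[ℂ] H0 E)) : Set (H0 E)) := by
      rw [← Submodule.topologicalClosure_coe]
      exact V.starProjection_apply_mem φ
    have hclosed : IsClosed {v : H0 E | intensity A x (fillOff Λ ξ) ≤ ‖φ - v‖ ^ 2} :=
      isClosed_le continuous_const (by fun_prop)
    refine hclosed.closure_subset_iff.2 ?_ hcl
    rintro _ ⟨f, hf, rfl⟩
    have := intensity_le hpos x hf
    rwa [minusNormSq_eq hB hBA, map_sub] at this
  have hp0 : 0 < ‖p‖ ^ 2 := hαpos.trans_le hαp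
  have hφp : inner ℂ φ p = ((‖p‖ ^ 2 : ℝ) : ℂ) := by
    have h1 : φ = p + V.starProjection φ := by rw [hp]; abel
    conv_lhs => rw [h1]
    rw [inner_add_left, hpV _ (V.starProjection_apply_mem φ), add_zero, inner_self_eq_norm_sq_to_K]
    norm_cast
  have hcoord : ∀ z, (B p) z = inner ℂ (B (basisVec z)) p := by
    intro z
    rw [hB.inner_left_eq_inner_right, inner_basisVec_left]
  set F : Finset E := Λ.filter fun y => ξ y = false with hF
  have hoff : ∀ z, z ∉ F → (B p) z = 0 := by
    intro z hz
    rw [hcoord]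
    refine hpV _ (Submodule.le_topologicalClosure _ ⟨basisVec z, ?_, rfl⟩)
    refine Submodule.subset_span ⟨z, ?_, rfl⟩
    change fillOff Λ ξ z = true
    simp only [hF, Finset.mem_filter, not_and, Bool.not_eq_false] at hz
    simp only [fillOff]
    split_ifs with h
    · exact hz h
    · rfl
  have hxF : x ∈ F := by simp [hF, hxΛ, hx]
  have hBp := eq_sum_basisVec hoff
  rw [← Finset.add_sum_erase F _ hxF, hcoord x, hφp] at hBp
  set c : ℂ := ((‖p‖ ^ 2 : ℝ) : ℂ) with hc
  have hc0 : c ≠ 0 := by rw [hc]; exact_mod_cast hp0.ne'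
  set g : H0 E := -(c⁻¹ • ∑ y ∈ F.erase x, (B p) y • basisVec y) with hg
  have hgmem : g ∈ locSpan {y | ξ y = false ∧ y ≠ x} := by
    refine Submodule.neg_mem _ (Submodule.smul_mem _ _ (Submodule.sum_mem _ fun y hy => ?_))
    refine Submodule.smul_mem _ _ (Submodule.subset_span ⟨y, ?_, rfl⟩)
    rw [Finset.mem_erase, hF, Finset.mem_filter] at hy
    exact ⟨hy.2.2, hy.1⟩
  have hk : HasPlusNorm A (basisVec x - g) ‖c⁻¹ • p‖ := by
    refine (hasPlusNorm_iff hker hB hBA).2 ⟨c⁻¹ • p, ?_, rfl⟩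
    rw [map_smul, hBp, smul_add, smul_smul, inv_mul_cancel₀ hc0, one_smul, hg, sub_neg_eq_add]
  have h1 := dualIntensity_le x hgmem hk
  have h2 : ‖c⁻¹ • p‖ ^ 2 = (‖p‖ ^ 2)⁻¹ := by
    rw [norm_smul, norm_inv, hc, Complex.norm_real, Real.norm_of_nonneg hp0.le, mul_pow]
    field_simp
  rw [h2] at h1
  calc dualIntensity A x ξ * intensity A x (fillOff Λ ξ) ≤ (‖p‖ ^ 2)⁻¹ * ‖p‖ ^ 2 :=
        mul_le_mul h1 hαp hαpos.le (inv_nonneg.2 hp0.le)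
    _ = 1 := inv_mul_cancel₀ (ne_of_gt hp0)

/-! ### Summable variations -/

/-- `α(x;ξ)`, `ξ` disjoint from `Z`, varies by at most `δ u` when the site `u` is occupied. -/
def HasVariation (A : H0 E →L[ℂ] H0 E) (x : E) (Z : Finset E) (δ : E → ℝ≥0∞) : Prop :=
  ∀ u, u ∉ Z → ∀ ξ : Config E, (∀ z ∈ Z, ξ z = false) → ξ u = false →
    ENNReal.ofReal (intensity A x ξ - intensity A x (ins u ξ)) ≤ δ u

/-- The configuration `ξ ∩ Λ`. -/
def keepOn (Λ : Finset E) (ξ : Config E) : Config E := fun y => if y ∈ Λ then ξ y else false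

theorem keepOn_insert (Λ : Finset E) (u : E) (ξ : Config E) (hu : ξ u = true) :
    keepOn (insert u Λ) ξ = ins u (keepOn Λ ξ) := by
  ext1 y
  by_cases h : y = u
  · subst h; simp [keepOn, hu]
  · rw [ins_of_ne h]; simp [keepOn, h]

theorem keepOn_insert_of_false (Λ : Finset E) (u : E) (ξ : Config E) (hu : ξ u = false) :
    keepOn (insert u Λ) ξ = keepOn Λ ξ := by
  ext1 y
  by_cases h : y = u
  · subst h; simp [keepOn, hu]
  · simp [keepOn, h]

/-- The part of the sum of `δ` outside `Λ`. -/
def tailSum (δ : E → ℝ≥0∞) (Λ : Finset E) : ℝ≥0∞ := ∑' u, if u ∈ Λ then 0 else δ u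

theorem tendsto_tailSum {δ : E → ℝ≥0∞} (hδ : ∑' u, δ u < ⊤) :
    Tendsto (tailSum δ) atTop (𝓝 0) := by
  refine (ENNReal.tendsto_tsum_compl_atTop_zero hδ.ne).congr fun Λ => ?_
  refine (tsum_subtype {x : E | x ∉ Λ} δ).trans (tsum_congr fun u => ?_)
  by_cases h : u ∈ Λ <;> simp [h]

variable {x : E} {Z : Finset E} {δ : E → ℝ≥0∞}

/-- Telescoping: the sites of Λ' are added one at a time, and only occupied sites outside Λ cost
anything. These avoid Z because η does. -/
theorem HasVariation.keepOn_sub_le (hv : HasVariation A x Z δ) {η : Config E}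
    (hη : ∀ z ∈ Z, η z = false) (Λ Λ' : Finset E) :
    ENNReal.ofReal (intensity A x (keepOn Λ η) - intensity A x (keepOn (Λ' ∪ Λ) η)) ≤
      tailSum δ Λ := by
  have h1 : ENNReal.ofReal (intensity A x (keepOn Λ η) - intensity A x (keepOn (Λ' ∪ Λ) η)) ≤
      ∑ u ∈ Λ', if u ∈ Λ then 0 else δ u := by
    induction Λ' using Finset.induction_on with
    | empty => simp
    | insert u Λ' hu ih =>
      rw [Finset.sum_insert hu, Finset.insert_union]
      by_cases hmem : u ∈ Λ' ∪ Λ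
      · rw [Finset.insert_eq_of_mem hmem]
        exact ih.trans (le_add_of_nonneg_left zero_le)
      · have hΛ : u ∉ Λ := fun h => hmem (Finset.mem_union_right _ h)
        rw [if_neg hΛ]
        cases hηu : η u
        · rw [keepOn_insert_of_false _ _ _ hηu]
          exact ih.trans (le_add_of_nonneg_left zero_le)
        · rw [keepOn_insert _ _ _ hηu]
          have h2 := hv u (fun hz => by simp [hη u hz] at hηu) (keepOn (Λ' ∪ Λ) η)
            (fun z hz => by simp [keepOn, hη z hz]) (by simp only [keepOn]; rw [if_neg hmem])
          calc _ = ENNReal.ofReal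
                ((intensity A x (keepOn (Λ' ∪ Λ) η) - intensity A x (ins u (keepOn (Λ' ∪ Λ) η))) +
                (intensity A x (keepOn Λ η) - intensity A x (keepOn (Λ' ∪ Λ) η))) := by
                congr 1; ring
            _ ≤ _ := ENNReal.ofReal_add_le
            _ ≤ _ := add_le_add h2 ih
  exact h1.trans (ENNReal.sum_le_tsum _)

/-- By monotonicity α(x;ξ) ≤ α(x;ξ ∩ Λ) = α(x;η ∩ Λ). A finite part of η almost attains α(x;η), so
finitely many telescoping steps suffice. -/
theorem HasVariation.sub_le (hpos : A.IsPositive) (hv : HasVariation A x Z δ) {ξ η : Config E}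
    (hη : ∀ z ∈ Z, η z = false) {Λ : Finset E}
    (hΛ : ∀ y ∈ Λ, ξ y = η y) :
    ENNReal.ofReal (intensity A x ξ - intensity A x η) ≤ tailSum δ Λ := by
  refine ENNReal.le_of_forall_pos_le_add fun c hc _ => ?_
  obtain ⟨Λ', f, hf, hlt⟩ := exists_minusNormSq_lt A x η (NNReal.coe_pos.2 hc)
  have h1 : intensity A x (keepOn (Λ' ∪ Λ) η) ≤ intensity A x η + c := by
    refine (intensity_le hpos x (locSpan_mono ?_ hf)).trans hlt.le
    intro y hy
    simp [keepOn, hy.1, hy.2]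
  have h2 : intensity A x ξ ≤ intensity A x (keepOn Λ η) := by
    refine intensity_anti hpos x fun y hy => ?_
    simp only [keepOn] at hy
    split_ifs at hy with h
    rw [hΛ y h, hy]
  calc ENNReal.ofReal (intensity A x ξ - intensity A x η)
      ≤ ENNReal.ofReal ((intensity A x (keepOn Λ η) - intensity A x (keepOn (Λ' ∪ Λ) η)) + c) :=
        ENNReal.ofReal_le_ofReal (by linarith)
    _ ≤ _ := ENNReal.ofReal_add_le
    _ ≤ tailSum δ Λ + c := by
        refine add_le_add (hv.keepOn_sub_le hη Λ Λ') ?_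
        rw [ENNReal.ofReal_coe_nnreal]

/-- The configuration `ξ \ Z`. -/
def clearOn (Z : Finset E) (ξ : Config E) : Config E := fun y => if y ∈ Z then false else ξ y

theorem clearOn_of_mem {z : E} (hz : z ∈ Z) (ξ : Config E) : clearOn Z ξ z = false := by
  simp [clearOn, hz]

theorem HasVariation.continuous (hpos : A.IsPositive) (hv : HasVariation A x Z δ)
    (hδ : ∑' u, δ u < ⊤) : Continuous fun ξ => intensity A x (clearOn Z ξ) := by
  rw [continuous_iff_continuousAt]
  intro ξ
  rw [ContinuousAt, Metric.tendsto_nhds]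
  intro c hc
  obtain ⟨Λ, hΛ⟩ := ((tendsto_tailSum hδ).eventually_lt_const
    (ENNReal.ofReal_pos.2 hc)).exists
  have hev : ∀ᶠ η : Config E in 𝓝 ξ, ∀ y ∈ Λ, η y = ξ y := by
    rw [Filter.eventually_all_finset]
    intro y _
    have := (continuous_apply y).tendsto ξ (isOpen_discrete {ξ y} |>.mem_nhds rfl)
    exact this
  filter_upwards [hev] with η hη
  have hag : ∀ y ∈ Λ, clearOn Z η y = clearOn Z ξ y := fun y hy => by
    simp [clearOn, hη y hy]
  have h1 := (hv.sub_le hpos (fun z hz => clearOn_of_mem hz ξ) hag).trans_lt hΛ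
  have h2 := (hv.sub_le hpos (fun z hz => clearOn_of_mem hz η)
    (fun y hy => (hag y hy).symm)).trans_lt hΛ
  rw [ENNReal.ofReal_lt_ofReal_iff hc] at h1 h2
  rw [Real.dist_eq, abs_lt]
  constructor <;> linarith

/-- Filling ξ outside a large Λ lowers α by at most the tail of δ, and β(x;ξ) times the lowered α is
at most 1. So αβ ≤ 1 + β · tail, and the tail tends to 0. -/
theorem HasVariation.intensity_mul_dualIntensity (hpos : A.IsPositive)
    (hker : ∀ f, A f = 0 → f = 0) (hH : HypothesisH A) (hv : HasVariation A x Z δ)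
    (hδ : ∑' u, δ u < ⊤) (hxZ : x ∈ Z) {ξ : Config E} (hξ : ∀ z ∈ Z, ξ z = false) :
    intensity A x ξ * dualIntensity A x ξ = 1 := by
  have hx : ξ x = false := hξ x hxZ
  refine le_antisymm ?_ (one_le_intensity_mul_dualIntensity hpos hker hH hx)
  have hβ := dualIntensity_nonneg A x ξ
  have hlim : Tendsto (fun Λ => 1 + dualIntensity A x ξ * (tailSum δ Λ).toReal) atTop
      (𝓝 (1 + dualIntensity A x ξ * 0)) := by
    refine (Tendsto.const_mul _ ?_).const_add 1
    exact (ENNReal.tendsto_toReal ENNReal.zero_ne_top).comp (tendsto_tailSum hδ)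
  rw [mul_zero, add_zero] at hlim
  refine ge_of_tendsto hlim ?_
  filter_upwards [eventually_ge_atTop Z] with Λ hΛ
  have h1 := dualIntensity_mul_fillOff_le hpos hker hH hx (hΛ hxZ)
  have h2 := hv.sub_le hpos (ξ := ξ) (η := fillOff Λ ξ) (Λ := Λ)
    (fun z hz => by simp [fillOff, hΛ hz, hξ z hz]) (fun y hy => by simp [fillOff, hy])
  have htop : tailSum δ Λ ≠ ⊤ := by
    refine (lt_of_le_of_lt (ENNReal.tsum_le_tsum fun u => ?_) hδ).ne
    split_ifs
    · exact zero_le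
    · exact le_rfl
  rw [ENNReal.ofReal_le_iff_le_toReal htop] at h2
  nlinarith

end Duality

end DPPDynamics

end

noncomputable section

namespace DPPDynamics

/-! ### Determinants with rows of `1 - C` and `C` -/

section MixedRows

open Matrix
open scoped ComplexOrder

variable {n : Type*} [Fintype n] [DecidableEq n]

/-- The matrix with the rows `i` of `1 - C` if `p i` and of `C` otherwise. -/
def mixedRows (C : Matrix n n ℂ) (p : n → Prop) [DecidablePred p] : Matrix n n ℂ :=
  Matrix.of fun i j => if p i then (1 - C) i j else C i j

/-- The matrix with the rows `i` of `W` if `p i` and of the identity otherwise. -/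
def rowsOrOne (W : Matrix n n ℂ) (p : n → Prop) [DecidablePred p] : Matrix n n ℂ :=
  Matrix.of fun i j => if p i then W i j else (1 : Matrix n n ℂ) i j

/-- Since (C⁻¹ - 1)C = 1 - C, the common factor det C splits off, leaving the principal minor of C⁻¹
- 1 on p. This L-ensemble form is the one whose ratios are variational. -/
theorem mixedRows_eq_mul {C : Matrix n n ℂ} (hC : IsUnit C.det) (p : n → Prop) [DecidablePred p] :
    mixedRows C p = rowsOrOne (C⁻¹ - 1) p * C := by
  ext i j
  simp only [mixedRows, rowsOrOne, Matrix.mul_apply, Matrix.of_apply]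
  by_cases h : p i
  · simp only [if_pos h]
    rw [← Matrix.mul_apply, sub_mul, Matrix.nonsing_inv_mul _ hC, one_mul]
  · simp only [if_neg h]
    rw [← Matrix.mul_apply, one_mul]

theorem posDef_inv_sub_one {C : Matrix n n ℂ} (h1 : C.PosDef) (h2 : (1 - C).PosDef) :
    (C⁻¹ - 1).PosDef := by
  have hC : IsUnit C.det := (Matrix.isUnit_iff_isUnit_det _).1 h1.isUnit
  have hH : (C⁻¹ - 1)ᴴ = C⁻¹ - 1 := by
    rw [conjTranspose_sub, conjTranspose_one, conjTranspose_nonsing_inv, h1.isHermitian.eq]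
  have h3 := h2.add_posSemidef (h1.posSemidef.conjTranspose_mul_mul_same (C⁻¹ - 1))
  -- This identity displays C⁻¹ - 1 as a positive definite matrix plus a positive semidefinite one.
  have h4 : 1 - C + (C⁻¹ - 1)ᴴ * C * (C⁻¹ - 1) = C⁻¹ - 1 := by
    rw [hH, sub_mul, Matrix.nonsing_inv_mul _ hC, mul_sub, sub_mul, sub_mul, one_mul, one_mul,
      one_mul, Matrix.mul_nonsing_inv _ hC, mul_one]
    abel
  rwa [h4] at h3

theorem vecMul_rowsOrOne (W : Matrix n n ℂ) (p : n → Prop) [DecidablePred p] (z : n → ℂ) (j : n) :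
    (z ᵥ* rowsOrOne W p) j = ((fun i => if p i then z i else 0) ᵥ* W) j +
      if p j then 0 else z j := by
  simp only [Matrix.vecMul, dotProduct, rowsOrOne, Matrix.of_apply, Matrix.one_apply]
  have h1 : ∀ i, z i * (if p i then W i j else if i = j then 1 else 0) =
      (if p i then z i else 0) * W i j + if i = j then (if p j then 0 else z j) else 0 := by
    intro i
    by_cases hij : i = j
    · subst hij
      by_cases h : p i <;> simp [h]
    · by_cases h : p i <;> simp [h, hij]
  simp only [h1, Finset.sum_add_distrib, Finset.sum_ite_eq', Finset.mem_univ, if_true]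

/-- The part on p of a left null vector has zero energy for W, so it vanishes, and then the identity
rows kill the rest. -/
theorem det_rowsOrOne_ne_zero {W : Matrix n n ℂ} (hW : W.PosDef) (p : n → Prop) [DecidablePred p] :
    (rowsOrOne W p).det ≠ 0 := by
  intro h0
  obtain ⟨z, hz, hz0⟩ := Matrix.exists_vecMul_eq_zero_iff.2 h0
  set a : n → ℂ := fun i => if p i then z i else 0 with ha
  have hz' : ∀ j, (a ᵥ* W) j + (if p j then 0 else z j) = 0 := fun j => by
    rw [ha, ← vecMul_rowsOrOne, hz0]; rfl
  have hq : a ⬝ᵥ W *ᵥ star a = 0 := by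
    rw [dotProduct_mulVec, dotProduct]
    refine Finset.sum_eq_zero fun j _ => ?_
    by_cases h : p j
    · have := hz' j
      rw [if_pos h, add_zero] at this
      rw [this, zero_mul]
    · simp [ha, h]
  have ha0 : a = 0 := by
    by_contra hne
    have h1 := hW.dotProduct_mulVec_pos (x := star a) (by simpa using hne)
    rw [star_star, hq] at h1
    exact lt_irrefl _ h1
  refine hz (funext fun j => ?_)
  by_cases h : p j
  · have := congrFun ha0 j
    simpa [ha, h] using this
  · have := hz' j
    rw [ha0, if_neg h] at this
    simpa using this

theorem det_mixedRows_ne_zero {C : Matrix n n ℂ} (h1 : C.PosDef) (h2 : (1 - C).PosDef)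
    (p : n → Prop) [DecidablePred p] : (mixedRows C p).det ≠ 0 := by
  have hC : IsUnit C.det := (Matrix.isUnit_iff_isUnit_det _).1 h1.isUnit
  rw [mixedRows_eq_mul hC, det_mul]
  exact mul_ne_zero (det_rowsOrOne_ne_zero (posDef_inv_sub_one h1 h2) p) hC.ne_zero

/-- The ratio of two principal minors of `W` is a minimum of the quadratic form of `W`. -/
theorem det_rowsOrOne_ratio {W : Matrix n n ℂ} (hW : W.PosDef) {p q : n → Prop} [DecidablePred p]
    [DecidablePred q] {x : n} (hx : ¬p x) (hq : ∀ i, q i ↔ p i ∨ i = x) {v : n → ℂ} (hvx : v x = 1)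
    (hv : ∀ i, ¬q i → v i = 0) :
    ((rowsOrOne W q).det / (rowsOrOne W p).det).re ≤ (star v ⬝ᵥ W *ᵥ v).re := by
  have hdet := det_rowsOrOne_ne_zero hW p
  set N := rowsOrOne W p with hN
  -- Row x of W is expanded in the rows of N. Passing from p to q replaces row x of N by this
  -- combination, so the ratio of determinants is the coefficient z x.
  set z : n → ℂ := W x ᵥ* N⁻¹ with hz
  have hzN : z ᵥ* N = W x := by
    rw [hz, vecMul_vecMul, Matrix.nonsing_inv_mul _ (isUnit_iff_ne_zero.2 hdet), vecMul_one]
  have hupd : rowsOrOne W q = N.updateRow x (∑ k, z k • N k) := by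
    have hsum : ∑ k, z k • N k = W x := by
      rw [← hzN]
      ext j
      simp [vecMul, dotProduct, Finset.sum_apply]
    rw [hsum]
    ext i j
    by_cases h : i = x
    · subst h
      simp [rowsOrOne, hq]
    · rw [updateRow_ne h]
      simp [hN, rowsOrOne, hq, h]
  have hratio : (rowsOrOne W q).det / N.det = z x := by
    rw [hupd, det_updateRow_sum, smul_eq_mul, mul_div_cancel_right₀ _ hdet]
  rw [hratio]
  set b : n → ℂ := fun i => if p i then z i else 0 with hb
  have hrow : ∀ j, (b ᵥ* W) j + (if p j then 0 else z j) = W x j := fun j => by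
    rw [hb, ← vecMul_rowsOrOne, ← hN, hzN]
  -- u minimizes the form: uW vanishes on p, so u is orthogonal for W to every vector supported on
  -- p, and its energy is z x. A competitor differs from u by such a vector d, which adds the energy
  -- of d.
  set u : n → ℂ := Pi.single x 1 - b with hu
  have huW : ∀ j, (u ᵥ* W) j = if p j then 0 else z j := by
    intro j
    rw [hu, sub_vecMul, Pi.sub_apply, single_one_vecMul]
    simp only [Matrix.row]
    rw [← hrow j]
    ring
  set d : n → ℂ := star v - u with hd
  have hd0 : ∀ j, ¬p j → d j = 0 := by
    intro j hj
    by_cases h : j = x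
    · subst h
      simp [hd, hu, hb, hj, hvx]
    · have h1 : v j = 0 := hv j (by rw [hq]; tauto)
      simp [hd, hu, hb, hj, h1, h]
  have hcross : u ⬝ᵥ W *ᵥ star d = 0 := by
    rw [dotProduct_mulVec, dotProduct]
    refine Finset.sum_eq_zero fun j _ => ?_
    by_cases h : p j
    · rw [huW, if_pos h, zero_mul]
    · rw [Pi.star_apply, hd0 j h, star_zero, mul_zero]
  have hcross' : d ⬝ᵥ W *ᵥ star u = 0 := by
    have h1 : star (u ⬝ᵥ W *ᵥ star d) = d ⬝ᵥ W *ᵥ star u := by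
      rw [← star_dotProduct_star, star_mulVec, hW.isHermitian.eq, star_star, ← dotProduct_mulVec]
    rw [← h1, hcross, star_zero]
  have huu : u ⬝ᵥ W *ᵥ star u = z x := by
    rw [dotProduct_mulVec, dotProduct, Finset.sum_eq_single x]
    · rw [huW, if_neg hx]
      simp [hu, hb, hx]
    · intro j _ hj
      by_cases h : p j
      · rw [huW, if_pos h, zero_mul]
      · simp [hu, hb, h, hj]
    · simp
  have hv2 : star v = u + d := by rw [hd]; abel
  have hfull : star v ⬝ᵥ W *ᵥ v = z x + d ⬝ᵥ W *ᵥ star d := by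
    have h1 : v = star u + star d := by rw [← star_add, ← hv2, star_star]
    conv_lhs => rw [hv2, h1]
    rw [mulVec_add, add_dotProduct, dotProduct_add, dotProduct_add, hcross, hcross', huu]
    ring
  rw [hfull, Complex.add_re]
  have h2 := hW.posSemidef.dotProduct_mulVec_nonneg (star d)
  rw [star_star] at h2
  have h3 : 0 ≤ (d ⬝ᵥ W *ᵥ star d).re := (Complex.nonneg_iff.1 h2).1
  linarith

theorem det_mixedRows_ratio {C : Matrix n n ℂ} (h1 : C.PosDef) (h2 : (1 - C).PosDef)
    {p q : n → Prop} [DecidablePred p] [DecidablePred q] {x : n} (hx : ¬p x)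
    (hq : ∀ i, q i ↔ p i ∨ i = x) {v : n → ℂ} (hvx : v x = 1) (hv : ∀ i, ¬q i → v i = 0) :
    ((mixedRows C q).det / (mixedRows C p).det).re ≤
      (star v ⬝ᵥ C⁻¹ *ᵥ v).re - (star v ⬝ᵥ v).re := by
  have hC : IsUnit C.det := (Matrix.isUnit_iff_isUnit_det _).1 h1.isUnit
  have h3 := det_rowsOrOne_ratio (posDef_inv_sub_one h1 h2) hx hq hvx hv
  rw [mixedRows_eq_mul hC, mixedRows_eq_mul hC, det_mul, det_mul,
    mul_div_mul_right _ _ hC.ne_zero]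
  rwa [sub_mulVec, one_mulVec, dotProduct_sub, Complex.sub_re] at h3

end MixedRows

end DPPDynamics

end

noncomputable section

namespace DPPDynamics

variable {E : Type*} [DecidableEq E]

/-! ### The determinantal point process -/

section Kernel

open Matrix
open scoped ComplexOrder

variable {A : H0 E →L[ℂ] H0 E}

omit [DecidableEq E] in
theorem isUnit_one_add (hpos : A.IsPositive) : IsUnit (1 + A) := by
  have h := (ContinuousLinearMap.nonneg_iff_isPositive A).2 hpos
  exact CStarAlgebra.isUnit_of_le 1 (le_add_of_nonneg_right h)

/-- `(1 + A)⁻¹ = 1 - K`. -/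
def coKernel (A : H0 E →L[ℂ] H0 E) : H0 E →L[ℂ] H0 E := Ring.inverse (1 + A)

omit [DecidableEq E] in
theorem coKernel_add_apply (hpos : A.IsPositive) (f : H0 E) :
    coKernel A f + A (coKernel A f) = f := by
  have := Ring.mul_inverse_cancel _ (isUnit_one_add hpos)
  exact congrArg (fun W : H0 E →L[ℂ] H0 E => W f) this

omit [DecidableEq E] in
theorem coKernel_apply_add (hpos : A.IsPositive) (f : H0 E) : coKernel A (f + A f) = f := by
  have := Ring.inverse_mul_cancel _ (isUnit_one_add hpos)
  exact congrArg (fun W : H0 E →L[ℂ] H0 E => W f) this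

omit [DecidableEq E] in
theorem dppKernel_apply (f : H0 E) : dppKernel A f = A (coKernel A f) := rfl

omit [DecidableEq E] in
theorem coKernel_symm (hpos : A.IsPositive) (f g : H0 E) :
    inner ℂ (coKernel A f) g = inner ℂ f (coKernel A g) := by
  have hf := coKernel_add_apply hpos f
  have hg := coKernel_add_apply hpos g
  set u := coKernel A f
  set v := coKernel A g
  rw [← hf, ← hg, inner_add_right, inner_add_left, hpos.inner_left_eq_inner_right]

omit [DecidableEq E] in
theorem dppKernel_symm (hpos : A.IsPositive) (f g : H0 E) :
    inner ℂ (dppKernel A f) g = inner ℂ f (dppKernel A g) := by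
  have e : ∀ f, dppKernel A f = f - coKernel A f := fun f =>
    eq_sub_of_add_eq' (coKernel_add_apply hpos f)
  rw [e, e, inner_sub_left, inner_sub_right, coKernel_symm hpos]

omit [DecidableEq E] in
theorem re_inner_coKernel (hpos : A.IsPositive) (f : H0 E) :
    (inner ℂ f (coKernel A f)).re = ‖coKernel A f‖ ^ 2 + minusNormSq A (coKernel A f) := by
  have hf := coKernel_add_apply hpos f
  set u := coKernel A f
  rw [← hf, inner_add_left, hpos.inner_left_eq_inner_right, inner_self_eq_norm_sq_to_K,
    Complex.add_re, minusNormSq]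
  norm_cast

omit [DecidableEq E] in
theorem re_inner_dppKernel (hpos : A.IsPositive) (f : H0 E) :
    (inner ℂ f (dppKernel A f)).re = minusNormSq A (coKernel A f) + ‖A (coKernel A f)‖ ^ 2 := by
  have hf := coKernel_add_apply hpos f
  rw [dppKernel_apply]
  set u := coKernel A f
  rw [← hf, inner_add_left, inner_self_eq_norm_sq_to_K, Complex.add_re, minusNormSq]
  norm_cast

/-- The vector of `ℋ_0` with the coordinates `v` on `Λ`. -/
def embed (Λ : Finset E) (v : Λ → ℂ) : H0 E := ∑ i : Λ, v i • basisVec (i : E)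

/-- The matrix of an operator on `Λ`. -/
def opMatrix (C : H0 E →L[ℂ] H0 E) (Λ : Finset E) : Matrix Λ Λ ℂ :=
  Matrix.of fun i j => entry C (i : E) (j : E)

theorem embed_apply (Λ : Finset E) (v : Λ → ℂ) (i : Λ) : embed Λ v i = v i := by
  rw [embed, lp.coeFn_sum, Finset.sum_apply]
  simp [basisVec_apply, Finset.sum_ite_eq]

theorem embed_eq {Λ : Finset E} {h : H0 E} (hh : ∀ y, y ∉ Λ → h y = 0) :
    embed Λ (fun i => h i) = h := by
  conv_rhs => rw [eq_sum_basisVec hh]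
  exact Finset.sum_coe_sort Λ fun y => h y • (basisVec y : H0 E)

theorem inner_embed_left (Λ : Finset E) (v : Λ → ℂ) (f : H0 E) :
    inner ℂ (embed Λ v) f = ∑ i : Λ, star (v i) * f i := by
  simp only [embed, sum_inner, inner_smul_left, inner_basisVec_left]
  rfl

theorem opMatrix_mulVec (C : H0 E →L[ℂ] H0 E) (Λ : Finset E) (v : Λ → ℂ) (i : Λ) :
    (opMatrix C Λ *ᵥ v) i = (C (embed Λ v)) i := by
  rw [← inner_basisVec_left, embed, map_sum, inner_sum]
  simp only [opMatrix, mulVec, dotProduct, Matrix.of_apply, entry, map_smul, inner_smul_right]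
  exact Finset.sum_congr rfl fun j _ => mul_comm _ _

theorem dotProduct_opMatrix (C : H0 E →L[ℂ] H0 E) (Λ : Finset E) (v w : Λ → ℂ) :
    star v ⬝ᵥ opMatrix C Λ *ᵥ w = inner ℂ (embed Λ v) (C (embed Λ w)) := by
  rw [inner_embed_left]
  simp only [dotProduct, opMatrix_mulVec, Pi.star_apply]

theorem dotProduct_embed (Λ : Finset E) (v w : Λ → ℂ) :
    star v ⬝ᵥ w = inner ℂ (embed Λ v) (embed Λ w) := by
  rw [inner_embed_left]
  simp only [dotProduct, embed_apply, Pi.star_apply]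

theorem opMatrix_posDef {C : H0 E →L[ℂ] H0 E} (hsymm : ∀ f g, inner ℂ (C f) g = inner ℂ f (C g))
    (hpd : ∀ f, f ≠ 0 → 0 < (inner ℂ f (C f)).re) (Λ : Finset E) : (opMatrix C Λ).PosDef := by
  refine Matrix.PosDef.of_dotProduct_mulVec_pos ?_ ?_
  · ext i j
    simp only [opMatrix, Matrix.conjTranspose_apply, Matrix.of_apply, entry]
    rw [← hsymm]
    exact inner_conj_symm _ _
  · intro v hv
    rw [dotProduct_opMatrix, Complex.pos_iff]
    refine ⟨hpd _ fun h0 => hv ?_, ?_⟩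
    · ext i
      rw [← embed_apply Λ v i, h0]
      rfl
    · have h1 := inner_conj_symm (𝕜 := ℂ) (embed Λ v) (C (embed Λ v))
      rw [hsymm] at h1
      exact (Complex.conj_eq_iff_im.1 h1).symm

theorem coKernel_posDef (hpos : A.IsPositive) (Λ : Finset E) : (opMatrix (coKernel A) Λ).PosDef := by
  refine opMatrix_posDef (coKernel_symm hpos) (fun f hf => ?_) Λ
  rw [re_inner_coKernel hpos]
  have h1 : 0 < ‖coKernel A f‖ := by
    rw [norm_pos_iff]
    intro h0
    apply hf
    rw [← coKernel_add_apply hpos f, h0, map_zero, add_zero]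
  have := minusNormSq_nonneg hpos (coKernel A f)
  positivity

theorem dppKernel_posDef (hpos : A.IsPositive) (hker : ∀ f, A f = 0 → f = 0) (Λ : Finset E) :
    (opMatrix (dppKernel A) Λ).PosDef := by
  refine opMatrix_posDef (dppKernel_symm hpos) (fun f hf => ?_) Λ
  rw [re_inner_dppKernel hpos]
  have h1 : 0 < ‖A (coKernel A f)‖ := by
    rw [norm_pos_iff]
    intro h0
    apply hf
    rw [← coKernel_add_apply hpos f, h0, hker _ h0, add_zero]
  have := minusNormSq_nonneg hpos (coKernel A f)
  positivity

theorem one_sub_dppKernel (hpos : A.IsPositive) (Λ : Finset E) :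
    1 - opMatrix (dppKernel A) Λ = opMatrix (coKernel A) Λ := by
  ext i j
  have h1 := coKernel_add_apply hpos (basisVec (j : E))
  have h2 : inner ℂ (basisVec (i : E) : H0 E) (basisVec (j : E)) = (1 : Matrix Λ Λ ℂ) i j := by
    rw [inner_basisVec_left, basisVec_apply, Matrix.one_apply]
    simp
  rw [Matrix.sub_apply, ← h2]
  simp only [opMatrix, Matrix.of_apply, entry, dppKernel_apply]
  conv_lhs => rw [← h1]
  rw [coKernel_apply_add hpos, inner_add_right]
  ring

/-- The quadratic form of the inverse of a compression is at most the form of the inverse. -/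
theorem inv_opMatrix_le {C : H0 E →L[ℂ] H0 E} (hsymm : ∀ f g, inner ℂ (C f) g = inner ℂ f (C g))
    (hpd : ∀ f, 0 ≤ (inner ℂ f (C f)).re) {Λ : Finset E} (hM : (opMatrix C Λ).PosDef)
    {v : Λ → ℂ} {u : ℕ → H0 E} {ρ : ℝ} (hu : Tendsto (fun n => C (u n)) atTop (𝓝 (embed Λ v)))
    (hρ : Tendsto (fun n => (inner ℂ (u n) (C (u n))).re) atTop (𝓝 ρ)) :
    (star v ⬝ᵥ (opMatrix C Λ)⁻¹ *ᵥ v).re ≤ ρ := by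
  have hdet : IsUnit (opMatrix C Λ).det := (Matrix.isUnit_iff_isUnit_det _).1 hM.isUnit
  set g : Λ → ℂ := (opMatrix C Λ)⁻¹ *ᵥ v with hg
  have hMg : opMatrix C Λ *ᵥ g = v := by
    rw [hg, mulVec_mulVec, Matrix.mul_nonsing_inv _ hdet, one_mulVec]
  have h1 : (inner ℂ (embed Λ g) (C (embed Λ g))).re = (star v ⬝ᵥ g).re := by
    rw [← dotProduct_opMatrix, hMg, ← Complex.conj_re, ← Complex.star_def, ← star_dotProduct_star,
      star_star]
  have h2 : (inner ℂ (embed Λ g) (embed Λ v)).re = (star v ⬝ᵥ g).re := by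
    rw [← dotProduct_embed, ← Complex.conj_re, ← Complex.star_def, ← star_dotProduct_star,
      star_star]
  -- This is the form of C at u_n - g, with g the compressed inverse applied to v. A sequence is
  -- needed because v need not lie in the range of C itself.
  have h3 : ∀ n, 0 ≤ (inner ℂ (u n) (C (u n))).re - 2 * (inner ℂ (embed Λ g) (C (u n))).re +
      (star v ⬝ᵥ g).re := by
    intro n
    have h4 := hpd (u n - embed Λ g)
    rw [map_sub, inner_sub_left, inner_sub_right, inner_sub_right] at h4
    have h5 : (inner ℂ (u n) (C (embed Λ g))).re = (inner ℂ (embed Λ g) (C (u n))).re := by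
      rw [← hsymm, ← inner_conj_symm, Complex.conj_re]
    simp only [Complex.sub_re, h5, h1] at h4
    linarith
  have hlim : Tendsto (fun n => (inner ℂ (u n) (C (u n))).re -
      2 * (inner ℂ (embed Λ g) (C (u n))).re + (star v ⬝ᵥ g).re) atTop
      (𝓝 (ρ - 2 * (inner ℂ (embed Λ g) (embed Λ v)).re + (star v ⬝ᵥ g).re)) := by
    refine (hρ.sub (Tendsto.const_mul 2 ?_)).add_const _
    exact (Complex.continuous_re.tendsto _).comp (tendsto_const_nhds.inner hu)
  have := ge_of_tendsto' hlim h3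
  rw [h2] at this
  linarith

end Kernel

end DPPDynamics

end

noncomputable section

namespace DPPDynamics

variable {E : Type*} [DecidableEq E]

/-! ### The Papangelou intensity -/

section Papangelou

open Matrix
open scoped ComplexOrder

variable {A : H0 E →L[ℂ] H0 E} {μ : Measure (Config E)}

omit [DecidableEq E] in
theorem measurableSet_cylinder (S T : Finset E) :
    MeasurableSet {ζ : Config E | (∀ x ∈ S, ζ x = true) ∧ ∀ x ∈ T, ζ x = false} := by
  have h : ∀ (x : E) (b : Bool), MeasurableSet {ζ : Config E | ζ x = b} := fun x b =>
    by
    have := measurable_pi_apply (X := fun _ : E => Bool) x (measurableSet_singleton b)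
    exact this
  have e : {ζ : Config E | (∀ x ∈ S, ζ x = true) ∧ ∀ x ∈ T, ζ x = false} =
      (⋂ x ∈ S, {ζ : Config E | ζ x = true}) ∩ ⋂ x ∈ T, {ζ : Config E | ζ x = false} := by
    ext ζ
    simp
  rw [e]
  exact (S.measurableSet_biInter fun x _ => h x _).inter (T.measurableSet_biInter fun x _ => h x _)

/-- Inclusion–exclusion as multilinearity: demanding a site to be empty subtracts the event that it
is occupied, and in the determinant the identity row is the sum of a row of 1 - K and a row of K. -/
theorem IsDPP.real_cylinder {K : H0 E →L[ℂ] H0 E} (hμ : IsDPP K μ) (Λ : Finset E) (T : Finset E) :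
    ∀ S : Finset E, S ⊆ Λ → T ⊆ Λ → Disjoint S T →
      ((μ.real {ζ : Config E | (∀ x ∈ S, ζ x = true) ∧ ∀ x ∈ T, ζ x = false} : ℝ) : ℂ) =
        (Matrix.of fun i j : Λ => if (i : E) ∈ S then opMatrix K Λ i j else
          if (i : E) ∈ T then (1 : Matrix Λ Λ ℂ) i j - opMatrix K Λ i j else
            (1 : Matrix Λ Λ ℂ) i j).det := by
  have := hμ.1
  induction T using Finset.induction_on with
  | empty =>
    intro S hS _ _
    simp only [Finset.notMem_empty, if_false, false_imp_iff, implies_true, and_true]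
    rw [hμ.2 S]
    -- Without empty sites the rows outside S are identity rows, so the matrix is block triangular
    -- and only the minor on S remains.
    rw [Matrix.twoBlockTriangular_det _ (fun i : Λ => (i : E) ∈ S)]
    · have h1 : (Matrix.of fun i j : Λ => if (i : E) ∈ S then opMatrix K Λ i j else
            (1 : Matrix Λ Λ ℂ) i j).toSquareBlockProp (fun i : Λ => ¬ (i : E) ∈ S) = 1 := by
        ext i j
        have hi : ¬ ((i : Λ) : E) ∈ S := i.2
        simp only [Matrix.toSquareBlockProp, Matrix.toBlock_apply, Matrix.of_apply, if_neg hi,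
          Matrix.one_apply, Subtype.ext_iff]
      rw [h1, Matrix.det_one, mul_one]
      let e : {i : Λ // (i : E) ∈ S} ≃ S :=
        { toFun := fun i => ⟨i, i.2⟩
          invFun := fun i => ⟨⟨i, hS i.2⟩, i.2⟩
          left_inv := fun i => rfl
          right_inv := fun i => rfl }
      rw [← Matrix.det_submatrix_equiv_self e]
      congr 1
      ext i j
      simp [Matrix.toSquareBlockProp, i.2, opMatrix, e]
    · intro i hi j hj
      simp only [Matrix.of_apply, if_neg hi]
      exact Matrix.one_apply_ne fun h => hi (h ▸ hj)
  | insert a T ha ih =>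
    intro S hS hT hST
    have haΛ : a ∈ Λ := hT (Finset.mem_insert_self a T)
    have hTΛ : T ⊆ Λ := (Finset.subset_insert a T).trans hT
    have haS : a ∉ S := fun h => Finset.disjoint_left.1 hST h (Finset.mem_insert_self a T)
    have hd : Disjoint S T := hST.mono_right (Finset.subset_insert a T)
    have i1 := ih S hS hTΛ hd
    have i2 := ih (insert a S) (Finset.insert_subset haΛ hS) hTΛ
      (Finset.disjoint_insert_left.2 ⟨ha, hd⟩)
    have hsub : {ζ : Config E | (∀ x ∈ insert a S, ζ x = true) ∧ ∀ x ∈ T, ζ x = false} ⊆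
        {ζ : Config E | (∀ x ∈ S, ζ x = true) ∧ ∀ x ∈ T, ζ x = false} := fun ζ hζ =>
      ⟨fun x hx => hζ.1 x (Finset.mem_insert_of_mem hx), hζ.2⟩
    have hset : {ζ : Config E | (∀ x ∈ S, ζ x = true) ∧ ∀ x ∈ insert a T, ζ x = false} =
        {ζ : Config E | (∀ x ∈ S, ζ x = true) ∧ ∀ x ∈ T, ζ x = false} \
          {ζ : Config E | (∀ x ∈ insert a S, ζ x = true) ∧ ∀ x ∈ T, ζ x = false} := by
      ext ζ
      simp only [Set.mem_ofPred_eq, Set.mem_sdiff, Finset.forall_mem_insert]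
      cases ζ a <;> simp
    rw [hset, measureReal_sdiff hsub (measurableSet_cylinder _ _), Complex.ofReal_sub, i1, i2,
      sub_eq_iff_eq_add]
    set N : Matrix Λ Λ ℂ := Matrix.of fun i j : Λ => if (i : E) ∈ S then opMatrix K Λ i j else
          if (i : E) ∈ T then (1 : Matrix Λ Λ ℂ) i j - opMatrix K Λ i j else
            (1 : Matrix Λ Λ ℂ) i j with hN
    have e0 : N = N.updateRow ⟨a, haΛ⟩ ((fun j => (1 : Matrix Λ Λ ℂ) ⟨a, haΛ⟩ j -
        opMatrix K Λ ⟨a, haΛ⟩ j) + opMatrix K Λ ⟨a, haΛ⟩) := by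
      ext i j
      by_cases hi : i = ⟨a, haΛ⟩
      · subst hi
        simp [N, haS, ha]
      · simp [Matrix.updateRow_ne hi]
    conv_lhs => rw [e0]
    rw [Matrix.det_updateRow_add]
    congr 2
    · ext i j
      by_cases hi : i = ⟨a, haΛ⟩
      · subst hi
        simp [haS]
      · have : (i : E) ≠ a := fun h => hi (Subtype.ext h)
        simp [Matrix.updateRow_ne hi, N, this]
    · ext i j
      by_cases hi : i = ⟨a, haΛ⟩
      · subst hi
        simp
      · have : (i : E) ≠ a := fun h => hi (Subtype.ext h)
        simp [Matrix.updateRow_ne hi, N, this]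

theorem IsDPP.localMarginal_eq {K : H0 E →L[ℂ] H0 E} (hμ : IsDPP K μ) (Λ : Finset E)
    (ξ : Config E) : ((localMarginal μ Λ ξ : ℝ) : ℂ) =
      (mixedRows (opMatrix K Λ) fun i => ξ i = false).det := by
  have h := hμ.real_cylinder Λ (Λ.filter fun x => ξ x = false) (Λ.filter fun x => ξ x = true)
    (Finset.filter_subset _ _) (Finset.filter_subset _ _) (by
      rw [Finset.disjoint_left]
      simp +contextual)
  have hset : {ζ : Config E | ∀ y ∈ Λ, ζ y = ξ y} =
      {ζ : Config E | (∀ x ∈ Λ.filter fun x => ξ x = true, ζ x = true) ∧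
        ∀ x ∈ Λ.filter fun x => ξ x = false, ζ x = false} := by
    ext ζ
    simp only [Set.mem_ofPred_eq, Finset.mem_filter]
    constructor
    · exact fun h => ⟨fun x hx => (h x hx.1).trans hx.2, fun x hx => (h x hx.1).trans hx.2⟩
    · intro h y hy
      cases hξ : ξ y
      · exact h.2 y ⟨hy, hξ⟩
      · exact h.1 y ⟨hy, hξ⟩
  rw [localMarginal, hset, h]
  congr 1
  ext i j
  simp only [mixedRows, Matrix.of_apply, Finset.mem_filter, i.2, true_and, Matrix.sub_apply]
  rcases Bool.eq_false_or_eq_true (ξ i) with h | h <;> simp [h]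

theorem IsDPP.localMarginal_eq_coKernel (hpos : A.IsPositive) (hμ : IsDPP (dppKernel A) μ)
    (Λ : Finset E) (ξ : Config E) : ((localMarginal μ Λ ξ : ℝ) : ℂ) =
      (mixedRows (opMatrix (coKernel A) Λ) fun i => ξ i = true).det := by
  rw [hμ.localMarginal_eq]
  congr 1
  ext i j
  rw [← one_sub_dppKernel hpos]
  simp only [mixedRows, Matrix.of_apply, Matrix.sub_apply]
  rcases Bool.eq_false_or_eq_true (ξ i) with h | h <;> simp [h]

theorem IsDPP.localMarginal_pos (hpos : A.IsPositive) (hker : ∀ f, A f = 0 → f = 0)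
    (hμ : IsDPP (dppKernel A) μ) (Λ : Finset E) (ξ : Config E) : 0 < localMarginal μ Λ ξ := by
  refine lt_of_le_of_ne measureReal_nonneg fun h0 => ?_
  refine det_mixedRows_ne_zero (dppKernel_posDef hpos hker Λ) ?_ (fun i : Λ => ξ i = false) ?_
  · rw [one_sub_dppKernel hpos]
    exact coKernel_posDef hpos Λ
  · rw [← hμ.localMarginal_eq, ← h0, Complex.ofReal_zero]

/-- With C = 1 - K = (1 + A)⁻¹ the variational bound involves the inverse of the compression of C.
Its form is at most that of C⁻¹ = 1 + A, so subtracting ‖h‖² leaves at most ‖h‖_-². -/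
theorem IsDPP.ratio_le (hpos : A.IsPositive) (hker : ∀ f, A f = 0 → f = 0)
    (hμ : IsDPP (dppKernel A) μ) {Λ : Finset E} {x : E} (hxΛ : x ∈ Λ) {ξ : Config E}
    (hx : ξ x = false) {f : H0 E} (hf : f ∈ locSpan {y : E | y ∈ Λ ∧ ξ y = true}) :
    localMarginal μ Λ (ins x ξ) / localMarginal μ Λ ξ ≤ minusNormSq A (basisVec x - f) := by
  set h : H0 E := basisVec x - f with hh
  have hoff : ∀ y, ¬ (y ∈ Λ ∧ ξ y = true) → f y = 0 := fun y hy =>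
    apply_eq_zero_of_mem_locSpan hf hy
  have happ : ∀ y, h y = (if y = x then 1 else 0) - f y := fun y => by
    rw [hh, lp.coeFn_sub, Pi.sub_apply, basisVec_apply]
  have hΛ : ∀ y, y ∉ Λ → h y = 0 := fun y hy => by
    have hyx : y ≠ x := fun h => hy (h ▸ hxΛ)
    rw [happ, hoff y fun h => hy h.1, if_neg hyx, sub_zero]
  have hemb := embed_eq hΛ
  have key := det_mixedRows_ratio (coKernel_posDef hpos Λ)
    (by rw [← one_sub_dppKernel hpos, sub_sub_cancel]; exact dppKernel_posDef hpos hker Λ)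
    (p := fun i : Λ => ξ i = true) (q := fun i : Λ => ins x ξ i = true) (x := ⟨x, hxΛ⟩)
    (v := fun i : Λ => h i) (by simp [hx])
    (by
      intro i
      by_cases hi : (i : E) = x
      · simp [ins, hi, Subtype.ext_iff]
      · simp [ins, hi, Subtype.ext_iff])
    (by
      show h x = 1
      rw [happ, hoff x (by simp [hx]), if_pos rfl, sub_zero])
    (by
      intro i hi
      have hix : (i : E) ≠ x := fun h => hi (by simp [h, ins])
      show h i = 0
      rw [happ, if_neg hix, hoff, sub_zero]
      rintro ⟨_, h2⟩
      exact hi (by rw [ins_of_ne hix]; exact h2))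
  rw [← hμ.localMarginal_eq_coKernel hpos, ← hμ.localMarginal_eq_coKernel hpos,
    ← Complex.ofReal_div, Complex.ofReal_re] at key
  refine key.trans ?_
  have h1 : (star (fun i : Λ => h i) ⬝ᵥ (opMatrix (coKernel A) Λ)⁻¹ *ᵥ fun i : Λ => h i).re ≤
      ‖h‖ ^ 2 + minusNormSq A h := by
    refine inv_opMatrix_le (coKernel_symm hpos) (fun f => ?_) (coKernel_posDef hpos Λ)
      (u := fun _ => h + A h) ?_ ?_
    · rw [re_inner_coKernel hpos]
      have := minusNormSq_nonneg hpos (coKernel A f)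
      positivity
    · rw [hemb]
      simp only [coKernel_apply_add hpos]
      exact tendsto_const_nhds
    · have e : (inner ℂ (h + A h) (coKernel A (h + A h))).re = ‖h‖ ^ 2 + minusNormSq A h := by
        rw [re_inner_coKernel hpos, coKernel_apply_add hpos]
      simp only [e]
      exact tendsto_const_nhds
  have h2 : (star (fun i : Λ => h i) ⬝ᵥ fun i : Λ => h i).re = ‖h‖ ^ 2 := by
    rw [dotProduct_embed, hemb, inner_self_eq_norm_sq_to_K]
    norm_cast
  linarith

/-- The mirror image with C = K, where K⁻¹ = 1 + A⁻¹ formally, and occupied and empty sites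
exchanged. As h is only in ℋ_+, it is approximated by A v_n = K(v_n + A v_n), with energies ‖v_n‖_-²
+ ‖A v_n‖² converging to r² + ‖h‖². -/
theorem IsDPP.inv_ratio_le (hpos : A.IsPositive) (hker : ∀ f, A f = 0 → f = 0)
    (hμ : IsDPP (dppKernel A) μ) {Λ : Finset E} {x : E} (hxΛ : x ∈ Λ) {ξ : Config E}
    (hx : ξ x = false) {g : H0 E} (hg : g ∈ locSpan {y : E | y ∈ Λ ∧ ξ y = false ∧ y ≠ x}) {r : ℝ}
    (hr : HasPlusNorm A (basisVec x - g) r) :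
    localMarginal μ Λ ξ / localMarginal μ Λ (ins x ξ) ≤ r ^ 2 := by
  set h : H0 E := basisVec x - g with hh
  have hoff : ∀ y, ¬ (y ∈ Λ ∧ ξ y = false ∧ y ≠ x) → g y = 0 := fun y hy =>
    apply_eq_zero_of_mem_locSpan hg hy
  have happ : ∀ y, h y = (if y = x then 1 else 0) - g y := fun y => by
    rw [hh, lp.coeFn_sub, Pi.sub_apply, basisVec_apply]
  have hΛ : ∀ y, y ∉ Λ → h y = 0 := fun y hy => by
    have hyx : y ≠ x := fun h => hy (h ▸ hxΛ)
    rw [happ, hoff y fun h => hy h.1, if_neg hyx, sub_zero]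
  have hemb := embed_eq hΛ
  have key := det_mixedRows_ratio (dppKernel_posDef hpos hker Λ)
    (by rw [one_sub_dppKernel hpos]; exact coKernel_posDef hpos Λ)
    (p := fun i : Λ => ins x ξ i = false) (q := fun i : Λ => ξ i = false) (x := ⟨x, hxΛ⟩)
    (v := fun i : Λ => h i) (by simp [ins])
    (by
      intro i
      by_cases hi : (i : E) = x
      · simp [ins, hi, Subtype.ext_iff, hx]
      · simp [ins, hi, Subtype.ext_iff])
    (by
      show h x = 1
      rw [happ, hoff x (by simp), if_pos rfl, sub_zero])
    (by
      intro i hi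
      have hix : (i : E) ≠ x := fun h => hi (by simp [h, hx])
      show h i = 0
      rw [happ, if_neg hix, hoff, sub_zero]
      rintro ⟨_, h2, _⟩
      exact hi h2)
  rw [← hμ.localMarginal_eq, ← hμ.localMarginal_eq,
    ← Complex.ofReal_div, Complex.ofReal_re] at key
  refine key.trans ?_
  obtain ⟨_, v, _, hv, hvr⟩ := hr
  have h1 : (star (fun i : Λ => h i) ⬝ᵥ (opMatrix (dppKernel A) Λ)⁻¹ *ᵥ fun i : Λ => h i).re ≤
      r ^ 2 + ‖h‖ ^ 2 := by
    refine inv_opMatrix_le (dppKernel_symm hpos) (fun f => ?_) (dppKernel_posDef hpos hker Λ)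
      (u := fun n => v n + A (v n)) ?_ ?_
    · rw [re_inner_dppKernel hpos]
      have := minusNormSq_nonneg hpos (coKernel A f)
      positivity
    · rw [hemb]
      simpa only [dppKernel_apply, coKernel_apply_add hpos] using hv
    · have e : ∀ n, (inner ℂ (v n + A (v n)) (dppKernel A (v n + A (v n)))).re =
          minusNormSq A (v n) + ‖A (v n)‖ ^ 2 := fun n => by
        rw [re_inner_dppKernel hpos, coKernel_apply_add hpos]
      simp only [e]
      exact hvr.add (hv.norm.pow 2)
  have h2 : (star (fun i : Λ => h i) ⬝ᵥ fun i : Λ => h i).re = ‖h‖ ^ 2 := by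
    rw [dotProduct_embed, hemb, inner_self_eq_norm_sq_to_K]
    norm_cast
  linarith

/-- The ratio lies between 1/β_Λ and α_Λ, and both ends converge to α when αβ = 1. -/
theorem isPapangelou_intensity (hpos : A.IsPositive) (hker : ∀ f, A f = 0 → f = 0)
    (hH : HypothesisH A) (hμ : IsDPP (dppKernel A) μ) {x : E} {ξ : Config E} (hx : ξ x = false)
    (hαβ : intensity A x ξ * dualIntensity A x ξ = 1) :
    IsPapangelou μ x ξ (intensity A x ξ) := by
  have hα : 0 < intensity A x ξ := intensity_pos hpos hker hH hx
  have hβ : dualIntensity A x ξ = (intensity A x ξ)⁻¹ := eq_inv_of_mul_eq_one_right hαβ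
  have hP : ∀ (Λ : Finset E) (ζ : Config E), 0 < localMarginal μ Λ ζ :=
    fun Λ ζ => hμ.localMarginal_pos hpos hker Λ ζ
  refine tendsto_order.2 ⟨fun a ha => ?_, fun a ha => ?_⟩
  · rcases le_or_gt a 0 with ha0 | ha0
    · exact Eventually.of_forall fun Λ => ha0.trans_lt (div_pos (hP _ _) (hP _ _))
    have hlt : (intensity A x ξ)⁻¹ < a⁻¹ := (inv_lt_inv₀ hα ha0).2 ha
    obtain ⟨Λ₀, g, r, hg, hr, hlt'⟩ := exists_plusNorm_lt hpos hker hH x ξ (sub_pos.2 hlt)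
    filter_upwards [eventually_ge_atTop (insert x Λ₀)] with Λ hΛ
    have h1 := hμ.inv_ratio_le hpos hker (hΛ (Finset.mem_insert_self _ _)) hx
      (locSpan_mono (fun y hy => And.intro (hΛ (Finset.mem_insert_of_mem hy.1)) hy.2) hg) hr
    rw [hβ] at hlt'
    rw [← inv_div] at h1
    have h2 : (localMarginal μ Λ (ins x ξ) / localMarginal μ Λ ξ)⁻¹ < a⁻¹ := by linarith
    exact (inv_lt_inv₀ (div_pos (hP _ _) (hP _ _)) ha0).1 h2
  · obtain ⟨Λ₀, f, hf, hlt⟩ := exists_minusNormSq_lt A x ξ (sub_pos.2 ha)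
    filter_upwards [eventually_ge_atTop (insert x Λ₀)] with Λ hΛ
    have h1 := hμ.ratio_le hpos hker (hΛ (Finset.mem_insert_self _ _)) hx
      (locSpan_mono (fun y hy => And.intro (hΛ (Finset.mem_insert_of_mem hy.1)) hy.2) hf)
    linarith

end Papangelou

end DPPDynamics

end

noncomputable section

namespace DPPDynamics

variable {E : Type*} [DecidableEq E]

/-! ### Glauber dynamics -/

section Glauber

variable {A : H0 E →L[ℂ] H0 E}

omit [DecidableEq E] in
theorem continuous_ite_apply {f g : Config E → ℝ} (x : E) (hf : Continuous f)
    (hg : Continuous g) : Continuous fun ξ : Config E => if ξ x = true then f ξ else g ξ := by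
  have hi : Continuous fun ξ : Config E => if ξ x = true then (1 : ℝ) else 0 :=
    (continuous_of_discreteTopology (f := fun b : Bool => if b = true then (1 : ℝ) else 0)).comp
      (continuous_apply x)
  refine ((hi.mul hf).add ((continuous_const (y := (1 : ℝ)).sub hi |>.mul hg))).congr fun ξ => ?_
  by_cases h : ξ x = true <;> simp [h]

theorem ins_comm (x u : E) (ξ : Config E) : ins x (ins u ξ) = ins u (ins x ξ) := by
  by_cases h : x = u
  · rw [h]
  · exact (Function.update_comm h _ _ ξ).symm

theorem del_comm (x u : E) (ξ : Config E) : del x (del u ξ) = del u (del x ξ) := by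
  by_cases h : x = u
  · rw [h]
  · exact (Function.update_comm h _ _ ξ).symm

theorem ins_del_comm {x u : E} (h : x ≠ u) (ξ : Config E) : ins x (del u ξ) = del u (ins x ξ) :=
  Function.update_comm h.symm _ _ ξ

theorem clearOn_singleton (x : E) (ξ : Config E) : clearOn {x} ξ = del x ξ := by
  ext1 y
  by_cases h : y = x <;> simp [clearOn, del, h]

/-- The largest decrease of `α(x;ξ)` when `u ≠ x` becomes occupied. -/
def siteVariation (A : H0 E →L[ℂ] H0 E) (x u : E) : ℝ≥0∞ :=
  if u = x then 0 else
    ⨆ (ξ : Config E) (_ : ξ x = false ∧ ξ u = false),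
      ENNReal.ofReal (intensity A x ξ - intensity A x (ins u ξ))

theorem le_siteVariation {x u : E} (hu : u ≠ x) {ξ : Config E} (hx : ξ x = false)
    (hξ : ξ u = false) :
    ENNReal.ofReal (intensity A x ξ - intensity A x (ins u ξ)) ≤ siteVariation A x u := by
  rw [siteVariation, if_neg hu]
  exact le_iSup₂ (f := fun (ξ : Config E) (_ : ξ x = false ∧ ξ u = false) =>
    ENNReal.ofReal (intensity A x ξ - intensity A x (ins u ξ))) ξ ⟨hx, hξ⟩

theorem hasVariation_siteVariation (A : H0 E →L[ℂ] H0 E) (x : E) :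
    HasVariation A x {x} (siteVariation A x) := fun _ hu _ hx hξ =>
  le_siteVariation (by simpa using hu) (hx x (by simp)) hξ

theorem tsum_siteVariation_le (A : H0 E →L[ℂ] H0 E) (x : E) :
    ∑' u, siteVariation A x u ≤ glauberM1 A :=
  le_iSup (fun x => ∑' u, siteVariation A x u) x

theorem intensity_mul_dualIntensity_of_glauberM1 (hpos : A.IsPositive)
    (hker : ∀ f, A f = 0 → f = 0) (hH : HypothesisH A) (hM : glauberM1 A < ⊤) {x : E}
    {ξ : Config E} (hx : ξ x = false) : intensity A x ξ * dualIntensity A x ξ = 1 :=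
  (hasVariation_siteVariation A x).intensity_mul_dualIntensity hpos hker hH
    ((tsum_siteVariation_le A x).trans_lt hM) (by simp) (by simpa using hx)

/-- Substituting β = 1/α removes the dual intensity, so both Glauber rates are controlled by the
variation of α alone. -/
theorem deathRate_ins (hpos : A.IsPositive)
    (hker : ∀ f, A f = 0 → f = 0) (hH : HypothesisH A) (hM : glauberM1 A < ⊤) {x : E}
    {ξ : Config E} (hx : ξ x = false) :
    deathRate A x (ins x ξ) = 1 / (1 + intensity A x ξ) := by
  have h1 := intensity_mul_dualIntensity_of_glauberM1 hpos hker hH hM hx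
  have hα := intensity_pos hpos hker hH hx
  have hβ := dualIntensity_nonneg A x ξ
  rw [deathRate, if_pos (ins_same x ξ), del_ins, del_eq_self hx, div_eq_div_iff (by positivity)
    (by positivity)]
  linear_combination h1

theorem abs_div_one_add_sub_le {a b : ℝ} (ha : 0 ≤ a) (hab : a ≤ b) :
    |b / (1 + b) - a / (1 + a)| ≤ b - a := by
  have hb := ha.trans hab
  have e : b / (1 + b) - a / (1 + a) = (b - a) / ((1 + b) * (1 + a)) := by
    field_simp
    ring
  rw [e, abs_of_nonneg (div_nonneg (sub_nonneg.2 hab) (by positivity))]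
  exact div_le_self (sub_nonneg.2 hab) (by nlinarith)

theorem abs_one_div_one_add_sub_le {a b : ℝ} (ha : 0 ≤ a) (hab : a ≤ b) :
    |1 / (1 + a) - 1 / (1 + b)| ≤ b - a := by
  have hb := ha.trans hab
  have e : 1 / (1 + a) - 1 / (1 + b) = b / (1 + b) - a / (1 + a) := by
    field_simp
    ring
  rw [e]
  exact abs_div_one_add_sub_le ha hab

theorem glauberGamma_le (hpos : A.IsPositive)
    (hker : ∀ f, A f = 0 → f = 0) (hH : HypothesisH A) (hM : glauberM1 A < ⊤) (x u : E) :
    glauberGamma (birthRate A) (deathRate A) x u ≤ 2 * siteVariation A x u := by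
  rw [glauberGamma]
  split_ifs with hu
  · exact zero_le
  refine iSup₂_le fun ξ hξ => ?_
  have hx' : ins u ξ x = false := by rw [ins_of_ne (Ne.symm hu)]; exact hξ.1
  rw [deathRate_ins hpos hker hH hM hξ.1, deathRate_ins hpos hker hH hM hx', birthRate, if_pos hξ.1,
    birthRate, if_pos hx']
  have h0 := intensity_nonneg hpos x (ins u ξ)
  have hle : intensity A x (ins u ξ) ≤ intensity A x ξ := intensity_anti hpos x fun y hy => by
    by_cases h : y = u
    · rw [h, ins_same]
    · rwa [ins_of_ne h]
  refine le_trans (ENNReal.ofReal_le_ofReal (add_le_add (abs_div_one_add_sub_le h0 hle)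
    (abs_one_div_one_add_sub_le h0 hle))) ?_
  rw [← two_mul, ENNReal.ofReal_mul zero_le_two, ENNReal.ofReal_ofNat]
  exact mul_le_mul_right (le_siteVariation hu hξ.1 hξ.2) _

theorem rowSup_glauberGamma_le (hpos : A.IsPositive)
    (hker : ∀ f, A f = 0 → f = 0) (hH : HypothesisH A) (hM : glauberM1 A < ⊤) :
    rowSup (glauberGamma (birthRate A) (deathRate A)) ≤ 2 * glauberM1 A := by
  refine iSup_le fun x => ?_
  calc ∑' u, glauberGamma (birthRate A) (deathRate A) x u ≤ ∑' u, 2 * siteVariation A x u :=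
        ENNReal.tsum_le_tsum fun u => glauberGamma_le hpos hker hH hM x u
    _ = 2 * ∑' u, siteVariation A x u := ENNReal.tsum_mul_left
    _ ≤ 2 * glauberM1 A := mul_le_mul_right (tsum_siteVariation_le A x) _

/-- The rate of a change of the occupation of `x`. -/
def flipRate (A : H0 E →L[ℂ] H0 E) (x : E) (ξ : Config E) : ℝ :=
  if ξ x = true then deathRate A x ξ else birthRate A x ξ

theorem continuous_flipRate (hpos : A.IsPositive)
    (hker : ∀ f, A f = 0 → f = 0) (hH : HypothesisH A) (hM : glauberM1 A < ⊤) (x : E) :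
    Continuous (flipRate A x) := by
  have hc := (hasVariation_siteVariation A x).continuous hpos
    ((tsum_siteVariation_le A x).trans_lt hM)
  simp only [clearOn_singleton] at hc
  have hne : ∀ ξ, 1 + intensity A x (del x ξ) ≠ 0 := fun ξ => by
    have := intensity_nonneg hpos x (del x ξ)
    positivity
  have h1 : Continuous fun ξ => 1 / (1 + intensity A x (del x ξ)) :=
    continuous_const.div (continuous_const.add hc) hne
  have h2 : Continuous fun ξ => intensity A x (del x ξ) / (1 + intensity A x (del x ξ)) :=
    hc.div (continuous_const.add hc) hne
  refine (continuous_ite_apply x h1 h2).congr fun ξ => ?_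
  rw [flipRate]
  split_ifs with h
  · rw [← deathRate_ins hpos hker hH hM (del_same x ξ), ins_del, ins_eq_self h]
  · have h' : ξ x = false := by simpa using h
    rw [birthRate, if_pos h', del_eq_self h']

theorem flipRate_nonneg (hpos : A.IsPositive) (x : E) (ξ : Config E) : 0 ≤ flipRate A x ξ := by
  have h1 := intensity_nonneg hpos x ξ
  have h2 := dualIntensity_nonneg A x (del x ξ)
  rw [flipRate, deathRate, birthRate]
  split_ifs <;> positivity

theorem flipRate_le_one (hpos : A.IsPositive) (x : E) (ξ : Config E) : flipRate A x ξ ≤ 1 := by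
  have h1 := intensity_nonneg hpos x ξ
  have h2 := dualIntensity_nonneg A x (del x ξ)
  rw [flipRate, deathRate, birthRate]
  split_ifs
  · exact div_le_one_of_le₀ (by linarith) (by positivity)
  · exact div_le_one_of_le₀ (by linarith) (by positivity)
  · exact zero_le_one

/-- The change of the occupation of `x`. -/
def flipMap (x : E) : C(Config E, Config E) where
  toFun ξ := Function.update ξ x (!ξ x)
  continuous_toFun := continuous_id.update x
    ((continuous_of_discreteTopology (f := not)).comp (continuous_apply x))

theorem flipMap_of_true {x : E} {ξ : Config E} (h : ξ x = true) : flipMap x ξ = del x ξ := by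
  simp [flipMap, del, h]

theorem flipMap_of_false {x : E} {ξ : Config E} (h : ξ x = false) : flipMap x ξ = ins x ξ := by
  simp [flipMap, ins, h]

theorem flipMap_of_ne {x y : E} (h : y ≠ x) (ξ : Config E) : flipMap x ξ y = ξ y := by
  simp [flipMap, h]

theorem flipMap_del {x u : E} (h : x ≠ u) (ξ : Config E) :
    flipMap x (del u ξ) = del u (flipMap x ξ) := by
  simp [flipMap, del, h, Function.update_comm h]

theorem flipMap_ins {x u : E} (h : x ≠ u) (ξ : Config E) :
    flipMap x (ins u ξ) = ins u (flipMap x ξ) := by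
  simp [flipMap, ins, h, Function.update_comm h]

theorem ofReal_abs_flipRate_sub_le {x u : E} (hxu : x ≠ u) {η : Config E} (hη : η u = true) :
    ENNReal.ofReal |flipRate A x η - flipRate A x (del u η)| ≤
      glauberGamma (birthRate A) (deathRate A) x u := by
  have hins : ins u (del u η) = η := by rw [ins_del, ins_eq_self hη]
  rw [glauberGamma, if_neg (Ne.symm hxu)]
  rcases Bool.eq_false_or_eq_true (η x) with hx | hx
  · have e1 : ins x (ins u (del x (del u η))) = η := by
      rw [ins_comm, ins_del, ← ins_comm, hins, ins_eq_self hx]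
    have e2 : ins x (del x (del u η)) = del u η := by
      rw [ins_del, ins_eq_self]
      rwa [del_of_ne hxu]
    refine le_trans ?_ (le_iSup₂ (f := fun (ξ : Config E) (_ : ξ x = false ∧ ξ u = false) =>
      ENNReal.ofReal (|birthRate A x ξ - birthRate A x (ins u ξ)| +
        |deathRate A x (ins x (ins u ξ)) - deathRate A x (ins x ξ)|)) (del x (del u η))
      ⟨del_same _ _, by rw [del_comm, del_same]⟩)
    refine ENNReal.ofReal_le_ofReal ?_
    rw [e1, e2, flipRate, if_pos hx, flipRate, del_of_ne hxu, if_pos hx]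
    exact le_add_of_nonneg_left (abs_nonneg _)
  · refine le_trans ?_ (le_iSup₂ (f := fun (ξ : Config E) (_ : ξ x = false ∧ ξ u = false) =>
      ENNReal.ofReal (|birthRate A x ξ - birthRate A x (ins u ξ)| +
        |deathRate A x (ins x (ins u ξ)) - deathRate A x (ins x ξ)|)) (del u η)
      ⟨by rwa [del_of_ne hxu], del_same _ _⟩)
    refine ENNReal.ofReal_le_ofReal ?_
    rw [hins, flipRate, if_neg (by simp [hx]), flipRate, del_of_ne hxu, if_neg (by simp [hx]),
      abs_sub_comm]
    exact le_add_of_nonneg_right (abs_nonneg _)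

/-- The basic coupling of η and η \ u. A flip at u in either copy removes the discrepancy, at total
rate b + d ≥ ε. Flips at another site i happen together except at the difference of their rates,
which γ(i,u) bounds. -/
theorem isSpinSystem_glauber (hpos : A.IsPositive)
    (hker : ∀ f, A f = 0 → f = 0) (hH : HypothesisH A) (hM : glauberM1 A < ⊤) :
    IsSpinSystem flipMap (fun x => ⟨flipRate A x, continuous_flipRate hpos hker hH hM x⟩)
      (fun x => {x}) (glauberGamma (birthRate A) (deathRate A))
      (glauberEps (birthRate A) (deathRate A)) where
  rate_nonneg x ξ := flipRate_nonneg hpos x ξ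
  move_eq i ξ x hx := flipMap_of_ne (by simpa using hx) ξ
  total_rate := by
    refine ⟨1, fun x => ?_⟩
    have h : ∀ i, (if x ∈ ({i} : Finset E) then
        ‖(⟨flipRate A i, continuous_flipRate hpos hker hH hM i⟩ : C(Config E, ℝ))‖ₑ else 0) ≤
        if i = x then 1 else 0 := by
      intro i
      by_cases hi : i = x
      · subst hi
        simp only [Finset.mem_singleton, if_true]
        rw [← ofReal_norm, ← ENNReal.ofReal_one]
        refine ENNReal.ofReal_le_ofReal ((ContinuousMap.norm_le _ zero_le_one).2 fun ξ => ?_)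
        rw [ContinuousMap.coe_mk, Real.norm_of_nonneg (flipRate_nonneg hpos i ξ)]
        exact flipRate_le_one hpos i ξ
      · simp [hi, Ne.symm hi]
    refine (ENNReal.tsum_le_tsum h).trans ?_
    rw [tsum_ite_eq]
    simp
  rowSup_lt_top := (rowSup_glauberGamma_le hpos hker hH hM).trans_lt
    (ENNReal.mul_lt_top (by simp) hM)
  discrepancy u η hη := by
    have hins : ins u (del u η) = η := by rw [ins_del, ins_eq_self hη]
    refine ⟨fun i x => if i = x then glauberGamma (birthRate A) (deathRate A) x u else 0,
      fun i => if i = u then flipRate A u (del u η) + flipRate A u η else 0,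
      flipRate A u (del u η) + flipRate A u η, fun i x hx => ?_, fun x => ?_, fun i => ?_,
      hasSum_ite_eq u _, ?_, fun f hf i => ?_⟩
    · refine if_neg ?_
      rintro rfl
      simp at hx
    · rw [tsum_ite_eq]
    · have h1 := flipRate_nonneg hpos u (del u η)
      have h2 := flipRate_nonneg hpos u η
      dsimp only
      split_ifs <;> positivity
    · have h1 := flipRate_nonneg hpos u (del u η)
      have h2 := flipRate_nonneg hpos u η
      refine ENNReal.toReal_le_of_le_ofReal (by positivity) ?_
      refine (iInf_le _ u).trans ((iInf₂_le (del u η) (del_same u η)).trans ?_)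
      rw [hins, flipRate, if_neg (by simp), flipRate, if_pos hη]
    · dsimp only
      simp only [rateTerm_apply, ContinuousMap.coe_mk]
      -- For i = u the healing term cancels the two generator terms exactly, so nothing is spread.
      by_cases hi : i = u
      · subst hi
        rw [flipMap_of_true hη, flipMap_of_false (del_same i η), hins, if_pos rfl]
        refine le_trans (le_of_eq ?_) zero_le
        rw [ENNReal.ofReal_eq_zero]
        refine le_of_eq ?_
        ring
      · rw [if_neg hi, zero_mul, add_zero]
        -- A common flip moves to another pair that differs at u, whose discrepancy cannot exceed
        -- the maximal one.
        have hD := hf (flipMap i η)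
        rw [← flipMap_ins hi, ins_eq_self hη, ← flipMap_del hi] at hD
        have h1 := flipRate_nonneg hpos i η
        have h3 : |f (flipMap i (del u η)) - f (del u η)| ≤ oscR f i :=
          abs_sub_le_of_eq_off f fun y hy => flipMap_of_ne hy _
        have h2 : flipRate A i η * (f (flipMap i η) - f η) -
            flipRate A i (del u η) * (f (flipMap i (del u η)) - f (del u η)) ≤
            |flipRate A i η - flipRate A i (del u η)| * oscR f i := by
          have h4 : flipRate A i η * (f (flipMap i η) - f (flipMap i (del u η))) ≤
              flipRate A i η * (f η - f (del u η)) :=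
            mul_le_mul_of_nonneg_left ((le_abs_self _).trans hD) h1
          have h5 : (flipRate A i η - flipRate A i (del u η)) *
              (f (flipMap i (del u η)) - f (del u η)) ≤
              |flipRate A i η - flipRate A i (del u η)| * oscR f i :=
            (le_abs_self _).trans ((abs_mul _ _).le.trans
              (mul_le_mul_of_nonneg_left h3 (abs_nonneg _)))
          linarith
        refine (ENNReal.ofReal_le_ofReal h2).trans ?_
        rw [ENNReal.ofReal_mul (abs_nonneg _), ofReal_oscR]
        refine (mul_le_mul_left (ofReal_abs_flipRate_sub_le hi hη) _).trans ?_
        refine le_trans (le_of_eq ?_) (ENNReal.le_tsum i)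
        rw [if_pos rfl]

theorem glauberTerms_eq (hpos : A.IsPositive)
    (hker : ∀ f, A f = 0 → f = 0) (hH : HypothesisH A) (hM : glauberM1 A < ⊤)
    (f : C(Config E, ℝ)) (ξ : Config E) (x : E) :
    glauberTerms (birthRate A) (deathRate A) f ξ x =
      rateTerm flipMap (fun x => ⟨flipRate A x, continuous_flipRate hpos hker hH hM x⟩) x f ξ := by
  rw [rateTerm_apply, glauberTerms]
  simp only [ContinuousMap.coe_mk, flipRate]
  split_ifs with h
  · rw [flipMap_of_true h]
  · rw [flipMap_of_false (by simpa using h)]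

end Glauber

end DPPDynamics

end

noncomputable section

namespace DPPDynamics

variable {E : Type*} [DecidableEq E]

/-! ### Variation of the jump rates -/

section JumpRates

theorem gFun_eq_mul (t : ℝ) {u v : ℝ} (hu : 0 ≤ u) (hv : 0 ≤ v) :
    gFun t u v = (1 / (1 + u)) ^ t * (1 / (1 + v)) ^ t := by
  rw [gFun, ← Real.mul_rpow (by positivity) (by positivity), one_div_mul_one_div]

theorem one_div_one_add_rpow_mem {t u : ℝ} (ht : 0 ≤ t) (hu : 0 ≤ u) :
    0 ≤ (1 / (1 + u)) ^ t ∧ (1 / (1 + u)) ^ t ≤ 1 :=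
  ⟨by positivity, Real.rpow_le_one (by positivity) (div_le_one_of_le₀ (by linarith)
    (by positivity)) ht⟩

theorem gFun_nonneg {t u v : ℝ} (hu : 0 ≤ u) (hv : 0 ≤ v) : 0 ≤ gFun t u v := by
  rw [gFun]
  positivity

theorem gFun_le_one {t u v : ℝ} (ht : 0 ≤ t) (hu : 0 ≤ u) (hv : 0 ≤ v) : gFun t u v ≤ 1 := by
  rw [gFun_eq_mul t hu hv]
  exact mul_le_one₀ (one_div_one_add_rpow_mem ht hu).2 (one_div_one_add_rpow_mem ht hv).1
    (one_div_one_add_rpow_mem ht hv).2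

/-- The quotient of the two powers is ρ^t with ρ = (1+a)/(1+b) ≤ 1, and ρ^t ≥ ρ for t ≤ 1. This
gives the Lipschitz constant 1 for all t, so a₀ does not depend on t. -/
theorem abs_one_div_one_add_rpow_sub_le {t a b : ℝ} (ht : 0 ≤ t) (ht1 : t ≤ 1) (ha : 0 ≤ a)
    (hab : a ≤ b) : |(1 / (1 + b)) ^ t - (1 / (1 + a)) ^ t| ≤ b - a := by
  have hb := ha.trans hab
  have hle : (1 + a) / (1 + b) ≤ 1 := div_le_one_of_le₀ (by linarith) (by positivity)
  have e : (1 / (1 + b)) ^ t = (1 / (1 + a)) ^ t * ((1 + a) / (1 + b)) ^ t := by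
    rw [← Real.mul_rpow (by positivity) (by positivity)]
    congr 1
    field_simp
  have h1 : (1 + a) / (1 + b) ≤ ((1 + a) / (1 + b)) ^ t := by
    simpa using Real.rpow_le_rpow_of_exponent_ge (by positivity) hle ht1
  have h2 : ((1 + a) / (1 + b)) ^ t ≤ 1 := Real.rpow_le_one (by positivity) hle ht
  have h3 : 1 - (1 + a) / (1 + b) ≤ b - a := by
    rw [one_sub_div (by positivity)]
    calc (1 + b - (1 + a)) / (1 + b) ≤ 1 + b - (1 + a) :=
          div_le_self (by linarith) (by linarith)
      _ = b - a := by ring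
  obtain ⟨h4, h5⟩ := one_div_one_add_rpow_mem ht ha
  rw [e, abs_sub_comm, ← mul_one_sub, abs_of_nonneg (mul_nonneg h4 (by linarith))]
  calc (1 / (1 + a)) ^ t * (1 - ((1 + a) / (1 + b)) ^ t) ≤ 1 * (1 - ((1 + a) / (1 + b)) ^ t) :=
        mul_le_mul_of_nonneg_right h5 (by linarith)
    _ ≤ b - a := by linarith

/-- Changing one factor at a time: the prefactor v costs v - v', and each power costs its own
increment times v' ≤ N. -/
theorem abs_mul_gFun_sub_le {t u u' v v' N : ℝ} (ht : 0 ≤ t) (ht1 : t ≤ 1) (hu' : 0 ≤ u')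
    (hu : u' ≤ u) (hv' : 0 ≤ v') (hv : v' ≤ v) (hN : v ≤ N) :
    |v * gFun t u v - v' * gFun t u' v'| ≤ (1 + N) * ((u - u') + (v - v')) := by
  have hu0 := hu'.trans hu
  have hv0 := hv'.trans hv
  rw [gFun_eq_mul t hu0 hv0, gFun_eq_mul t hu' hv']
  obtain ⟨a1, a2⟩ := one_div_one_add_rpow_mem ht hu0
  obtain ⟨b1, b2⟩ := one_div_one_add_rpow_mem ht hv0
  obtain ⟨c1, c2⟩ := one_div_one_add_rpow_mem ht hu'
  have hA := abs_one_div_one_add_rpow_sub_le ht ht1 hu' hu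
  have hB := abs_one_div_one_add_rpow_sub_le ht ht1 hv' hv
  set a := (1 / (1 + u)) ^ t
  set b := (1 / (1 + v)) ^ t
  set a' := (1 / (1 + u')) ^ t
  set b' := (1 / (1 + v')) ^ t
  have e : v * (a * b) - v' * (a' * b') =
      (v - v') * (a * b) + v' * ((a - a') * b) + v' * (a' * (b - b')) := by ring
  have h1 : |(v - v') * (a * b)| ≤ v - v' := by
    rw [abs_of_nonneg (mul_nonneg (by linarith) (mul_nonneg a1 b1))]
    exact mul_le_of_le_one_right (by linarith) (mul_le_one₀ a2 b1 b2)
  have h2 : |v' * ((a - a') * b)| ≤ N * (u - u') := by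
    rw [abs_mul, abs_mul, abs_of_nonneg hv', abs_of_nonneg b1]
    exact mul_le_mul (hv.trans hN) ((mul_le_of_le_one_right (abs_nonneg _) b2).trans hA)
      (mul_nonneg (abs_nonneg _) b1) (hv0.trans hN)
  have h3 : |v' * (a' * (b - b'))| ≤ N * (v - v') := by
    rw [abs_mul, abs_mul, abs_of_nonneg hv', abs_of_nonneg c1]
    exact mul_le_mul (hv.trans hN) ((mul_le_of_le_one_left (abs_nonneg _) c2).trans hB)
      (mul_nonneg c1 (abs_nonneg _)) (hv0.trans hN)
  rw [e]
  have h4 := abs_add_three ((v - v') * (a * b)) (v' * ((a - a') * b)) (v' * (a' * (b - b')))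
  nlinarith

variable {A : H0 E →L[ℂ] H0 E} {w : E → E → ℝ≥0} {t : ℝ}

theorem jumpRate_ins {x y : E} (hxy : y ≠ x) {ξ : Config E} (hx : ξ x = false)
    (hy : ξ y = false) : jumpRate A w t x y (ins x ξ) =
      w x y * (intensity A y ξ * gFun t (intensity A x ξ) (intensity A y ξ)) := by
  rw [jumpRate, if_pos ⟨ins_same x ξ, by rwa [ins_of_ne hxy]⟩, del_ins, del_eq_self hx, mul_assoc]

theorem jumpRate_eq_zero {x y : E} {ξ : Config E} (h : ¬ (ξ x = true ∧ ξ y = false)) :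
    jumpRate A w t x y ξ = 0 := if_neg h

theorem jumpRate_nonneg (hpos : A.IsPositive) (x y : E) (ξ : Config E) :
    0 ≤ jumpRate A w t x y ξ := by
  rw [jumpRate]
  have h1 := intensity_nonneg hpos x (del x ξ)
  have h2 := intensity_nonneg hpos y (del x ξ)
  have h3 := gFun_nonneg (t := t) h1 h2
  split_ifs <;> positivity

theorem jumpRate_le (hpos : A.IsPositive) (ht : 0 ≤ t) (x y : E) (ξ : Config E) :
    jumpRate A w t x y ξ ≤ w x y * intensity A y (del x ξ) := by
  have h1 := intensity_nonneg hpos x (del x ξ)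
  have h2 := intensity_nonneg hpos y (del x ξ)
  rw [jumpRate]
  split_ifs
  · exact mul_le_of_le_one_right (by positivity) (gFun_le_one ht h1 h2)
  · positivity

theorem ofReal_jumpRate_le (hpos : A.IsPositive) (ht : 0 ≤ t) (x y : E) (ξ : Config E) :
    ENNReal.ofReal (jumpRate A w t x y ξ) ≤ ‖A‖ₑ * if y = x then 0 else (w x y : ℝ≥0∞) := by
  split_ifs with h
  · subst h
    rw [jumpRate_eq_zero (by simp)]
    simp
  · rw [← ofReal_norm, ← ENNReal.ofReal_coe_nnreal, ← ENNReal.ofReal_mul (norm_nonneg _)]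
    refine ENNReal.ofReal_le_ofReal ((jumpRate_le hpos ht x y ξ).trans ?_)
    rw [mul_comm]
    exact mul_le_mul_of_nonneg_right (intensity_le_norm hpos y _) (by positivity)

theorem abs_jumpRate_sub_le (hpos : A.IsPositive) (ht : 0 ≤ t) (ht1 : t ≤ 1) {x y u : E}
    (hyx : y ≠ x) (hux : u ≠ x) (hyu : y ≠ u) {ξ : Config E} (hx : ξ x = false)
    (hy : ξ y = false) :
    |jumpRate A w t x y (ins x ξ) - jumpRate A w t x y (ins x (ins u ξ))| ≤
      (1 + ‖A‖) * (w x y * ((intensity A x ξ - intensity A x (ins u ξ)) +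
        (intensity A y ξ - intensity A y (ins u ξ)))) := by
  rw [jumpRate_ins hyx hx hy, jumpRate_ins hyx (by rwa [ins_of_ne (Ne.symm hux)])
    (by rwa [ins_of_ne hyu]), ← mul_sub, abs_mul, abs_of_nonneg (NNReal.coe_nonneg _),
    mul_left_comm]
  have hle : ∀ z, intensity A z (ins u ξ) ≤ intensity A z ξ := fun z =>
    intensity_anti hpos z fun y hy => by
      by_cases h : y = u
      · rw [h, ins_same]
      · rwa [ins_of_ne h]
  exact mul_le_mul_of_nonneg_left (abs_mul_gFun_sub_le ht ht1 (intensity_nonneg hpos _ _) (hle x)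
    (intensity_nonneg hpos _ _) (hle y) (intensity_le_norm hpos y ξ)) (NNReal.coe_nonneg _)

/-- For y ≠ u the Lipschitz estimate gives 1 + ‖A‖; for y = u the rate itself is at most the weight
times an intensity, with constant 1. The stated constant is larger so that it also covers the factor
2 of the Glauber case. Symmetry of w treats both directions of the jump alike. -/
theorem pairVariation_jumpRate_le (hpos : A.IsPositive) (ht : 0 ≤ t) (ht1 : t ≤ 1)
    (hw : ∀ x y, w x y = w y x) {x y u : E} (hyx : y ≠ x) (hux : u ≠ x) :
    pairVariation (jumpRate A w t) x y u ≤
      ((2 + ‖A‖₊ : ℝ≥0) : ℝ≥0∞) * (w x y * intensityVariation A x y u) := by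
  have hcoe : ((2 + ‖A‖₊ : ℝ≥0) : ℝ) = 2 + ‖A‖ := by simp
  by_cases hyu : y = u
  · subst hyu
    rw [pairVariation, if_pos rfl, pairRate, intensityVariation, if_pos rfl]
    refine iSup₂_le fun ξ hξ => ?_
    refine le_trans ?_ (mul_le_mul_right (mul_le_mul_right (le_iSup₂
      (f := fun (ξ : Config E) (_ : ξ x = false ∧ ξ y = false) =>
        ENNReal.ofReal (intensity A x ξ + intensity A y ξ)) ξ hξ) _) _)
    rw [← ENNReal.ofReal_coe_nnreal, ← ENNReal.ofReal_coe_nnreal,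
      ← ENNReal.ofReal_mul (NNReal.coe_nonneg _), ← ENNReal.ofReal_mul (NNReal.coe_nonneg _)]
    refine ENNReal.ofReal_le_ofReal ?_
    have hx0 := intensity_nonneg hpos x ξ
    have hy0 := intensity_nonneg hpos y ξ
    have h1 := jumpRate_le (w := w) hpos ht x y (ins x ξ)
    have h2 := jumpRate_le (w := w) hpos ht y x (ins y ξ)
    rw [del_ins, del_eq_self hξ.1] at h1
    rw [del_ins, del_eq_self hξ.2, hw y x] at h2
    have h3 : (w x y : ℝ) * (intensity A x ξ + intensity A y ξ) ≤ ((2 + ‖A‖₊ : ℝ≥0) : ℝ) *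
        (w x y * (intensity A x ξ + intensity A y ξ)) :=
      le_mul_of_one_le_left (by positivity) (by rw [hcoe]; linarith [norm_nonneg A])
    refine le_trans (max_le ?_ ?_) h3
    · exact h1.trans (mul_le_mul_of_nonneg_left (by linarith) (NNReal.coe_nonneg _))
    · exact h2.trans (mul_le_mul_of_nonneg_left (by linarith) (NNReal.coe_nonneg _))
  · rw [pairVariation, if_neg hyu, intensityVariation, if_neg hyu]
    refine iSup₂_le fun ξ hξ => ?_
    refine le_trans ?_ (mul_le_mul_right (mul_le_mul_right (le_iSup₂
      (f := fun (ξ : Config E) (_ : ξ x = false ∧ ξ y = false ∧ ξ u = false) =>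
        ENNReal.ofReal ((intensity A x ξ - intensity A x (ins u ξ)) +
        (intensity A y ξ - intensity A y (ins u ξ)))) ξ hξ) _) _)
    rw [← ENNReal.ofReal_coe_nnreal, ← ENNReal.ofReal_coe_nnreal,
      ← ENNReal.ofReal_mul (NNReal.coe_nonneg _), ← ENNReal.ofReal_mul (NNReal.coe_nonneg _), hcoe]
    refine ENNReal.ofReal_le_ofReal ?_
    have h1 := abs_jumpRate_sub_le (w := w) hpos ht ht1 hyx hux hyu hξ.1 hξ.2.1
    have h2 := abs_jumpRate_sub_le (w := w) hpos ht ht1 hyx.symm (Ne.symm hyu) hux.symm hξ.2.1 hξ.1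
    rw [hw y x, add_comm (intensity A y ξ - _)] at h2
    refine (max_le h1 h2).trans (mul_le_mul_of_nonneg_right (by linarith) ?_)
    have h3 := (abs_nonneg _).trans h1
    exact nonneg_of_mul_nonneg_right h3 (by positivity)

theorem rowSup_kawasakiGamma_le (hpos : A.IsPositive) (ht : 0 ≤ t) (ht1 : t ≤ 1)
    (hw : ∀ x y, w x y = w y x) :
    rowSup (kawasakiGamma (jumpRate A w t)) ≤
      ((2 + ‖A‖₊ : ℝ≥0) : ℝ≥0∞) * kawasakiM1 A w := by
  refine iSup_le fun x => ?_
  refine le_trans ?_ (mul_le_mul_right (le_iSup (fun x : E => ∑' u, if u = x then 0 else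
    ∑' y, if y = x then 0 else (w x y : ℝ≥0∞) * intensityVariation A x y u) x) _)
  rw [← ENNReal.tsum_mul_left]
  refine ENNReal.tsum_le_tsum fun u => ?_
  rw [kawasakiGamma]
  split_ifs with hu
  · exact zero_le
  rw [← ENNReal.tsum_mul_left]
  refine ENNReal.tsum_le_tsum fun y => ?_
  split_ifs with hy
  · exact zero_le
  · exact pairVariation_jumpRate_le hpos ht ht1 hw hy hu

end JumpRates

/-! ### Kawasaki dynamics -/

section Kawasaki

variable {A : H0 E →L[ℂ] H0 E} {w : E → E → ℝ≥0} {t : ℝ}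

/-- Both intensities decrease, so each drop is bounded by the sum of the two. The value 0 at u = x
is harmless because x belongs to the excluded set, and it matches the sum in M₁. -/
theorem hasVariation_pair (hpos : A.IsPositive) {x y : E} :
    HasVariation A x {x, y} (fun u => if u = x then 0 else intensityVariation A x y u) ∧
      HasVariation A y {x, y} (fun u => if u = x then 0 else intensityVariation A x y u) := by
  have hle : ∀ z u (ξ : Config E), intensity A z (ins u ξ) ≤ intensity A z ξ := fun z u ξ =>
    intensity_anti hpos z fun y hy => by
      by_cases h : y = u
      · rw [h, ins_same]
      · rwa [ins_of_ne h]
  have key : ∀ u, u ∉ ({x, y} : Finset E) → ∀ ξ : Config E, (∀ z ∈ ({x, y} : Finset E),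
      ξ z = false) → ξ u = false → ENNReal.ofReal ((intensity A x ξ - intensity A x (ins u ξ)) +
        (intensity A y ξ - intensity A y (ins u ξ))) ≤
        if u = x then 0 else intensityVariation A x y u := by
    intro u hu ξ hξ hξu
    simp only [Finset.mem_insert, Finset.mem_singleton, not_or] at hu
    rw [if_neg hu.1, intensityVariation, if_neg (Ne.symm hu.2)]
    exact le_iSup₂ (f := fun (ξ : Config E) (_ : ξ x = false ∧ ξ y = false ∧ ξ u = false) =>
        ENNReal.ofReal ((intensity A x ξ - intensity A x (ins u ξ)) +
        (intensity A y ξ - intensity A y (ins u ξ)))) ξ ⟨hξ x (by simp), hξ y (by simp), hξu⟩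
  refine ⟨fun u hu ξ hξ hξu => ?_, fun u hu ξ hξ hξu => ?_⟩
  · exact (ENNReal.ofReal_le_ofReal (by linarith [hle y u ξ])).trans (key u hu ξ hξ hξu)
  · exact (ENNReal.ofReal_le_ofReal (by linarith [hle x u ξ])).trans (key u hu ξ hξ hξu)

theorem tsum_intensityVariation_lt_top (hM : kawasakiM1 A w < ⊤) {x y : E} (hxy : y ≠ x)
    (hwxy : w x y ≠ 0) : ∑' u, (if u = x then 0 else intensityVariation A x y u) < ⊤ := by
  have h1 : (w x y : ℝ≥0∞) * ∑' u, (if u = x then 0 else intensityVariation A x y u) ≤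
      kawasakiM1 A w := by
    refine le_trans ?_ (le_iSup (fun x : E => ∑' u, if u = x then 0 else
      ∑' y, if y = x then 0 else (w x y : ℝ≥0∞) * intensityVariation A x y u) x)
    rw [← ENNReal.tsum_mul_left]
    refine ENNReal.tsum_le_tsum fun u => ?_
    split_ifs with hu
    · simp
    · refine le_trans (le_of_eq ?_) (ENNReal.le_tsum y)
      rw [if_neg hxy]
  exact (ENNReal.lt_top_of_mul_ne_top_right (h1.trans_lt hM).ne (by simpa using hwxy))

theorem intensity_mul_dualIntensity_of_kawasakiM1 (hpos : A.IsPositive)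
    (hker : ∀ f, A f = 0 → f = 0) (hH : HypothesisH A) (hM : kawasakiM1 A w < ⊤) {x y : E}
    (hxy : y ≠ x) (hwxy : w x y ≠ 0) {ξ : Config E} (hx : ξ x = false) (hy : ξ y = false) :
    intensity A x ξ * dualIntensity A x ξ = 1 :=
  (hasVariation_pair hpos).1.intensity_mul_dualIntensity hpos hker hH
    (tsum_intensityVariation_lt_top hM hxy hwxy) (by simp) (by simp [hx, hy])

theorem continuous_jumpRate (hpos : A.IsPositive) (ht : 0 ≤ t) (hM : kawasakiM1 A w < ⊤)
    (x y : E) : Continuous (jumpRate A w t x y) := by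
  by_cases hxy : y = x
  · subst hxy
    exact continuous_const.congr fun ξ => (jumpRate_eq_zero (by simp)).symm
  -- A pair of weight zero gives no control of the intensities through M₁, but its jump rate
  -- vanishes identically.
  by_cases hwxy : w x y = 0
  · refine (continuous_const (y := (0 : ℝ))).congr fun ξ => ?_
    rw [jumpRate, hwxy]
    simp
  have hδ := tsum_intensityVariation_lt_top hM hxy hwxy
  have h1 := (hasVariation_pair (A := A) (x := x) (y := y) hpos).1.continuous hpos hδ
  have h2 := (hasVariation_pair (A := A) (x := x) (y := y) hpos).2.continuous hpos hδ
  have hg : Continuous fun ξ => gFun t (intensity A x (clearOn {x, y} ξ))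
      (intensity A y (clearOn {x, y} ξ)) := by
    unfold gFun
    have hne : ∀ ξ, (1 + intensity A x (clearOn {x, y} ξ)) *
        (1 + intensity A y (clearOn {x, y} ξ)) ≠ 0 := fun ξ => by
      have i1 := intensity_nonneg hpos x (clearOn {x, y} ξ)
      have i2 := intensity_nonneg hpos y (clearOn {x, y} ξ)
      positivity
    exact (continuous_const.div ((continuous_const.add h1).mul (continuous_const.add h2))
      hne).rpow_const fun _ => Or.inr ht
  have hF : Continuous fun ξ => (w x y : ℝ) * intensity A y (clearOn {x, y} ξ) *
      gFun t (intensity A x (clearOn {x, y} ξ)) (intensity A y (clearOn {x, y} ξ)) :=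
    (continuous_const.mul h2).mul hg
  have h0 : Continuous fun _ : Config E => (0 : ℝ) := continuous_const
  refine (continuous_ite_apply x (continuous_ite_apply y h0 hF) h0).congr fun ξ => ?_
  rw [jumpRate]
  by_cases hx : ξ x = true
  · by_cases hy : ξ y = true
    · simp [hx, hy]
    · have hy' : ξ y = false := by simpa using hy
      have e : del x ξ = clearOn {x, y} ξ := by
        ext1 z
        by_cases hzx : z = x
        · simp [hzx, clearOn]
        · rw [del_of_ne hzx]
          by_cases hzy : z = y
          · simp [hzy, clearOn, hy']
          · simp [hzx, hzy, clearOn]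
      rw [if_pos hx, if_neg hy, if_pos ⟨hx, hy'⟩, e]
  · simp [hx]

/-- The jump of a particle from `p.1` to `p.2`. -/
def jumpMap (p : E × E) : C(Config E, Config E) where
  toFun ξ := ins p.2 (del p.1 ξ)
  continuous_toFun := (continuous_ins p.2).comp (continuous_del p.1)

theorem jumpMap_apply (p : E × E) (ξ : Config E) : jumpMap p ξ = ins p.2 (del p.1 ξ) := rfl

theorem tsum_prod_ite_fst (x : E) (g : E → ℝ≥0∞) :
    ∑' p : E × E, (if p.1 = x then g p.2 else 0) = ∑' y, g y := by
  rw [ENNReal.tsum_prod (f := fun a b => if a = x then g b else 0), ENNReal.tsum_comm]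
  exact tsum_congr fun y => tsum_ite_eq x _

theorem tsum_prod_ite_snd (x : E) (g : E → ℝ≥0∞) :
    ∑' p : E × E, (if p.2 = x then g p.1 else 0) = ∑' y, g y := by
  rw [ENNReal.tsum_prod (f := fun a b => if b = x then g a else 0)]
  exact tsum_congr fun y => tsum_ite_eq x _

/-- The rate at which the discrepancy of `η` and `η \ {u}` at `u` disappears by the move `p`. -/
def coalescenceRate (c : E → E → Config E → ℝ) (u : E) (η : Config E) (p : E × E) : ℝ≥0∞ :=
  (if p.2 = u then ENNReal.ofReal (c p.1 u (del u η)) else 0) +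
    if p.1 = u then ENNReal.ofReal (c u p.2 η) else 0

theorem tsum_coalescenceRate (c : E → E → Config E → ℝ) (u : E) (η : Config E) :
    ∑' p, coalescenceRate c u η p =
      (∑' x, ENNReal.ofReal (c x u (del u η))) + ∑' y, ENNReal.ofReal (c u y η) := by
  simp only [coalescenceRate]
  rw [ENNReal.tsum_add, tsum_prod_ite_snd u fun x => ENNReal.ofReal (c x u (del u η)),
    tsum_prod_ite_fst u fun y => ENNReal.ofReal (c u y η)]

theorem kawasakiEps_le_tsum (c : E → E → Config E → ℝ) {u : E} {η : Config E}
    (hη : η u = true) : kawasakiEps c ≤ ∑' p, coalescenceRate c u η p := by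
  rw [tsum_coalescenceRate]
  refine (iInf_le _ u).trans ((iInf₂_le (del u η) (del_same u η)).trans ?_)
  rw [ins_del, ins_eq_self hη]
  refine add_le_add (ENNReal.tsum_le_tsum fun x => ?_) (ENNReal.tsum_le_tsum fun x => ?_)
  · split_ifs
    exacts [le_rfl, zero_le]
  · split_ifs
    exacts [le_rfl, zero_le]

theorem tsum_coalescenceRate_lt_top (hpos : A.IsPositive) (ht : 0 ≤ t)
    (hw : ∀ x y, w x y = w y x) (hW : (⨆ x, weightSum w x) < ⊤) (u : E) (η : Config E) :
    ∑' p, coalescenceRate (jumpRate A w t) u η p < ⊤ := by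
  have hsum : ∑' y, ‖A‖ₑ * (if y = u then 0 else (w u y : ℝ≥0∞)) < ⊤ := by
    rw [ENNReal.tsum_mul_left]
    exact ENNReal.mul_lt_top (by simp) ((le_iSup (weightSum w) u).trans_lt hW)
  rw [tsum_coalescenceRate, ENNReal.add_lt_top]
  refine ⟨lt_of_le_of_lt (ENNReal.tsum_le_tsum fun x => ?_) hsum,
    lt_of_le_of_lt (ENNReal.tsum_le_tsum fun y => ofReal_jumpRate_le hpos ht u y η) hsum⟩
  refine (ofReal_jumpRate_le hpos ht x u (del u η)).trans (le_of_eq ?_)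
  rw [hw x u]
  simp only [eq_comm]

/-- The rates at which the move `p` spreads the discrepancy of `η` and `η \ {u}` to the
site `z`. -/
def spreadRate (c : E → E → Config E → ℝ) (u : E) (η : Config E) (p : E × E) (z : E) : ℝ≥0∞ :=
  (if p.1 = z then if η z = true ∧ u ≠ z ∧ p.2 ≠ z then pairVariation c z p.2 u else 0 else 0) +
    if p.2 = z then if η z = false ∧ u ≠ z ∧ p.1 ≠ z then pairVariation c z p.1 u else 0 else 0

/-- If z is occupied in η it can only be the start of a relevant jump, if empty only the end. So of
the ordered pairs (z,y) and (y,z) only one counts. -/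
theorem tsum_spreadRate_le (c : E → E → Config E → ℝ) (u : E) (η : Config E) (z : E) :
    ∑' p, spreadRate c u η p z ≤ kawasakiGamma c z u := by
  simp only [spreadRate]
  rw [ENNReal.tsum_add, tsum_prod_ite_fst z fun y =>
      if η z = true ∧ u ≠ z ∧ y ≠ z then pairVariation c z y u else 0,
    tsum_prod_ite_snd z fun y =>
      if η z = false ∧ u ≠ z ∧ y ≠ z then pairVariation c z y u else 0, kawasakiGamma]
  by_cases hu : u = z
  · simp [hu]
  rw [if_neg hu, ← ENNReal.tsum_add]
  refine ENNReal.tsum_le_tsum fun y => ?_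
  by_cases hy : y = z
  · simp [hy]
  rcases Bool.eq_false_or_eq_true (η z) with h | h <;> simp [h, hu, hy]

theorem le_pairVariation (c : E → E → Config E → ℝ) {x y u : E} (hyx : y ≠ x) (hxu : x ≠ u)
    (hyu : y ≠ u) {η : Config E} (hη : η u = true) (hx : η x = true) (hy : η y = false) :
    ENNReal.ofReal |c x y η - c x y (del u η)| ≤ pairVariation c x y u ∧
      ENNReal.ofReal |c x y η - c x y (del u η)| ≤ pairVariation c y x u := by
  have e1 : ins x (ins u (del x (del u η))) = η := by
    rw [ins_comm, ins_del, ← ins_comm, ins_del, ins_eq_self hη, ins_eq_self hx]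
  have e2 : ins x (del x (del u η)) = del u η := by
    rw [ins_del, ins_eq_self]
    rwa [del_of_ne hxu]
  have f1 : del x (del u η) x = false := del_same _ _
  have f2 : del x (del u η) y = false := by rwa [del_of_ne hyx, del_of_ne hyu]
  have f3 : del x (del u η) u = false := by rw [del_comm, del_same]
  rw [pairVariation, if_neg hyu, pairVariation, if_neg hxu]
  constructor
  · refine le_trans ?_ (le_iSup₂ (f := fun (ξ : Config E)
      (_ : ξ x = false ∧ ξ y = false ∧ ξ u = false) => ENNReal.ofReal
        (max |c x y (ins x ξ) - c x y (ins x (ins u ξ))|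
          |c y x (ins y ξ) - c y x (ins y (ins u ξ))|)) (del x (del u η)) ⟨f1, f2, f3⟩)
    rw [e1, e2, abs_sub_comm]
    exact ENNReal.ofReal_le_ofReal (le_max_left _ _)
  · refine le_trans ?_ (le_iSup₂ (f := fun (ξ : Config E)
      (_ : ξ y = false ∧ ξ x = false ∧ ξ u = false) => ENNReal.ofReal
        (max |c y x (ins y ξ) - c y x (ins y (ins u ξ))|
          |c x y (ins x ξ) - c x y (ins x (ins u ξ))|)) (del x (del u η)) ⟨f2, f1, f3⟩)
    rw [e1, e2, abs_sub_comm]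
    exact ENNReal.ofReal_le_ofReal (le_max_right _ _)

/-- A jump from or to u is possible in one copy only: it removes the discrepancy at u and creates
one at the other end, at a rate bounded by `pairRate`. A jump avoiding u is coupled in the two
copies, and only the difference of its rates creates discrepancies, at both of its ends. -/
theorem jump_discrepancy_le {c : E → E → Config E → ℝ} (hc0 : ∀ x y ξ, 0 ≤ c x y ξ)
    (hc : ∀ x y ξ, ¬ (ξ x = true ∧ ξ y = false) → c x y ξ = 0) {u : E} {η : Config E}
    (hη : η u = true) {f : C(Config E, ℝ)}
    (hf : ∀ ξ, |f (ins u ξ) - f (del u ξ)| ≤ f η - f (del u η)) (x y : E) :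
    ENNReal.ofReal (c x y η * (f (ins y (del x η)) - f η) -
        c x y (del u η) * (f (ins y (del x (del u η))) - f (del u η)) +
        (coalescenceRate c u η (x, y)).toReal * (f η - f (del u η))) ≤
      ∑' z, spreadRate c u η (x, y) z * osc f z := by
  have hins : ins u (del u η) = η := by rw [ins_del, ins_eq_self hη]
  have hζ : del u η u = false := del_same u η
  by_cases hyx : y = x
  · subst hyx
    have h0 : ∀ ξ, c y y ξ = 0 := fun ξ => hc y y ξ (by simp)
    have h1 : coalescenceRate c u η (y, y) = 0 := by
      rw [coalescenceRate]
      split_ifs with h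
      · simp only at h
        subst h
        simp [h0]
      · simp
    rw [h0, h0, h1]
    simp
  by_cases hxu : x = u
  · subst hxu
    have e1 : c x y (del x η) = 0 := hc _ _ _ (by simp)
    have e2 : coalescenceRate c x η (x, y) = ENNReal.ofReal (c x y η) := by
      simp [coalescenceRate, hyx]
    rw [e1, e2, ENNReal.toReal_ofReal (hc0 _ _ _), zero_mul, sub_zero, ← mul_add,
      sub_add_sub_cancel]
    by_cases hy : η y = true
    · rw [hc x y η (by simp [hy]), zero_mul, ENNReal.ofReal_zero]
      exact zero_le
    have hy' : η y = false := by simpa using hy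
    have h1 : c x y η * (f (ins y (del x η)) - f (del x η)) ≤ c x y η * oscR f y :=
      mul_le_mul_of_nonneg_left ((le_abs_self _).trans (abs_ins_sub_le f y _)) (hc0 _ _ _)
    refine (ENNReal.ofReal_le_ofReal h1).trans ?_
    rw [ENNReal.ofReal_mul (hc0 _ _ _), ofReal_oscR]
    refine le_trans (mul_le_mul_left ?_ _) (ENNReal.le_tsum y)
    have h2 : spreadRate c x η (x, y) y = pairRate c y x := by
      simp [spreadRate, pairVariation, hy', Ne.symm hyx]
    rw [h2, pairRate]
    refine le_trans (ENNReal.ofReal_le_ofReal ?_) (le_iSup₂ (f := fun (ξ : Config E)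
      (_ : ξ y = false ∧ ξ x = false) => ENNReal.ofReal (max (c y x (ins y ξ)) (c x y (ins x ξ))))
      (del x η) ⟨by rwa [del_of_ne hyx], hζ⟩)
    rw [hins]
    exact le_max_right _ _
  by_cases hyu : y = u
  · subst hyu
    have e1 : c x y η = 0 := hc _ _ _ (by simp [hη])
    have e2 : coalescenceRate c y η (x, y) = ENNReal.ofReal (c x y (del y η)) := by
      simp [coalescenceRate, hxu]
    have e3 : c x y (del y η) * (f η - f (ins y (del x (del y η)))) =
        0 * (f (ins y (del x η)) - f η) - c x y (del y η) *
          (f (ins y (del x (del y η))) - f (del y η)) +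
          c x y (del y η) * (f η - f (del y η)) := by ring
    rw [e1, e2, ENNReal.toReal_ofReal (hc0 _ _ _), ← e3]
    by_cases hx : η x = true
    · have h3 : |f η - f (ins y (del x (del y η)))| ≤ oscR f x := by
        refine abs_sub_le_of_eq_off f fun z hz => ?_
        by_cases hzy : z = y
        · rw [hzy, ins_same, hη]
        · rw [ins_of_ne hzy, del_of_ne hz, del_of_ne hzy]
      refine (ENNReal.ofReal_le_ofReal (mul_le_mul_of_nonneg_left ((le_abs_self _).trans h3)
        (hc0 _ _ _))).trans ?_
      rw [ENNReal.ofReal_mul (hc0 _ _ _), ofReal_oscR]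
      refine le_trans (mul_le_mul_left ?_ _) (ENNReal.le_tsum x)
      have h2 : spreadRate c y η (x, y) x = pairRate c x y := by
        simp [spreadRate, pairVariation, hx, hyx]
      rw [h2, pairRate]
      refine le_trans (ENNReal.ofReal_le_ofReal ?_) (le_iSup₂ (f := fun (ξ : Config E)
        (_ : ξ x = false ∧ ξ y = false) =>
          ENNReal.ofReal (max (c x y (ins x ξ)) (c y x (ins y ξ))))
        (del x (del y η)) ⟨del_same _ _, by rw [del_comm, del_same]⟩)
      rw [ins_del, ins_eq_self (ξ := del y η) (by rwa [del_of_ne hxu])]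
      exact le_max_left _ _
    · rw [hc x y (del y η) (by rw [del_of_ne hxu]; simp [hx]), zero_mul, ENNReal.ofReal_zero]
      exact zero_le
  have e2 : coalescenceRate c u η (x, y) = 0 := by simp [coalescenceRate, hxu, hyu]
  rw [e2, ENNReal.toReal_zero, zero_mul, add_zero]
  by_cases hxy : η x = true ∧ η y = false
  · obtain ⟨hx, hy⟩ := hxy
    have hD := hf (ins y (del x η))
    rw [ins_comm, ins_del_comm (Ne.symm hxu), ins_eq_self hη, ← ins_del_comm hyu, del_comm] at hD
    have h3 : |f (ins y (del x (del u η))) - f (del u η)| ≤ oscR f x + oscR f y := by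
      have h4 := abs_ins_sub_le f y (del x (del u η))
      have h5 : |f (del x (del u η)) - f (del u η)| ≤ oscR f x :=
        abs_sub_le_of_eq_off f fun z hz => del_of_ne hz _
      have h6 := abs_sub_le (f (ins y (del x (del u η)))) (f (del x (del u η))) (f (del u η))
      linarith
    have h2 : c x y η * (f (ins y (del x η)) - f η) -
        c x y (del u η) * (f (ins y (del x (del u η))) - f (del u η)) ≤
        |c x y η - c x y (del u η)| * (oscR f x + oscR f y) := by
      have h4 : c x y η * (f (ins y (del x η)) - f (ins y (del x (del u η)))) ≤
          c x y η * (f η - f (del u η)) :=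
        mul_le_mul_of_nonneg_left ((le_abs_self _).trans hD) (hc0 _ _ _)
      have h5 : (c x y η - c x y (del u η)) * (f (ins y (del x (del u η))) - f (del u η)) ≤
          |c x y η - c x y (del u η)| * (oscR f x + oscR f y) :=
        (le_abs_self _).trans ((abs_mul _ _).le.trans
          (mul_le_mul_of_nonneg_left h3 (abs_nonneg _)))
      linarith
    refine (ENNReal.ofReal_le_ofReal h2).trans ?_
    rw [ENNReal.ofReal_mul (abs_nonneg _), ENNReal.ofReal_add (oscR_nonneg _ _) (oscR_nonneg _ _),
      ofReal_oscR, ofReal_oscR, mul_add]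
    obtain ⟨g1, g2⟩ := le_pairVariation c hyx hxu hyu hη hx hy
    have s1 : spreadRate c u η (x, y) x = pairVariation c x y u := by
      simp [spreadRate, hx, hyx, Ne.symm hxu]
    have s2 : spreadRate c u η (x, y) y = pairVariation c y x u := by
      simp [spreadRate, hy, Ne.symm hyx, Ne.symm hyu]
    refine le_trans ?_ (ENNReal.sum_le_tsum {x, y})
    rw [Finset.sum_pair (Ne.symm hyx), s1, s2]
    exact add_le_add (mul_le_mul_left g1 _) (mul_le_mul_left g2 _)
  · rw [hc x y η hxy, hc x y (del u η) (by rwa [del_of_ne hxu, del_of_ne hyu])]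
    simp

theorem isSpinSystem_kawasaki (hpos : A.IsPositive) (ht : 0 ≤ t) (ht1 : t ≤ 1)
    (hw : ∀ x y, w x y = w y x) (hW : (⨆ x, weightSum w x) < ⊤) (hM : kawasakiM1 A w < ⊤) :
    IsSpinSystem jumpMap
      (fun p => ⟨jumpRate A w t p.1 p.2, continuous_jumpRate hpos ht hM p.1 p.2⟩)
      (fun p => {p.1, p.2}) (kawasakiGamma (jumpRate A w t)) (kawasakiEps (jumpRate A w t)) where
  rate_nonneg p ξ := jumpRate_nonneg hpos p.1 p.2 ξ
  move_eq p ξ x hx := by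
    simp only [Finset.mem_insert, Finset.mem_singleton, not_or] at hx
    rw [jumpMap_apply, ins_of_ne hx.2, del_of_ne hx.1]
  total_rate := by
    -- The factor 2 counts x as the start and as the end of a jump.
    refine ⟨(2 * (‖A‖ₑ * ⨆ x, weightSum w x)).toNNReal, fun x => ?_⟩
    rw [ENNReal.coe_toNNReal (ENNReal.mul_lt_top (by simp)
      (ENNReal.mul_lt_top (by simp) hW)).ne]
    have hr : ∀ p : E × E, ‖(⟨jumpRate A w t p.1 p.2, continuous_jumpRate hpos ht hM p.1 p.2⟩ :
        C(Config E, ℝ))‖ₑ ≤ ‖A‖ₑ * if p.2 = p.1 then 0 else (w p.1 p.2 : ℝ≥0∞) := by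
      intro p
      have hfin : (‖A‖ₑ * if p.2 = p.1 then 0 else (w p.1 p.2 : ℝ≥0∞)) ≠ ⊤ :=
        ENNReal.mul_ne_top (by simp) (by split_ifs <;> simp)
      rw [← ofReal_norm]
      refine ENNReal.ofReal_le_of_le_toReal
        ((ContinuousMap.norm_le _ ENNReal.toReal_nonneg).2 fun ξ => ?_)
      rw [ContinuousMap.coe_mk, Real.norm_of_nonneg (jumpRate_nonneg hpos p.1 p.2 ξ)]
      exact (ENNReal.ofReal_le_iff_le_toReal hfin).1 (ofReal_jumpRate_le hpos ht p.1 p.2 ξ)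
    have hsum : ∑' y, ‖A‖ₑ * (if y = x then 0 else (w x y : ℝ≥0∞)) ≤
        ‖A‖ₑ * ⨆ x, weightSum w x := by
      rw [ENNReal.tsum_mul_left]
      exact mul_le_mul_right (le_iSup (weightSum w) x) _
    calc _ ≤ ∑' p : E × E, ((if p.1 = x then ‖A‖ₑ * (if p.2 = x then 0 else (w x p.2 : ℝ≥0∞))
            else 0) +
          if p.2 = x then ‖A‖ₑ * (if p.1 = x then 0 else (w x p.1 : ℝ≥0∞)) else 0) := by
          refine ENNReal.tsum_le_tsum fun p => ?_
          split_ifs with h1 h2 h3 h4 h5 h6 h7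
          all_goals first
            | exact zero_le
            | (refine (hr p).trans ?_
               simp_all [eq_comm])
      _ ≤ 2 * (‖A‖ₑ * ⨆ x, weightSum w x) := by
          rw [ENNReal.tsum_add, tsum_prod_ite_fst x fun y =>
            ‖A‖ₑ * (if y = x then 0 else (w x y : ℝ≥0∞)), tsum_prod_ite_snd x fun y =>
            ‖A‖ₑ * (if y = x then 0 else (w x y : ℝ≥0∞)), two_mul]
          exact add_le_add hsum hsum
  rowSup_lt_top := (rowSup_kawasakiGamma_le hpos ht ht1 hw).trans_lt
    (ENNReal.mul_lt_top (by simp) hM)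
  discrepancy u η hη := by
    set c := jumpRate A w t with hc
    have hc0 : ∀ x y ξ, 0 ≤ c x y ξ := jumpRate_nonneg hpos
    have hins : ins u (del u η) = η := by rw [ins_del, ins_eq_self hη]
    have hlt := tsum_coalescenceRate_lt_top (w := w) hpos ht hw hW u η
    have hsum : HasSum (fun p => (coalescenceRate c u η p).toReal)
        (∑' p, coalescenceRate c u η p).toReal := by
      rw [ENNReal.tsum_toReal_eq (ENNReal.ne_top_of_tsum_ne_top hlt.ne)]
      exact ENNReal.hasSum_toReal hlt.ne
    refine ⟨spreadRate c u η, fun p => (coalescenceRate c u η p).toReal,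
      (∑' p, coalescenceRate c u η p).toReal, ?_, tsum_spreadRate_le c u η,
      fun p => ENNReal.toReal_nonneg, hsum,
      ENNReal.toReal_mono hlt.ne (kawasakiEps_le_tsum c hη), ?_⟩
    · intro p z hz
      simp only [Finset.mem_insert, Finset.mem_singleton, not_or] at hz
      rw [spreadRate, if_neg (Ne.symm hz.1), if_neg (Ne.symm hz.2), add_zero]
    · rintro f hf ⟨x, y⟩
      exact jump_discrepancy_le hc0 (fun x y ξ h => jumpRate_eq_zero h) hη hf x y

theorem kawasakiTerms_eq (hpos : A.IsPositive) (ht : 0 ≤ t) (hM : kawasakiM1 A w < ⊤)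
    (f : C(Config E, ℝ)) (ξ : Config E) (p : E × E) :
    kawasakiTerms (jumpRate A w t) f ξ p = rateTerm jumpMap
      (fun p => ⟨jumpRate A w t p.1 p.2, continuous_jumpRate hpos ht hM p.1 p.2⟩) p f ξ := by
  rw [rateTerm_apply, kawasakiTerms]
  simp only [ContinuousMap.coe_mk, jumpMap_apply]
  split_ifs with h
  · rfl
  · rw [jumpRate_eq_zero h, zero_mul]

end Kawasaki

end DPPDynamics

end

/-! ### The proposition -/

open DPPDynamics in
theorem proposition3p7 {E : Type*} [Countable E] [DecidableEq E]
    (A : H0 E →L[ℂ] H0 E) (hpos : A.IsPositive) (hker : ∀ f, A f = 0 → f = 0)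
    (hH : HypothesisH A)
    (μ : Measure (Config E)) (hμ : IsDPP (dppKernel A) μ) :
    ∃ a₀ : ℝ≥0,
      -- Glauber dynamics
      (rowSup (glauberGamma (birthRate A) (deathRate A)) ≤ a₀ * glauberM1 A ∧
        (glauberM1 A < ⊤ →
          (∀ x ξ, ξ x = false → IsPapangelou μ x ξ (intensity A x ξ)) ∧
          rowSup (glauberGamma (birthRate A) (deathRate A)) < ⊤ ∧
          ExistenceConclusions (glauberTerms (birthRate A) (deathRate A))
            (glauberGamma (birthRate A) (deathRate A))
            (glauberEps (birthRate A) (deathRate A)))) ∧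
      -- Kawasaki dynamics
      (∀ (t : ℝ), 0 ≤ t → t ≤ 1 → ∀ w : E → E → ℝ≥0, (∀ x y, w x y = w y x) →
        0 < (⨅ x, weightSum w x) → (⨆ x, weightSum w x) < ⊤ →
        (∀ x y u, y ≠ x → u ≠ x →
          pairVariation (jumpRate A w t) x y u ≤ a₀ * (w x y * intensityVariation A x y u)) ∧
        rowSup (kawasakiGamma (jumpRate A w t)) ≤ a₀ * kawasakiM1 A w ∧
        (kawasakiM1 A w < ⊤ →
          (∀ x y ξ, x ≠ y → w x y ≠ 0 → ξ x = false → ξ y = false →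
            IsPapangelou μ x ξ (intensity A x ξ)) ∧
          rowSup (kawasakiGamma (jumpRate A w t)) < ⊤ ∧
          ExistenceConclusions (kawasakiTerms (jumpRate A w t))
            (kawasakiGamma (jumpRate A w t)) (kawasakiEps (jumpRate A w t)))) := by
  refine ⟨2 + ‖A‖₊, ⟨?_, fun hM => ⟨fun x ξ hx => ?_, ?_, ?_⟩⟩, fun t ht ht1 w hw _ hW =>
    ⟨fun x y u hyx hux => pairVariation_jumpRate_le hpos ht ht1 hw hyx hux,
      rowSup_kawasakiGamma_le hpos ht ht1 hw, fun hM => ⟨fun x y ξ hxy hwxy hx hy => ?_, ?_, ?_⟩⟩⟩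
  -- The Glauber bound rests on αβ = 1, hence on finite M₁. For M₁ = ⊤ it is trivial because a₀ ≠ 0,
  -- so that a₀ · ⊤ = ⊤.
  · rcases eq_or_lt_of_le (le_top : glauberM1 A ≤ ⊤) with hM | hM
    · rw [hM, ENNReal.mul_top (by simp)]
      exact le_top
    · refine (rowSup_glauberGamma_le hpos hker hH hM).trans (mul_le_mul_left ?_ _)
      rw [ENNReal.coe_add, ENNReal.coe_ofNat]
      exact le_self_add
  · exact isPapangelou_intensity hpos hker hH hμ hx
      (intensity_mul_dualIntensity_of_glauberM1 hpos hker hH hM hx)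
  · exact (isSpinSystem_glauber hpos hker hH hM).rowSup_lt_top
  · exact (isSpinSystem_glauber hpos hker hH hM).existenceConclusions _
      (glauberTerms_eq hpos hker hH hM)
  · exact isPapangelou_intensity hpos hker hH hμ hx
      (intensity_mul_dualIntensity_of_kawasakiM1 hpos hker hH hM hxy.symm hwxy hx hy)
  · exact (isSpinSystem_kawasaki hpos ht ht1 hw hW hM).rowSup_lt_top
  · exact (isSpinSystem_kawasaki hpos ht ht1 hw hW hM).existenceConclusions _
      (kawasakiTerms_eq hpos ht hM)
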